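/- All vector spaces are over $\mathbb C$. For a vector space $W$ put $\mathcal E(W)=\mathrm{Hom}(W,W((x)))$, and write $a(x)=\sum_{n\in\mathbb Z}a_nx^{-n-1}$ for $a(x)\in\mathcal E(W)$; let $W((x_1,\dots,x_r))=W[[x_1,\dots,x_r]][x_1^{-1},\dots,x_r^{-1}]$. A *nonlocal vertex algebra* is a vector space $V$ with a linear map $Y:V\to\mathcal E(V)$, $v\mapsto Y(v,x)=\sum_n v_nx^{-n-1}$, and a vector $\mathbf 1\in V$ such that $Y(\mathbf 1,x)=1_V$; for all $v\in V$, $Y(v,x)\mathbf 1\in V[[x]]$ has constant term $v$; and for all $u,v,w\in V$ there is $l\ge 0$ with $(x_0+x_2)^lY(u,x_0+x_2)Y(v,x_2)w=(x_0+x_2)^lY(Y(u,x_0)v,x_2)w$. A *quasi $V$-module* structure on $W$ is a linear map $Y_W:V\to\mathcal E(W)$ with $Y_W(\mathbf 1,x)=1_W$ such that for all $u,v\in V$, $w\in W$ there is a nonzero polynomial $f(x_1,x_2)$ with $f(x_0+x_2,x_2)Y_W(u,x_0+x_2)Y_W(v,x_2)w=f(x_0+x_2,x_2)Y_W(Y(u,x_0)v,x_2)w$.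 Here powers of $x_0+x_2$ are expanded in nonnegative powers of $x_2$. A subspace $U\subseteq V$ is *generating* if the only subspace of $V$ that contains $U$ and $\mathbf 1$ and is closed under all products $(a,b)\mapsto a_nb$ $(n\in\mathbb Z)$ is $V$ itself. A finite sequence $\psi^{(1)},\dots,\psi^{(r)}$ in $\mathcal E(W)$ is *quasi compatible* if there is a nonzero polynomial $p(x,y)$ with $\big(\prod_{1\le i<j\le r}p(x_i,x_j)\big)\psi^{(1)}(x_1)\cdots\psi^{(r)}(x_r)\in\mathrm{Hom}(W,W((x_1,\dots,x_r)))$; a subset of $\mathcal E(W)$ is quasi compatible if all finite sequences in it are. For a quasi compatible pair $(a(x),b(x))$, the elements $a(x)_nb(x)\in\mathcal E(W)$ are defined by $$\sum_{n\in\mathbb Z}\big(a(x)_nb(x)\big)x_0^{-n-1}=\iota_{x,x_0}\big(p(x_0+x,x)^{-1}\big)\,\big(p(x_1,x)a(x_1)b(x)\big)\big|_{x_1=x+x_0},$$ where $p$ is any nonzero polynomial with $p(x_1,x_2)a(x_1)b(x_2)\in\mathrm{Hom}(W,W((x_1,x_2)))$, the inverse is taken in the field $\mathbb C((x))((x_0))$,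 and powers of $x+x_0$ are expanded in nonnegative powers of $x_0$; this does not depend on $p$. A quasi compatible subspace is *closed* if it contains $a(x)_nb(x)$ for all its elements $a(x),b(x)$ and all $n\in\mathbb Z$. For a quasi compatible subset $S$ of $\mathcal E(W)$, $\langle S\rangle$ denotes the smallest closed quasi compatible subspace of $\mathcal E(W)$ that contains $S\cup\{1_W\}$. **Theorem.** Let $V$ be a nonlocal vertex algebra, $U$ a generating subspace of $V$, $W$ a vector space, and $Y_W^0:U\to\mathcal E(W)$, $u\mapsto Y_W^0(u,x)=u(x)$, a linear map whose image $Y_W^0(U)$ is quasi compatible. Then $Y_W^0$ extends to a linear map $Y_W:V\to\mathcal E(W)$ such that $(W,Y_W)$ is a quasi $V$-module if and only if there is a linear map $f:V\to\langle Y_W^0(U)\rangle$ with $f(\mathbf 1)=1_W$ and $$f(u_nv)=u(x)_nf(v)\qquad\text{for all }u\in U,\ v\in V,\ n\in\mathbb Z.$$ Moreover, such an extension $Y_W$ is unique if it exists. -/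

import Mathlib

noncomputable section

namespace NonlocalVA

/-! ### Formal series

A formal series in commuting variables `x_1, …, x_r` with coefficients in `W` and arbitrary integer
exponents is the family of its coefficients `(Fin r → ℤ) → W`.  For `r = 2` the variable of index
`0` comes first.  The space `W((x))` is Mathlib's `HahnModule ℤ ℂ W`, and
`Hom(W, W((x)))` is Mathlib's `VertexOperator ℂ W`, whose normalized coefficient
`A[[n]]` is the coefficient of `x ^ (-n-1)`. -/

open scoped VertexOperator

variable {W : Type*} [AddCommGroup W] [Module ℂ W]

/-- The action of the polynomials in `x_1, …, x_r` on `W[[x_1^{±1}, …, x_r^{±1}]]`. -/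
def polyMul {r : ℕ} (p : MvPolynomial (Fin r) ℂ) (F : (Fin r → ℤ) → W) : (Fin r → ℤ) → W :=
  fun m => ∑ s ∈ p.support, p.coeff s • F (fun i => m i - (s i : ℤ))

/-- The space `W((x_1, …, x_r)) = W[[x_1, …, x_r]][x_1⁻¹, …, x_r⁻¹]`, as a subspace of the space of
all formal series: the exponents occurring in the series are uniformly bounded below. -/
def lowerTruncated (W : Type*) [AddCommGroup W] [Module ℂ W] (r : ℕ) :
    Submodule ℂ ((Fin r → ℤ) → W) where
  carrier := {F | ∃ N : ℤ, ∀ m, (∃ i, m i < N) → F m = 0}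
  zero_mem' := ⟨0, fun _ _ => rfl⟩
  add_mem' := by
    rintro F G ⟨N, hN⟩ ⟨M, hM⟩
    refine ⟨min N M, fun m ⟨i, hi⟩ => ?_⟩
    rw [Pi.add_apply, hN m ⟨i, lt_of_lt_of_le hi (min_le_left _ _)⟩,
      hM m ⟨i, lt_of_lt_of_le hi (min_le_right _ _)⟩, add_zero]
  smul_mem' := by
    rintro c F ⟨N, hN⟩
    exact ⟨N, fun m hm => by rw [Pi.smul_apply, hN m hm, smul_zero]⟩

/-- The formal series `ψ_1(x_1) ψ_2(x_2) ⋯ ψ_r(x_r) w`. -/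
def iterProd {r : ℕ} (ψ : Fin r → VertexOperator ℂ W) (w : W) : (Fin r → ℤ) → W :=
  fun m => (List.ofFn fun i => (HVertexOperator.coeff (ψ i) (m i) : Module.End ℂ W)).prod w

/-- For a series `F(x_1, x_2)`, the series `F(x_0 + x_2, x_2)` in `x_0` (index `0`) and `x_2`
(index `1`), where powers of `x_0 + x_2` are expanded in nonnegative powers of `x_2`.  For `F` in
`W((x_1))((x_2))` (the only case in which it is used) each of the sums is finite. -/
def expandFirst (F : (Fin 2 → ℤ) → W) : (Fin 2 → ℤ) → W :=
  fun m => ∑ᶠ k : ℕ, Ring.choose (m 0 + (k : ℤ)) k • F ![m 0 + (k : ℤ), m 1 - (k : ℤ)]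

/-- For a polynomial `p(x_1, x_2)`, the polynomial `p(x_0 + x_2, x_2)` in `x_0` (index `0`) and
`x_2` (index `1`). -/
def polyShift (p : MvPolynomial (Fin 2) ℂ) : MvPolynomial (Fin 2) ℂ :=
  MvPolynomial.aeval ![MvPolynomial.X 0 + MvPolynomial.X 1, MvPolynomial.X 1] p

/-- The operator `1_W`, as an element of `Hom(W, W((x)))`. -/
def idField (W : Type*) [AddCommGroup W] [Module ℂ W] : VertexOperator ℂ W where
  toFun w := HahnModule.of ℂ (HahnSeries.single 0 w)
  map_add' u v := by rw [HahnSeries.single_add, HahnModule.of_add]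
  map_smul' c v := by
    apply HahnModule.ext
    funext n
    change (HahnSeries.single 0 (c • v)).coeff n = c • (HahnSeries.single 0 v).coeff n
    rw [HahnSeries.coeff_single, HahnSeries.coeff_single]
    split_ifs
    · rfl
    · rw [smul_zero]

/-! ### Nonlocal vertex algebras and quasi modules -/

/-- For linear maps `Y : V → Hom(V, V((x)))` and `Z : V → Hom(W, W((x)))`, the series
`Z(Y(u, x_0) v, x_2) w` in `x_0` (index `0`) and `x_2` (index `1`). -/
def nestedProd {V : Type*} [AddCommGroup V] [Module ℂ V] (Y : V →ₗ[ℂ] VertexOperator ℂ V)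
    (Z : V →ₗ[ℂ] VertexOperator ℂ W) (u v : V) (w : W) : (Fin 2 → ℤ) → W :=
  fun m => HVertexOperator.coeff (Z (HVertexOperator.coeff (Y u) (m 0) v)) (m 1) w

/-- A nonlocal vertex algebra structure on the complex vector space `V`. -/
class NonlocalVertexAlgebra (V : Type*) [AddCommGroup V] [Module ℂ V] where
  /-- the vertex operator map `v ↦ Y(v, x)` -/
  Y : V →ₗ[ℂ] VertexOperator ℂ V
  /-- the vacuum vector -/
  vac : V
  /-- `Y(1, x) v = v` -/
  Y_vac : Y vac = idField V
  /-- `Y(v, x) 1 ∈ V[[x]]` -/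
  creation_regular : ∀ v : V, ∀ n : ℤ, n < 0 → HVertexOperator.coeff (Y v) n vac = 0
  /-- the constant term of `Y(v, x) 1` is `v` -/
  creation : ∀ v : V, HVertexOperator.coeff (Y v) 0 vac = v
  /-- `(x_0 + x_2)^l Y(u, x_0 + x_2) Y(v, x_2) w = (x_0 + x_2)^l Y(Y(u, x_0) v, x_2) w` -/
  weak_assoc : ∀ u v w : V, ∃ l : ℕ,
    polyMul ((MvPolynomial.X 0 + MvPolynomial.X 1) ^ l) (expandFirst (iterProd ![Y u, Y v] w)) =
      polyMul ((MvPolynomial.X 0 + MvPolynomial.X 1) ^ l) (nestedProd Y Y u v w)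

open NonlocalVertexAlgebra (Y vac)

/-- `Z : V → Hom(W, W((x)))` makes `W` into a quasi `V`-module: `Z(1, x) = 1_W`, and for all
`u, v, w` there is a nonzero polynomial `f(x_1, x_2)` with
`f(x_0 + x_2, x_2) Z(u, x_0 + x_2) Z(v, x_2) w = f(x_0 + x_2, x_2) Z(Y(u, x_0) v, x_2) w`. -/
structure IsQuasiModule {V : Type*} [AddCommGroup V] [Module ℂ V] [NonlocalVertexAlgebra V]
    (Z : V →ₗ[ℂ] VertexOperator ℂ W) : Prop where
  map_vac : Z vac = idField W
  quasi_assoc : ∀ (u v : V) (w : W), ∃ f : MvPolynomial (Fin 2) ℂ, f ≠ 0 ∧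
    polyMul (polyShift f) (expandFirst (iterProd ![Z u, Z v] w)) =
      polyMul (polyShift f) (nestedProd Y Z u v w)

/-- The subspace of the nonlocal vertex algebra `V` underlying the subalgebra generated by `S`: the
smallest subspace that contains `S` and the vacuum vector and is closed under all the products
`a_n b`. -/
def vertexSubalgebraSpan {V : Type*} [AddCommGroup V] [Module ℂ V] [NonlocalVertexAlgebra V]
    (S : Set V) : Submodule ℂ V :=
  sInf {T : Submodule ℂ V | S ⊆ T ∧ vac ∈ T ∧
    ∀ a ∈ T, ∀ b ∈ T, ∀ n : ℤ, VertexOperator.ncoeff (Y a) n b ∈ T}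

/-! ### Quasi compatibility -/

/-- The finite sequence `ψ_1, …, ψ_r` in `Hom(W, W((x)))` is quasi compatible: for some nonzero
polynomial `p(x, y)`, the product `(∏_{i<j} p(x_i, x_j)) ψ_1(x_1) ⋯ ψ_r(x_r)` lies in
`Hom(W, W((x_1, …, x_r)))`. -/
def QuasiCompatibleSeq {r : ℕ} (ψ : Fin r → VertexOperator ℂ W) : Prop :=
  ∃ p : MvPolynomial (Fin 2) ℂ, p ≠ 0 ∧ ∀ w : W,
    polyMul (∏ i : Fin r, ∏ j ∈ Finset.Ioi i, MvPolynomial.rename ![i, j] p) (iterProd ψ w) ∈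
      lowerTruncated W r

/-- A subset of `Hom(W, W((x)))` is quasi compatible if all finite sequences in it are. -/
def QuasiCompatible (S : Set (VertexOperator ℂ W)) : Prop :=
  ∀ (r : ℕ) (ψ : Fin r → VertexOperator ℂ W), (∀ i, ψ i ∈ S) → QuasiCompatibleSeq ψ

/-- `p ≠ 0` and `p(x_1, x_2) a(x_1) b(x_2) ∈ Hom(W, W((x_1, x_2)))`. -/
def Clears (p : MvPolynomial (Fin 2) ℂ) (a b : VertexOperator ℂ W) : Prop :=
  p ≠ 0 ∧ ∀ w : W, polyMul p (iterProd ![a, b] w) ∈ lowerTruncated W 2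

/-! ### The products `a(x)_n b(x)` -/

/-- For `F(x_1, x) = ∑ F_{m,n} x_1^m x^n`, the coefficient
`∑_m (m choose i) F_{m, k + i - m}` of `x_0^i x^k` in `F(x + x_0, x)`, where powers of `x + x_0` are
expanded in nonnegative powers of `x_0`.  For `F ∈ W((x_1, x))` the sum is finite. -/
def substCoeff (F : (Fin 2 → ℤ) → W) (i k : ℤ) : W :=
  if 0 ≤ i then ∑ᶠ m : ℤ, Ring.choose m i.toNat • F ![m, k + i - m] else 0

lemma substCoeff_finite {F : (Fin 2 → ℤ) → W} (hF : F ∈ lowerTruncated W 2) (i k : ℤ) :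
    (Function.support fun m : ℤ => Ring.choose m i.toNat • F ![m, k + i - m]).Finite := by
  obtain ⟨N, hN⟩ := hF
  refine (Set.finite_Icc N (k + i - N)).subset fun m hm => ?_
  by_contra hc
  apply hm
  have hz : F ![m, k + i - m] = 0 := by
    apply hN
    rw [Set.mem_Icc, not_and_or, not_le, not_le] at hc
    rcases hc with hc | hc
    · exact ⟨0, by simpa using hc⟩
    · exact ⟨1, by simp; omega⟩
  simp only [hz, smul_zero]

lemma substCoeff_bddBelow {F : (Fin 2 → ℤ) → W} (hF : F ∈ lowerTruncated W 2) (i : ℤ) :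
    BddBelow (Function.support (substCoeff F i)) := by
  obtain ⟨N, hN⟩ := hF
  refine ⟨2 * N - i, fun k hk => ?_⟩
  by_contra hc
  apply hk
  rw [substCoeff]
  split_ifs
  · refine finsum_eq_zero_of_forall_eq_zero fun m => ?_
    have hz : F ![m, k + i - m] = 0 := by
      apply hN
      by_cases hm : m < N
      · exact ⟨0, by simpa using hm⟩
      · exact ⟨1, by simp; omega⟩
    rw [hz, smul_zero]
  · rfl

lemma substCoeff_add {F G : (Fin 2 → ℤ) → W} (hF : F ∈ lowerTruncated W 2)
    (hG : G ∈ lowerTruncated W 2) (i k : ℤ) :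
    substCoeff (F + G) i k = substCoeff F i k + substCoeff G i k := by
  unfold substCoeff
  split_ifs
  · rw [← finsum_add_distrib (substCoeff_finite hF i k) (substCoeff_finite hG i k)]
    simp only [Pi.add_apply, smul_add]
  · rw [add_zero]

lemma substCoeff_smul (c : ℂ) (F : (Fin 2 → ℤ) → W) (i k : ℤ) :
    substCoeff (c • F) i k = c • substCoeff F i k := by
  unfold substCoeff
  split_ifs
  · rw [smul_finsum]
    simp only [Pi.smul_apply, smul_comm c]
  · rw [smul_zero]

/-- The space `M((x))` for a module `M` over a commutative ring `R`. -/
abbrev Ser (R M : Type*) [CommRing R] [AddCommGroup M] [Module R M] : Type _ :=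
  HahnModule ℤ R M

/-- The coefficient of `x^i` in an element of `M((x))`. -/
def Ser.coeff {R M : Type*} [CommRing R] [AddCommGroup M] [Module R M] (g : Ser R M) (i : ℤ) : M :=
  ((HahnModule.of R).symm g).coeff i

/-- The product of an element of `R((x))` and an element of `M((x))`. -/
def Ser.mul {R M : Type*} [CommRing R] [AddCommGroup M] [Module R M] (q : LaurentSeries R)
    (g : Ser R M) : Ser R M :=
  q • g

lemma Ser.mul_coeff_add {R M : Type*} [CommRing R] [AddCommGroup M] [Module R M]
    (q : LaurentSeries R) {g h k : Ser R M} (H : ∀ i, k.coeff i = g.coeff i + h.coeff i) (i : ℤ) :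
    (Ser.mul q k).coeff i = (Ser.mul q g).coeff i + (Ser.mul q h).coeff i := by
  have hk : k = g + h := HahnModule.ext _ _ (funext H)
  rw [hk, Ser.mul, smul_add]
  rfl

lemma Ser.mul_coeff_smul {R M : Type*} [CommRing R] [AddCommGroup M] [Module R M]
    (q : LaurentSeries R) {g h : Ser R M} (r : R) (H : ∀ i, h.coeff i = r • g.coeff i) (i : ℤ) :
    (Ser.mul q h).coeff i = r • (Ser.mul q g).coeff i := by
  have hk : h = r • g := HahnModule.ext _ _ (funext H)
  rw [hk, Ser.mul, ← smul_comm r q g]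
  rfl

/-- The space `W((x))((x_0))`; the variable `x_0` is the outer one. -/
abbrev DoubleSeries (W : Type*) [AddCommGroup W] [Module ℂ W] : Type _ :=
  Ser (LaurentSeries ℂ) (Ser ℂ W)

/-- For `F(x_1, x) ∈ W((x_1, x))`, the series `F(x + x_0, x) ∈ W((x))((x_0))`, where powers of
`x + x_0` are expanded in nonnegative powers of `x_0`. -/
def substSeries (F : (Fin 2 → ℤ) → W) (hF : F ∈ lowerTruncated W 2) : DoubleSeries W :=
  HahnModule.of (LaurentSeries ℂ) (HahnSeries.ofSuppBddBelow
    (fun i => HahnModule.of ℂ (HahnSeries.ofSuppBddBelow (substCoeff F i)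
      (substCoeff_bddBelow hF i)))
    ⟨0, fun i hi => by
      by_contra hc
      apply hi
      apply HahnModule.ext
      funext k
      exact if_neg hc⟩)

/-- For an element `t` of a field extension `K` of `ℂ` and a polynomial `p(x_1, x_2)`, the inverse
of `p(x_0 + t, t)` in the field `K((x_0))`. -/
def shiftInv {K : Type*} [Field K] [Algebra ℂ K] (t : K) (p : MvPolynomial (Fin 2) ℂ) :
    LaurentSeries K :=
  (MvPolynomial.eval₂ (HahnSeries.C.comp (algebraMap ℂ K))
    ![HahnSeries.single 1 1 + HahnSeries.C t, HahnSeries.C t] p)⁻¹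

/-- `ι_{x, x_0} (p(x_0 + x, x)⁻¹)`: the inverse of `p(x_0 + x, x)` in the field
`ℂ((x))((x_0))`; the variable `x_0` is the outer one. -/
def iotaInv (p : MvPolynomial (Fin 2) ℂ) : LaurentSeries (LaurentSeries ℂ) :=
  shiftInv (HahnSeries.single 1 1 : LaurentSeries ℂ) p

lemma polyMul_iterProd_add (p : MvPolynomial (Fin 2) ℂ) (a b : VertexOperator ℂ W) (v w : W) :
    polyMul p (iterProd ![a, b] (v + w)) =
      polyMul p (iterProd ![a, b] v) + polyMul p (iterProd ![a, b] w) := by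
  funext m
  simp only [polyMul, iterProd, Pi.add_apply, map_add, smul_add, Finset.sum_add_distrib]

lemma polyMul_iterProd_smul (p : MvPolynomial (Fin 2) ℂ) (a b : VertexOperator ℂ W) (c : ℂ)
    (w : W) : polyMul p (iterProd ![a, b] (c • w)) = c • polyMul p (iterProd ![a, b] w) := by
  funext m
  simp only [polyMul, iterProd, Pi.smul_apply, map_smul, Finset.smul_sum, smul_comm c]

/-- The series
`ι_{x, x_0}(p(x_0 + x, x)⁻¹) ((p(x_1, x) a(x_1) b(x) w)|_{x_1 = x + x_0}) ∈ W((x))((x_0))`,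
where `p` is such that `p(x_1, x_2) a(x_1) b(x_2) ∈ Hom(W, W((x_1, x_2)))`.  This is
`(Y_E(a(x), x_0) b(x)) w`. -/
def YE (p : MvPolynomial (Fin 2) ℂ) (a b : VertexOperator ℂ W) (hp : Clears p a b) (w : W) :
    DoubleSeries W :=
  Ser.mul (iotaInv p) (substSeries (polyMul p (iterProd ![a, b] w)) (hp.2 w))

lemma YE_add (p : MvPolynomial (Fin 2) ℂ) (a b : VertexOperator ℂ W) (hp : Clears p a b)
    (v w : W) (i : ℤ) :
    (YE p a b hp (v + w)).coeff i = (YE p a b hp v).coeff i + (YE p a b hp w).coeff i := by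
  refine Ser.mul_coeff_add _ (fun i => HahnModule.ext _ _ (funext fun k => ?_)) i
  change substCoeff (W := W) _ i k = substCoeff (W := W) _ i k + substCoeff (W := W) _ i k
  rw [polyMul_iterProd_add, substCoeff_add (hp.2 v) (hp.2 w)]

lemma YE_smul (p : MvPolynomial (Fin 2) ℂ) (a b : VertexOperator ℂ W) (hp : Clears p a b)
    (c : ℂ) (w : W) (i : ℤ) :
    (YE p a b hp (c • w)).coeff i = c • (YE p a b hp w).coeff i := by
  have key : ∀ g : Ser ℂ W, (HahnSeries.single (0 : ℤ) c : LaurentSeries ℂ) • g = c • g :=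
    fun g => HahnModule.single_zero_smul_eq_smul ℤ
  refine (Ser.mul_coeff_smul _ (HahnSeries.single (0 : ℤ) c : LaurentSeries ℂ)
    (fun i => ?_) i).trans (key _)
  refine HahnModule.ext _ _ (funext fun k => ?_)
  refine Eq.trans ?_ (congrArg (fun g => Ser.coeff g k) (key _)).symm
  change substCoeff (W := W) _ i k = c • substCoeff (W := W) _ i k
  rw [polyMul_iterProd_smul, substCoeff_smul]

/-- The product `a(x)_n b(x) ∈ Hom(W, W((x)))`, i.e. the coefficient of `x_0 ^ (-n-1)` in
`Y_E(a(x), x_0) b(x)`, computed with the polynomial `p`. -/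
def nthProdWith (p : MvPolynomial (Fin 2) ℂ) (a b : VertexOperator ℂ W) (hp : Clears p a b)
    (n : ℤ) : VertexOperator ℂ W where
  toFun w := (YE p a b hp w).coeff (-n - 1)
  map_add' v w := YE_add p a b hp v w (-n - 1)
  map_smul' c w := YE_smul p a b hp c w (-n - 1)

open Classical in
/-- The product `a(x)_n b(x)` of a quasi compatible ordered pair `(a(x), b(x))`.  The polynomial
used to compute it is immaterial.  (For pairs that are not quasi compatible the product is not
defined; the value `0` is a placeholder that is never used.) -/
def nthProd (a b : VertexOperator ℂ W) (n : ℤ) : VertexOperator ℂ W :=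
  if h : ∃ p, Clears p a b then nthProdWith h.choose a b h.choose_spec n else 0

/-- The quasi compatible subspace `T` of `Hom(W, W((x)))` is closed: `a(x)_n b(x) ∈ T` for all
`a(x), b(x) ∈ T` and all `n`. -/
def IsClosedSubspace (T : Submodule ℂ (VertexOperator ℂ W)) : Prop :=
  ∀ a ∈ T, ∀ b ∈ T, ∀ n : ℤ, nthProd a b n ∈ T

/-- `⟨S⟩`: for a quasi compatible subset `S` of `Hom(W, W((x)))`, the smallest closed quasi
compatible subspace that contains `S` and `1_W`. -/
def generatedSubspace (S : Set (VertexOperator ℂ W)) : Submodule ℂ (VertexOperator ℂ W) :=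
  sInf {T : Submodule ℂ (VertexOperator ℂ W) | QuasiCompatible (T : Set (VertexOperator ℂ W)) ∧
    IsClosedSubspace T ∧ S ⊆ T ∧ idField W ∈ T}

end NonlocalVA

end

noncomputable section

namespace NonlocalVA

set_option linter.unusedSectionVars false

open MvPolynomial (X C rename)

open NonlocalVertexAlgebra (Y vac)

section Series

variable {W W' : Type*} [AddCommGroup W] [Module ℂ W] [AddCommGroup W'] [Module ℂ W'] {r : ℕ}

/-! ### The action of polynomials on formal series -/

/-! A quasi module structure is essentially a homomorphism for the products. If p clears the pair
(a, b), then p(x_0 + x, x) ∑ (a_n b)(x) x_0^{-n-1} equals p(x_1, x) a(x_1) b(x) at x_1 = x + x_0,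
and this relation determines all a_n b (`polyMul_prodSeries`, `eq_prodSeries`). Up to a power of
x_1, which reconciles the two expansions of x_0 + x, it is quasi associativity. So Z(u_n v) = Z(u)_n
Z(v) in a quasi module whenever the pair (Z(u), Z(v)) can be cleared (`IsQuasiModule.map_ncoeff`),
and conversely (`isQuasiModule_of_map_ncoeff`).

Given an extension, the vectors it sends into ⟨Y_W^0(U)⟩ form a subspace containing U and the vacuum
and closed under products, hence all of V; the extension itself is f. Two extensions agree on such a
subspace as well, which gives uniqueness. Given f, the choice v = 1, n = -1 shows that f extends
Y_W^0. The elements a with f(a_n v) = f(a)_n f(v) for all v and n include U and the vacuum. They are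
closed under products (`map_ncoeff_ncoeff`): f is applied to weak associativity in V, and the result
is compared with associativity of the products of fields.

Two facts about fields carry the argument. The first is that ⟨S⟩ is quasi compatible for quasi
compatible S. A maximal quasi compatible set containing S is a closed subspace, because replacing
neighbours a, b in a quasi compatible sequence by a_n b preserves quasi compatibility
(`QuasiCompatibleSeq.nthProd`). That holds because the lowest coefficient in x_0 of the substituted
clearing polynomial is again a product of nonzero polynomials in at most two variables.

The second is associativity in a closed quasi compatible subspace, up to a nonzero polynomial in
three variables (`exists_polyMul_assoc`): both iterated products come from one cleared series for
a(x_1) b(x_2) c(x_3), by substitutions that agree by Vandermonde's identity. Polynomial factors are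
cancelled throughout by their injectivity on iterated Laurent series (`eq_zero_of_polyMul_eq_zero`).
-/

lemma polyMul_eq_sum (p : MvPolynomial (Fin r) ℂ) (F : (Fin r → ℤ) → W) (m : Fin r → ℤ) :
    polyMul p F m = Finsupp.sum (AddMonoidAlgebra.coeff p)
      (fun s c => c • F (fun i => m i - (s i : ℤ))) := by
  rw [MvPolynomial.sum_def]
  rfl

lemma polyMul_add_left (p q : MvPolynomial (Fin r) ℂ) (F : (Fin r → ℤ) → W) :
    polyMul (p + q) F = polyMul p F + polyMul q F := by
  funext m
  rw [Pi.add_apply, polyMul_eq_sum, polyMul_eq_sum, polyMul_eq_sum, AddMonoidAlgebra.coeff_add]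
  exact Finsupp.sum_add_index' (fun _ => zero_smul _ _) (fun _ _ _ => add_smul _ _ _)

lemma polyMul_monomial (s : Fin r →₀ ℕ) (c : ℂ) (F : (Fin r → ℤ) → W) (m : Fin r → ℤ) :
    polyMul (MvPolynomial.monomial s c) F m = c • F (fun i => m i - (s i : ℤ)) := by
  rw [polyMul_eq_sum]
  exact MvPolynomial.sum_monomial_eq (zero_smul _ _)

lemma polyMul_add_right (p : MvPolynomial (Fin r) ℂ) (F G : (Fin r → ℤ) → W) :
    polyMul p (F + G) = polyMul p F + polyMul p G := by
  funext m
  simp [polyMul, Finset.sum_add_distrib]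

@[simp]
lemma polyMul_zero_right (p : MvPolynomial (Fin r) ℂ) :
    polyMul p (0 : (Fin r → ℤ) → W) = 0 := by
  funext m
  simp [polyMul]

lemma polyMul_neg_right (p : MvPolynomial (Fin r) ℂ) (F : (Fin r → ℤ) → W) :
    polyMul p (-F) = -polyMul p F := by
  funext m
  simp [polyMul]

lemma polyMul_sub_right (p : MvPolynomial (Fin r) ℂ) (F G : (Fin r → ℤ) → W) :
    polyMul p (F - G) = polyMul p F - polyMul p G := by
  rw [sub_eq_add_neg, polyMul_add_right, polyMul_neg_right, ← sub_eq_add_neg]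

lemma polyMul_mul (p q : MvPolynomial (Fin r) ℂ) (F : (Fin r → ℤ) → W) :
    polyMul (p * q) F = polyMul p (polyMul q F) := by
  induction p using MvPolynomial.induction_on' with
  | add p₁ p₂ h₁ h₂ => rw [add_mul, polyMul_add_left, h₁, h₂, polyMul_add_left]
  | monomial s c =>
    induction q using MvPolynomial.induction_on' with
    | add p₁ p₂ h₁ h₂ => rw [mul_add, polyMul_add_left, h₁, h₂, polyMul_add_left, polyMul_add_right]
    | monomial t d =>
      funext m
      rw [MvPolynomial.monomial_mul, polyMul_monomial, polyMul_monomial, polyMul_monomial, mul_smul]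
      congr 3
      funext i
      simp only [Finsupp.add_apply]
      push_cast
      ring

lemma polyMul_comm (p q : MvPolynomial (Fin r) ℂ) (F : (Fin r → ℤ) → W) :
    polyMul p (polyMul q F) = polyMul q (polyMul p F) := by
  rw [← polyMul_mul, mul_comm, polyMul_mul]

lemma polyMul_C (c : ℂ) (F : (Fin r → ℤ) → W) : polyMul (C c) F = c • F := by
  funext m
  rw [← MvPolynomial.monomial_zero', polyMul_monomial]
  simp

@[simp]
lemma polyMul_one (F : (Fin r → ℤ) → W) : polyMul 1 F = F := by
  rw [← MvPolynomial.C_1, polyMul_C, one_smul]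

lemma polyMul_X_pow (i : Fin r) (k : ℕ) (F : (Fin r → ℤ) → W) (m : Fin r → ℤ) :
    polyMul (X i ^ k) F m = F (Function.update m i (m i - k)) := by
  rw [MvPolynomial.X_pow_eq_monomial, polyMul_monomial, one_smul]
  congr 1
  funext j
  by_cases h : j = i
  · subst h
    simp
  · simp [h]

lemma polyMul_X (i : Fin r) (F : (Fin r → ℤ) → W) (m : Fin r → ℤ) :
    polyMul (X i) F m = F (Function.update m i (m i - 1)) := by
  simpa using polyMul_X_pow i 1 F m

lemma polyMul_map (A : W →ₗ[ℂ] W') (p : MvPolynomial (Fin r) ℂ) (F : (Fin r → ℤ) → W) :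
    polyMul p (fun m => A (F m)) = fun m => A (polyMul p F m) := by
  funext m
  simp [polyMul]

/-- A family of formal series stable under addition, scalars and multiplication by the variables is
stable under multiplication by polynomials. -/
lemma polyMul_mem (S : Submodule ℂ ((Fin r → ℤ) → W))
    (hX : ∀ i, ∀ F ∈ S, polyMul (X i) F ∈ S) (p : MvPolynomial (Fin r) ℂ) :
    ∀ F ∈ S, polyMul p F ∈ S := by
  induction p using MvPolynomial.induction_on with
  | C c => intro F hF; rw [polyMul_C]; exact S.smul_mem c hF
  | add p q hp hq => intro F hF; rw [polyMul_add_left]; exact S.add_mem (hp F hF) (hq F hF)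
  | mul_X p i hp => intro F hF; rw [polyMul_mul]; exact hp _ (hX i F hF)

lemma polyMul_mem_lowerTruncated (p : MvPolynomial (Fin r) ℂ) {F : (Fin r → ℤ) → W}
    (hF : F ∈ lowerTruncated W r) : polyMul p F ∈ lowerTruncated W r := by
  refine polyMul_mem _ (fun i F hF => ?_) p F hF
  obtain ⟨N, hN⟩ := hF
  refine ⟨N, fun m ⟨j, hj⟩ => ?_⟩
  rw [polyMul_X]
  refine hN _ ⟨j, ?_⟩
  by_cases h : j = i
  · subst h
    simp only [Function.update_self]
    omega
  · simpa [h] using hj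

lemma map_mem_lowerTruncated (A : W →ₗ[ℂ] W') {F : (Fin r → ℤ) → W}
    (hF : F ∈ lowerTruncated W r) : (fun m => A (F m)) ∈ lowerTruncated W' r := by
  obtain ⟨N, hN⟩ := hF
  exact ⟨N, fun m hm => by simp [hN m hm]⟩

/-! ### Two-variable slices -/

/-- The vector of exponents `m` with its entries of index `i` and `j` replaced by `n 0` and `n 1`. -/
def setTwo (i j : Fin r) (m : Fin r → ℤ) (n : Fin 2 → ℤ) : Fin r → ℤ :=
  Function.update (Function.update m i (n 0)) j (n 1)

/-- The series in two variables obtained from `H` by fixing all exponents other than those of the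
variables `x_i` and `x_j` as in `m`. -/
def slice (i j : Fin r) (m : Fin r → ℤ) (H : (Fin r → ℤ) → W) : (Fin 2 → ℤ) → W :=
  fun n => H (setTwo i j m n)

section setTwo
variable {i j : Fin r} (hij : i ≠ j) (m : Fin r → ℤ) (n n' : Fin 2 → ℤ)

include hij in
lemma setTwo_left : setTwo i j m n i = n 0 := by simp [setTwo, hij]

lemma setTwo_right : setTwo i j m n j = n 1 := by simp [setTwo]

lemma setTwo_of_ne {k : Fin r} (hi : k ≠ i) (hj : k ≠ j) : setTwo i j m n k = m k := by
  simp [setTwo, hi, hj]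

lemma setTwo_self : setTwo i j m ![m i, m j] = m := by simp [setTwo]

include hij in
lemma setTwo_setTwo : setTwo i j (setTwo i j m n) n' = setTwo i j m n' := by
  funext k
  by_cases hj : k = j
  · subst hj; simp [setTwo]
  by_cases hi : k = i
  · subst hi; simp [setTwo, hij]
  · simp [setTwo, hi, hj]

include hij in
lemma update_setTwo_left (a : ℤ) : Function.update (setTwo i j m n) i a =
    setTwo i j m (Function.update n 0 a) := by
  funext k
  by_cases hj : k = j
  · subst hj; simp [setTwo, hij.symm]
  by_cases hi : k = i
  · subst hi; simp [setTwo, hij]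
  · simp [setTwo, hi, hj]

lemma update_setTwo_right (a : ℤ) : Function.update (setTwo i j m n) j a =
    setTwo i j m (Function.update n 1 a) := by
  funext k
  by_cases hj : k = j
  · subst hj; simp [setTwo]
  by_cases hi : k = i
  · subst hi; simp [setTwo]
  · simp [setTwo, hi, hj]

lemma update_setTwo_of_ne {k : Fin r} (hi : k ≠ i) (hj : k ≠ j) (a : ℤ) :
    Function.update (setTwo i j m n) k a = setTwo i j (Function.update m k a) n := by
  rw [setTwo, setTwo, Function.update_comm (Ne.symm hj), Function.update_comm (Ne.symm hi)]

end setTwo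

@[simp]
lemma slice_apply (i j : Fin r) (m : Fin r → ℤ) (H : (Fin r → ℤ) → W) :
    slice i j m H ![m i, m j] = H m := by
  rw [slice, setTwo_self]

lemma slice_slice {i j : Fin r} (hij : i ≠ j) (m : Fin r → ℤ) (n : Fin 2 → ℤ)
    (H : (Fin r → ℤ) → W) : slice i j (setTwo i j m n) H = slice i j m H := by
  funext n'
  rw [slice, slice, setTwo_setTwo hij]

lemma ext_slice {i j : Fin r} {G H : (Fin r → ℤ) → W} (h : ∀ m, slice i j m G = slice i j m H) :
    G = H := by
  funext m
  rw [← slice_apply i j m G, h, slice_apply]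

lemma slice_add (i j : Fin r) (m : Fin r → ℤ) (G H : (Fin r → ℤ) → W) :
    slice i j m (G + H) = slice i j m G + slice i j m H := rfl

lemma slice_smul (i j : Fin r) (m : Fin r → ℤ) (c : ℂ) (H : (Fin r → ℤ) → W) :
    slice i j m (c • H) = c • slice i j m H := rfl

lemma slice_X_left {i j : Fin r} (hij : i ≠ j) (m : Fin r → ℤ) (H : (Fin r → ℤ) → W) :
    slice i j m (polyMul (X i) H) = polyMul (X 0) (slice i j m H) := by
  funext n
  rw [slice, polyMul_X, polyMul_X, slice, setTwo_left hij, update_setTwo_left hij]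

lemma slice_X_right {i j : Fin r} (m : Fin r → ℤ) (H : (Fin r → ℤ) → W) :
    slice i j m (polyMul (X j) H) = polyMul (X 1) (slice i j m H) := by
  funext n
  rw [slice, polyMul_X, polyMul_X, slice, setTwo_right, update_setTwo_right]

lemma slice_X_of_ne {i j k : Fin r} (hi : k ≠ i) (hj : k ≠ j) (m : Fin r → ℤ)
    (H : (Fin r → ℤ) → W) :
    slice i j m (polyMul (X k) H) = slice i j (Function.update m k (m k - 1)) H := by
  funext n
  rw [slice, polyMul_X, slice, setTwo_of_ne _ _ hi hj, update_setTwo_of_ne _ _ hi hj]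

/-- A polynomial in x_i and x_j alone does not mix slices. This is the device that reduces
identities in r variables to two variables. -/
lemma slice_rename {i j : Fin r} (hij : i ≠ j) (p : MvPolynomial (Fin 2) ℂ) (m : Fin r → ℤ)
    (H : (Fin r → ℤ) → W) :
    slice i j m (polyMul (rename ![i, j] p) H) = polyMul p (slice i j m H) := by
  induction p using MvPolynomial.induction_on generalizing H with
  | C c => rw [MvPolynomial.rename_C, polyMul_C, polyMul_C, slice_smul]
  | add p q hp hq => rw [map_add, polyMul_add_left, polyMul_add_left, slice_add, hp, hq]
  | mul_X p k hp =>
    rw [map_mul, polyMul_mul, hp, polyMul_mul, MvPolynomial.rename_X]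
    fin_cases k
    · exact congrArg _ (slice_X_left hij m H)
    · exact congrArg _ (slice_X_right m H)

/-! ### Substitutions in two variables -/

/-- The substitution `x_i ↦ x_i + x_j` in polynomials. -/
def shiftVar (i j : Fin r) : MvPolynomial (Fin r) ℂ →ₐ[ℂ] MvPolynomial (Fin r) ℂ :=
  MvPolynomial.aeval (Function.update X i (X i + X j))

lemma shiftVar_X_self (i j : Fin r) : shiftVar i j (X i) = X i + X j := by
  simp [shiftVar]

lemma shiftVar_X_of_ne {i j k : Fin r} (h : k ≠ i) : shiftVar i j (X k) = X k := by
  simp [shiftVar, h]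

lemma shiftVar_C (i j : Fin r) (c : ℂ) : shiftVar i j (C c) = C c := by
  simp [shiftVar]

lemma shiftVar_injective {i j : Fin r} (hij : i ≠ j) : Function.Injective (shiftVar i j) := by
  let b : MvPolynomial (Fin r) ℂ →ₐ[ℂ] MvPolynomial (Fin r) ℂ :=
    MvPolynomial.aeval (Function.update X i (X i - X j))
  have h : b.comp (shiftVar i j) = AlgHom.id ℂ _ := by
    refine MvPolynomial.algHom_ext fun k => ?_
    by_cases hk : k = i
    · subst hk
      simp [shiftVar_X_self, b, hij.symm]
    · simp [shiftVar_X_of_ne hk, b, hk]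
  exact Function.LeftInverse.injective (g := b) fun p => DFunLike.congr_fun h p

lemma shiftVar_ne_zero {i j : Fin r} (hij : i ≠ j) {p : MvPolynomial (Fin r) ℂ} (hp : p ≠ 0) :
    shiftVar i j p ≠ 0 := fun h => hp (shiftVar_injective hij (h.trans (map_zero _).symm))

lemma shiftVar_rename {i j : Fin r} (hij : i ≠ j) (p : MvPolynomial (Fin 2) ℂ) :
    shiftVar i j (rename ![i, j] p) = rename ![i, j] (polyShift p) := by
  have : (shiftVar i j).comp (rename ![i, j]) =
      (rename ![i, j]).comp (MvPolynomial.aeval ![X 0 + X 1, X 1]) := by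
    refine MvPolynomial.algHom_ext fun k => ?_
    fin_cases k
    · simp [shiftVar_X_self]
    · simp [shiftVar_X_of_ne hij.symm]
  exact DFunLike.congr_fun this p

lemma shiftVar_zero_one (p : MvPolynomial (Fin 2) ℂ) : shiftVar 0 1 p = polyShift p := by
  have : shiftVar (0 : Fin 2) 1 = MvPolynomial.aeval ![X 0 + X 1, X 1] := by
    refine MvPolynomial.algHom_ext fun k => ?_
    fin_cases k
    · simp [shiftVar_X_self]
    · simp [shiftVar_X_of_ne]
  exact DFunLike.congr_fun this p

lemma polyShift_ne_zero {p : MvPolynomial (Fin 2) ℂ} (hp : p ≠ 0) : polyShift p ≠ 0 := by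
  rw [← shiftVar_zero_one]
  exact shiftVar_ne_zero (by decide) hp

lemma rename_pair_ne_zero {i j : Fin r} (hij : i ≠ j) {p : MvPolynomial (Fin 2) ℂ} (hp : p ≠ 0) :
    rename ![i, j] p ≠ 0 := by
  have hinj : Function.Injective ![i, j] := by
    intro a b
    fin_cases a <;> fin_cases b <;> simp [hij, hij.symm]
  exact fun h => hp (MvPolynomial.rename_injective _ hinj (h.trans (map_zero _).symm))

lemma choose_succ_eq (m : ℤ) {i : ℤ} (hi : 0 < i) :
    Ring.choose (m + 1) i.toNat = Ring.choose m (i - 1).toNat + Ring.choose m i.toNat := by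
  obtain ⟨k, rfl⟩ : ∃ k : ℕ, i = k + 1 := ⟨(i - 1).toNat, by omega⟩
  have h1 : ((k : ℤ) + 1).toNat = k + 1 := by omega
  have h2 : ((k : ℤ) + 1 - 1).toNat = k := by omega
  rw [h1, h2, Ring.choose_succ_succ]

lemma substCoeff_X_one (F : (Fin 2 → ℤ) → W) (i k : ℤ) :
    substCoeff (polyMul (X 1) F) i k = substCoeff F i (k - 1) := by
  unfold substCoeff
  split_ifs
  · refine finsum_congr fun m => ?_
    rw [polyMul_X]
    congr 2
    funext l
    fin_cases l
    · simp
    · simp; ring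
  · rfl

/-- The factor x_1 becomes x + x_0, which on coefficients is Pascal's rule after a shift of the
summation index. Truncation makes the two resulting sums finite, so that they may be separated. -/
lemma substCoeff_X_zero {F : (Fin 2 → ℤ) → W} (hF : F ∈ lowerTruncated W 2) (i k : ℤ) :
    substCoeff (polyMul (X 0) F) i k = substCoeff F (i - 1) k + substCoeff F i (k - 1) := by
  have hterm : ∀ m : ℤ, polyMul (X 0) F ![m + 1, k + i - (m + 1)] = F ![m, k - 1 + i - m] := by
    intro m
    rw [polyMul_X]
    congr 1
    funext l
    fin_cases l
    · simp
    · simp; ring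
  have key : ∀ (h : 0 ≤ i), substCoeff (polyMul (X 0) F) i k =
      ∑ᶠ m : ℤ, Ring.choose (m + 1) i.toNat • F ![m, k - 1 + i - m] := by
    intro h
    rw [substCoeff, if_pos h, ← finsum_comp_equiv (Equiv.addRight (1 : ℤ))]
    exact finsum_congr fun m => by rw [Equiv.coe_addRight, hterm]
  rcases lt_trichotomy i 0 with h | h | h
  · have h' : ¬ (0 ≤ i) := by omega
    have h'' : ¬ (0 ≤ i - 1) := by omega
    rw [substCoeff, substCoeff, substCoeff, if_neg h', if_neg h'', if_neg h', add_zero]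
  · subst h
    rw [key le_rfl]
    simp [substCoeff]
  · have h0 : 0 ≤ i := h.le
    have h' : 0 ≤ i - 1 := by omega
    have e : substCoeff F (i - 1) k =
        ∑ᶠ m : ℤ, Ring.choose m (i - 1).toNat • F ![m, k - 1 + i - m] := by
      rw [substCoeff, if_pos h']
      exact finsum_congr fun m => by rw [show k + (i - 1) - m = k - 1 + i - m by ring]
    have f1 : (Function.support fun m : ℤ =>
        Ring.choose m (i - 1).toNat • F ![m, k - 1 + i - m]).Finite := by
      refine (substCoeff_finite hF (i - 1) k).subset fun m hm => ?_
      rw [Function.mem_support] at hm ⊢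
      rwa [show k + (i - 1) - m = k - 1 + i - m by ring]
    rw [key h0, e, substCoeff, if_pos h0,
      ← finsum_add_distrib f1 (substCoeff_finite hF i (k - 1))]
    exact finsum_congr fun m => by rw [choose_succ_eq m h, add_smul]

lemma substCoeff_map (A : W →ₗ[ℂ] W') {F : (Fin 2 → ℤ) → W} (hF : F ∈ lowerTruncated W 2)
    (i k : ℤ) : substCoeff (fun m => A (F m)) i k = A (substCoeff F i k) := by
  unfold substCoeff
  split_ifs
  · refine Eq.trans ?_ (AddMonoidHom.map_finsum A.toAddMonoidHom (substCoeff_finite hF i k)).symm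
    exact finsum_congr fun m => (map_zsmul A _ _).symm
  · rw [map_zero]

/-- The formal series all of whose slices in the variables `x_i, x_j` lie in `W((x_i, x_j))`. -/
def sliceTruncated (W : Type*) [AddCommGroup W] [Module ℂ W] (i j : Fin r) :
    Submodule ℂ ((Fin r → ℤ) → W) where
  carrier := {H | ∀ m, slice i j m H ∈ lowerTruncated W 2}
  zero_mem' := fun _ => (lowerTruncated W 2).zero_mem
  add_mem' := fun hF hG m => (lowerTruncated W 2).add_mem (hF m) (hG m)
  smul_mem' := fun c _ hF m => (lowerTruncated W 2).smul_mem c (hF m)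

lemma polyMul_mem_sliceTruncated {i j : Fin r} (hij : i ≠ j) (p : MvPolynomial (Fin r) ℂ)
    {H : (Fin r → ℤ) → W} (hH : H ∈ sliceTruncated W i j) :
    polyMul p H ∈ sliceTruncated W i j := by
  refine polyMul_mem _ (fun k F hF m => ?_) p H hH
  by_cases hi : k = i
  · subst hi
    rw [slice_X_left hij]
    exact polyMul_mem_lowerTruncated _ (hF m)
  by_cases hj : k = j
  · subst hj
    rw [slice_X_right]
    exact polyMul_mem_lowerTruncated _ (hF m)
  rw [slice_X_of_ne hi hj]
  exact hF _

/-- For a series `H` and distinct variables `x_i`, `x_j`, the series `H` with `x_j + x_i`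
substituted for `x_i`, where powers of `x_j + x_i` are expanded in nonnegative powers of `x_i`. -/
def substVar (i j : Fin r) (H : (Fin r → ℤ) → W) : (Fin r → ℤ) → W :=
  fun m => substCoeff (slice i j m H) (m i) (m j)

/-- For a series `H` and distinct variables `x_i`, `x_j`, the series `H` with `x_i + x_j`
substituted for `x_i`, where powers of `x_i + x_j` are expanded in nonnegative powers of `x_j`. -/
def expandVar (i j : Fin r) (H : (Fin r → ℤ) → W) : (Fin r → ℤ) → W :=
  fun m => expandFirst (slice i j m H) ![m i, m j]

lemma slice_zero_one (m : Fin 2 → ℤ) (H : (Fin 2 → ℤ) → W) : slice 0 1 m H = H := by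
  funext n
  rw [slice]
  congr 1
  funext k
  fin_cases k
  · simp [setTwo]
  · simp [setTwo]

lemma slice_substVar {i j : Fin r} (hij : i ≠ j) (m : Fin r → ℤ) (H : (Fin r → ℤ) → W) :
    slice i j m (substVar i j H) = substVar 0 1 (slice i j m H) := by
  funext n
  rw [slice, substVar, slice_slice hij, substVar, slice_zero_one, setTwo_left hij, setTwo_right]

lemma substVar_map (A : W →ₗ[ℂ] W') {i j : Fin r} {H : (Fin r → ℤ) → W}
    (hH : H ∈ sliceTruncated W i j) :
    substVar i j (fun m => A (H m)) = fun m => A (substVar i j H m) := by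
  funext m
  exact substCoeff_map A (hH m) _ _

lemma substVar_add {i j : Fin r} {G H : (Fin r → ℤ) → W} (hG : G ∈ sliceTruncated W i j)
    (hH : H ∈ sliceTruncated W i j) :
    substVar i j (G + H) = substVar i j G + substVar i j H := by
  funext m
  exact substCoeff_add (hG m) (hH m) _ _

/-- It suffices to multiply by one variable at a time: x_i is Pascal's rule, x_j shifts an exponent,
and any other variable only changes the slice. -/
lemma substVar_polyMul {i j : Fin r} (hij : i ≠ j) (p : MvPolynomial (Fin r) ℂ) :
    ∀ {H : (Fin r → ℤ) → W}, H ∈ sliceTruncated W i j →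
      substVar i j (polyMul p H) = polyMul (shiftVar i j p) (substVar i j H) := by
  induction p using MvPolynomial.induction_on with
  | C c =>
    intro H hH
    rw [shiftVar_C, polyMul_C, polyMul_C]
    funext m
    exact substCoeff_smul c _ _ _
  | add p q hp hq =>
    intro H hH
    rw [polyMul_add_left, map_add, polyMul_add_left, substVar_add
      (polyMul_mem_sliceTruncated hij _ hH) (polyMul_mem_sliceTruncated hij _ hH), hp hH, hq hH]
  | mul_X p k hp =>
    intro H hH
    rw [polyMul_mul, hp (polyMul_mem_sliceTruncated hij _ hH), map_mul, polyMul_mul]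
    congr 1
    by_cases hi : k = i
    · subst hi
      rw [shiftVar_X_self, polyMul_add_left]
      funext m
      rw [Pi.add_apply, polyMul_X, polyMul_X, substVar, slice_X_left hij,
        substCoeff_X_zero (hH m)]
      simp only [substVar]
      congr 1
      -- A slice ignores the entries of m at i and j, so lowering one of them leaves the slice
      -- unchanged.
      · rw [Function.update_self, Function.update_of_ne hij.symm, ← slice_slice hij m ![m k - 1, m j] ]
        congr 2
        simp [setTwo, hij.symm]
      · rw [Function.update_self, Function.update_of_ne hij, ← slice_slice hij m ![m k, m j - 1] ]
        congr 2
        simp [setTwo]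
    rw [shiftVar_X_of_ne hi]
    funext m
    rw [polyMul_X]
    by_cases hj : k = j
    · subst hj
      rw [substVar, slice_X_right, substCoeff_X_one, substVar, Function.update_self,
        Function.update_of_ne hij, ← slice_slice hij m ![m i, m k - 1] ]
      congr 2
      simp [setTwo]
    · rw [substVar, slice_X_of_ne hi hj, substVar, Function.update_of_ne (Ne.symm hi),
        Function.update_of_ne (Ne.symm hj)]

/-! ### Expansion in the other direction -/

/-- The formal series in two variables in which the exponents of the second variable are bounded
below. -/
def boundedSecond (W : Type*) [AddCommGroup W] [Module ℂ W] :
    Submodule ℂ ((Fin 2 → ℤ) → W) where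
  carrier := {F | ∃ N : ℤ, ∀ m, m 1 < N → F m = 0}
  zero_mem' := ⟨0, fun _ _ => rfl⟩
  add_mem' := by
    rintro F G ⟨N, hN⟩ ⟨M, hM⟩
    refine ⟨min N M, fun m hi => ?_⟩
    rw [Pi.add_apply, hN m (lt_of_lt_of_le hi (min_le_left _ _)),
      hM m (lt_of_lt_of_le hi (min_le_right _ _)), add_zero]
  smul_mem' := by
    rintro c F ⟨N, hN⟩
    exact ⟨N, fun m hm => by rw [Pi.smul_apply, hN m hm, smul_zero]⟩

lemma expandFirst_finite {F : (Fin 2 → ℤ) → W} (hF : F ∈ boundedSecond W) (m : Fin 2 → ℤ) :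
    (Function.support fun k : ℕ =>
      Ring.choose (m 0 + (k : ℤ)) k • F ![m 0 + (k : ℤ), m 1 - (k : ℤ)]).Finite := by
  obtain ⟨N, hN⟩ := hF
  refine (Set.finite_Iic (m 1 - N).toNat).subset fun k hk => ?_
  by_contra hc
  apply hk
  have hz : F ![m 0 + (k : ℤ), m 1 - (k : ℤ)] = 0 := by
    apply hN
    simp only [Set.mem_Iic, not_le] at hc
    simp
    omega
  simp only [hz, smul_zero]

lemma expandFirst_add {F G : (Fin 2 → ℤ) → W} (hF : F ∈ boundedSecond W)
    (hG : G ∈ boundedSecond W) :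
    expandFirst (F + G) = expandFirst F + expandFirst G := by
  funext m
  unfold expandFirst
  rw [Pi.add_apply, ← finsum_add_distrib (expandFirst_finite hF m) (expandFirst_finite hG m)]
  simp only [Pi.add_apply, smul_add]

lemma expandFirst_smul (c : ℂ) (F : (Fin 2 → ℤ) → W) :
    expandFirst (c • F) = c • expandFirst F := by
  funext m
  unfold expandFirst
  rw [Pi.smul_apply, smul_finsum]
  simp only [Pi.smul_apply, smul_comm c]

lemma expandFirst_map (A : W →ₗ[ℂ] W') {F : (Fin 2 → ℤ) → W} (hF : F ∈ boundedSecond W) :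
    expandFirst (fun m => A (F m)) = fun m => A (expandFirst F m) := by
  funext m
  unfold expandFirst
  refine Eq.trans ?_ (AddMonoidHom.map_finsum A.toAddMonoidHom (expandFirst_finite hF m)).symm
  exact finsum_congr fun k => (map_zsmul A _ _).symm

lemma expandFirst_X_one (F : (Fin 2 → ℤ) → W) (a b : ℤ) :
    expandFirst (polyMul (X 1) F) ![a, b] = expandFirst F ![a, b - 1] := by
  unfold expandFirst
  refine finsum_congr fun k => ?_
  rw [polyMul_X]
  congr 2
  funext l
  fin_cases l
  · simp
  · simp; ring

lemma expandFirst_X_zero {F : (Fin 2 → ℤ) → W} (hF : F ∈ boundedSecond W) (a b : ℤ) :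
    expandFirst (polyMul (X 0) F) ![a, b] =
      expandFirst F ![a - 1, b] + expandFirst F ![a, b - 1] := by
  have hf := expandFirst_finite hF
  have f1 := hf ![a - 1, b]
  have f2 := hf ![a, b - 1]
  simp only [expandFirst, Matrix.cons_val_zero, Matrix.cons_val_one] at f1 f2 ⊢
  -- The term k = 0 is split off so that Pascal's rule can be applied to the binomials with lower
  -- index k + 1.
  have hsucc : ∀ g : ℕ → W, (Function.support g).Finite →
      ∑ᶠ k, g k = g 0 + ∑ᶠ k, g (k + 1) := by
    intro g hg
    obtain ⟨n, hn⟩ := hg.bddAbove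
    have e1 : ∑ᶠ k, g k = ∑ k ∈ Finset.range (n + 2), g k :=
      finsum_eq_sum_of_support_subset _ fun k hk => by
        have := hn hk
        simp; omega
    have e2 : ∑ᶠ k, g (k + 1) = ∑ k ∈ Finset.range (n + 1), g (k + 1) :=
      finsum_eq_sum_of_support_subset _ fun k hk => by
        have : k + 1 ≤ n := hn hk
        simp; omega
    rw [e1, e2, Finset.sum_range_succ', add_comm]
  have hG : polyMul (X 0) F ∈ boundedSecond W := by
    obtain ⟨N, hN⟩ := hF
    exact ⟨N, fun m hm => by rw [polyMul_X]; exact hN _ (by simpa using hm)⟩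
  have f3 := expandFirst_finite hG ![a, b]
  simp only [Matrix.cons_val_zero, Matrix.cons_val_one] at f3
  have hterm : ∀ k : ℕ, polyMul (X 0) F ![a + k, b - k] = F ![a - 1 + k, b - k] := by
    intro k
    rw [polyMul_X]
    congr 1
    funext l
    fin_cases l
    · simp; ring
    · simp
  simp only [hterm] at f3 ⊢
  rw [hsucc _ f3, hsucc _ f1, add_assoc]
  have f1' : (Function.support fun k : ℕ => Ring.choose (a - 1 + ((k + 1 : ℕ) : ℤ)) (k + 1) •
      F ![a - 1 + ((k + 1 : ℕ) : ℤ), b - ((k + 1 : ℕ) : ℤ)]).Finite :=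
    f1.preimage (f := fun k : ℕ => k + 1) (fun x _ y _ h => by simpa using h)
  rw [← finsum_add_distrib f1' f2]
  congr 1
  · simp
  · refine finsum_congr fun k => ?_
    have e0 : a + ((k + 1 : ℕ) : ℤ) = a + k + 1 := by push_cast; ring
    have e1 : a - 1 + ((k + 1 : ℕ) : ℤ) = a + k := by push_cast; ring
    have e2 : b - ((k + 1 : ℕ) : ℤ) = b - 1 - k := by push_cast; ring
    rw [e0, e1, e2, Ring.choose_succ_succ, add_smul, add_comm]

/-- The formal series all of whose slices in the variables `x_i, x_j` have exponents of `x_j`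
bounded below. -/
def sliceBounded (W : Type*) [AddCommGroup W] [Module ℂ W] (i j : Fin r) :
    Submodule ℂ ((Fin r → ℤ) → W) where
  carrier := {H | ∀ m, slice i j m H ∈ boundedSecond W}
  zero_mem' := fun _ => (boundedSecond W).zero_mem
  add_mem' := fun hF hG m => (boundedSecond W).add_mem (hF m) (hG m)
  smul_mem' := fun c _ hF m => (boundedSecond W).smul_mem c (hF m)

lemma polyMul_mem_boundedSecond (p : MvPolynomial (Fin 2) ℂ) {F : (Fin 2 → ℤ) → W}
    (hF : F ∈ boundedSecond W) : polyMul p F ∈ boundedSecond W := by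
  refine polyMul_mem _ (fun i F hF => ?_) p F hF
  obtain ⟨N, hN⟩ := hF
  refine ⟨N, fun m hm => ?_⟩
  rw [polyMul_X]
  refine hN _ ?_
  fin_cases i
  · simpa using hm
  · simp; omega

lemma polyMul_mem_sliceBounded {i j : Fin r} (hij : i ≠ j) (p : MvPolynomial (Fin r) ℂ)
    {H : (Fin r → ℤ) → W} (hH : H ∈ sliceBounded W i j) :
    polyMul p H ∈ sliceBounded W i j := by
  refine polyMul_mem _ (fun k F hF m => ?_) p H hH
  by_cases hi : k = i
  · subst hi
    rw [slice_X_left hij]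
    exact polyMul_mem_boundedSecond _ (hF m)
  by_cases hj : k = j
  · subst hj
    rw [slice_X_right]
    exact polyMul_mem_boundedSecond _ (hF m)
  rw [slice_X_of_ne hi hj]
  exact hF _

/-- The counterpart of `substVar_polyMul` for the opposite direction of expansion; finiteness of the
sums now needs a lower bound for the exponents of x_j only. -/
lemma expandVar_polyMul {i j : Fin r} (hij : i ≠ j) (p : MvPolynomial (Fin r) ℂ) :
    ∀ {H : (Fin r → ℤ) → W}, H ∈ sliceBounded W i j →
      expandVar i j (polyMul p H) = polyMul (shiftVar i j p) (expandVar i j H) := by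
  induction p using MvPolynomial.induction_on with
  | C c =>
    intro H hH
    rw [shiftVar_C, polyMul_C, polyMul_C]
    funext m
    exact congrFun (expandFirst_smul c _) _
  | add p q hp hq =>
    intro H hH
    rw [polyMul_add_left, map_add, polyMul_add_left, ← hp hH, ← hq hH]
    funext m
    exact congrFun (expandFirst_add (polyMul_mem_sliceBounded hij _ hH m)
      (polyMul_mem_sliceBounded hij _ hH m)) _
  | mul_X p k hp =>
    intro H hH
    rw [polyMul_mul, hp (polyMul_mem_sliceBounded hij _ hH), map_mul, polyMul_mul]
    congr 1
    by_cases hi : k = i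
    · subst hi
      rw [shiftVar_X_self, polyMul_add_left]
      funext m
      rw [Pi.add_apply, polyMul_X, polyMul_X, expandVar, slice_X_left hij,
        expandFirst_X_zero (hH m)]
      simp only [expandVar]
      congr 1
      · rw [Function.update_self, Function.update_of_ne hij.symm,
          ← slice_slice hij m ![m k - 1, m j] ]
        congr 2
        simp [setTwo, hij.symm]
      · rw [Function.update_self, Function.update_of_ne hij, ← slice_slice hij m ![m k, m j - 1] ]
        congr 2
        simp [setTwo]
    rw [shiftVar_X_of_ne hi]
    funext m
    rw [polyMul_X]
    by_cases hj : k = j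
    · subst hj
      rw [expandVar, slice_X_right, expandFirst_X_one, expandVar, Function.update_self,
        Function.update_of_ne hij, ← slice_slice hij m ![m i, m k - 1] ]
      congr 2
      simp [setTwo]
    · rw [expandVar, slice_X_of_ne hi hj, expandVar, Function.update_of_ne (Ne.symm hi),
        Function.update_of_ne (Ne.symm hj)]

/-- The formal series such that, for each fixed exponent of `x_i`, the exponents of all the other
variables are bounded below. -/
def levelTruncated (W : Type*) [AddCommGroup W] [Module ℂ W] (i : Fin r) :
    Submodule ℂ ((Fin r → ℤ) → W) where
  carrier := {H | ∀ n : ℤ, ∃ N : ℤ, ∀ m : Fin r → ℤ, m i = n → (∃ k, m k < N) → H m = 0}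
  zero_mem' := fun _ => ⟨0, fun _ _ _ => rfl⟩
  add_mem' := by
    intro F G hF hG n
    obtain ⟨N, hN⟩ := hF n
    obtain ⟨M, hM⟩ := hG n
    refine ⟨min N M, fun m hm ⟨k, hk⟩ => ?_⟩
    rw [Pi.add_apply, hN m hm ⟨k, lt_of_lt_of_le hk (min_le_left _ _)⟩,
      hM m hm ⟨k, lt_of_lt_of_le hk (min_le_right _ _)⟩, add_zero]
  smul_mem' := by
    intro c F hF n
    obtain ⟨N, hN⟩ := hF n
    exact ⟨N, fun m hm hk => by rw [Pi.smul_apply, hN m hm hk, smul_zero]⟩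

lemma polyMul_mem_levelTruncated {i : Fin r} (p : MvPolynomial (Fin r) ℂ)
    {H : (Fin r → ℤ) → W} (hH : H ∈ levelTruncated W i) : polyMul p H ∈ levelTruncated W i := by
  refine polyMul_mem _ (fun l F hF n => ?_) p H hH
  have step : ∀ N : ℤ, ∀ m : Fin r → ℤ, (∃ k, m k < N) →
      ∃ k, Function.update m l (m l - 1) k < N := by
    rintro N m ⟨k, hk⟩
    refine ⟨k, ?_⟩
    by_cases h : k = l
    · subst h
      simp only [Function.update_self]
      omega
    · simpa [h] using hk
  by_cases hl : l = i
  · subst hl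
    obtain ⟨N, hN⟩ := hF (n - 1)
    exact ⟨N, fun m hm hk => by rw [polyMul_X]; exact hN _ (by simp [hm]) (step N m hk)⟩
  · obtain ⟨N, hN⟩ := hF n
    exact ⟨N, fun m hm hk => by
      rw [polyMul_X]; exact hN _ (by simp [Ne.symm hl, hm]) (step N m hk)⟩

lemma levelTruncated_le_sliceTruncated {o i j : Fin r} (hi : o ≠ i) (hj : o ≠ j) (hij : i ≠ j) :
    levelTruncated W o ≤ sliceTruncated W i j := by
  intro H hH m
  obtain ⟨N, hN⟩ := hH (m o)
  refine ⟨N, fun n ⟨k, hk⟩ => hN _ (setTwo_of_ne _ _ hi hj) ?_⟩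
  fin_cases k
  · exact ⟨i, by rwa [setTwo_left hij]⟩
  · exact ⟨j, by rwa [setTwo_right]⟩

lemma lowerTruncated_le_sliceTruncated {i j : Fin r} (hij : i ≠ j) :
    lowerTruncated W r ≤ sliceTruncated W i j := by
  rintro H ⟨N, hN⟩ m
  refine ⟨N, fun n ⟨k, hk⟩ => hN _ ?_⟩
  fin_cases k
  · exact ⟨i, by rwa [setTwo_left hij]⟩
  · exact ⟨j, by rwa [setTwo_right]⟩

lemma substVar_eq_zero_of_neg (i j : Fin r) (H : (Fin r → ℤ) → W) {m : Fin r → ℤ} (hm : m i < 0) :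
    substVar i j H m = 0 := if_neg (by omega)

lemma substVar_mem_levelTruncated {i j : Fin r} (hij : i ≠ j) {H : (Fin r → ℤ) → W}
    (hH : H ∈ lowerTruncated W r) : substVar i j H ∈ levelTruncated W i := by
  obtain ⟨N, hN⟩ := hH
  intro n
  -- The contributing terms have exponents l ≥ N and m j + n - l ≥ N, whence m j ≥ 2N - n. The final
  -- n handles the exponent of x_i itself, which equals n and so is never below the bound.
  refine ⟨min (min N (2 * N - n)) n, fun m hm ⟨k, hk⟩ => ?_⟩
  rw [substVar, substCoeff]
  split_ifs
  swap
  · rfl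
  refine finsum_eq_zero_of_forall_eq_zero fun l => ?_
  rw [slice, hN, smul_zero]
  have h1 := min_le_left (min N (2 * N - n)) n
  have h2 := min_le_right (min N (2 * N - n)) n
  have h3 := min_le_left N (2 * N - n)
  have h4 := min_le_right N (2 * N - n)
  by_cases hl : l < N
  · exact ⟨i, by rw [setTwo_left hij]; simpa using hl⟩
  by_cases hj : k = j
  · subst hj
    refine ⟨k, ?_⟩
    rw [setTwo_right]
    simp
    omega
  by_cases hi : k = i
  · subst hi
    omega
  · exact ⟨k, by rw [setTwo_of_ne _ _ hi hj]; omega⟩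

/-- Where both are defined and the powers of `x_1` are nonnegative, the two expansions agree. -/
lemma expandFirst_eq_substVar {F : (Fin 2 → ℤ) → W} (h0 : ∀ m, m 0 < 0 → F m = 0) :
    expandFirst F = substVar 0 1 F := by
  funext m
  rw [expandFirst, substVar, slice_zero_one, substCoeff]
  split_ifs with hm
  · have hinj : Function.Injective fun k : ℕ => m 0 + (k : ℤ) := fun a b h => by
      simpa using h
    -- For l ≥ 0 the binomial (l choose m 0) vanishes unless l = m 0 + k with k natural. Symmetry of
    -- binomials then turns it into (m 0 + k choose k).
    have hsupp : (Function.support fun l : ℤ =>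
        Ring.choose l (m 0).toNat • F ![l, m 1 + m 0 - l]) ⊆
        Set.range fun k : ℕ => m 0 + (k : ℤ) := by
      intro l hl
      by_contra hc
      apply hl
      have hlt : l < m 0 := by
        by_contra h
        exact hc ⟨(l - m 0).toNat, by simp; omega⟩
      by_cases hneg : l < 0
      · exact (congrArg _ (h0 _ (by simpa using hneg))).trans (smul_zero _)
      · obtain ⟨a, rfl⟩ : ∃ a : ℕ, l = a := ⟨l.toNat, by omega⟩
        beta_reduce
        rw [Ring.choose_natCast, Nat.choose_eq_zero_of_lt (by omega), Nat.cast_zero, zero_smul]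
    rw [← finsum_mem_univ (α := ℤ), ← finsum_mem_inter_support_eq' _
      (Set.range fun k : ℕ => m 0 + (k : ℤ)) Set.univ (fun x hx => by simpa using hsupp hx),
      finsum_mem_range hinj]
    refine finsum_congr fun k => ?_
    have e : m 1 + m 0 - (m 0 + (k : ℤ)) = m 1 - k := by ring
    rw [e]
    congr 1
    obtain ⟨a, ha⟩ : ∃ a : ℕ, m 0 = a := ⟨(m 0).toNat, by omega⟩
    have e2 : m 0 + (k : ℤ) = ((a + k : ℕ) : ℤ) := by rw [ha]; push_cast; ring
    rw [e2, ha, Int.toNat_natCast, Ring.choose_natCast, Ring.choose_natCast, Nat.choose_symm_add]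
  · refine finsum_eq_zero_of_forall_eq_zero fun k => ?_
    by_cases hneg : m 0 + (k : ℤ) < 0
    · rw [h0 _ (by simpa using hneg), smul_zero]
    · obtain ⟨a, ha⟩ : ∃ a : ℕ, m 0 + (k : ℤ) = a := ⟨(m 0 + k).toNat, by omega⟩
      rw [ha, Ring.choose_natCast, Nat.choose_eq_zero_of_lt (by omega), Nat.cast_zero, zero_smul]

/-! ### Iterated Laurent series -/

/-- The space `W((x_r))⋯((x_1))` of iterated Laurent series; the first variable is the outermost
one. -/
def iterLaurent (W : Type*) [AddCommGroup W] [Module ℂ W] (r : ℕ) :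
    Submodule ℂ ((Fin r → ℤ) → W) where
  carrier := {H | ∀ (k : Fin r) (m : Fin r → ℤ), ∃ N : ℤ, ∀ m' : Fin r → ℤ,
    (∀ i < k, m' i = m i) → m' k < N → H m' = 0}
  zero_mem' := fun _ _ => ⟨0, fun _ _ _ => rfl⟩
  add_mem' := by
    intro F G hF hG k m
    obtain ⟨N, hN⟩ := hF k m
    obtain ⟨M, hM⟩ := hG k m
    refine ⟨min N M, fun m' hm hk => ?_⟩
    rw [Pi.add_apply, hN m' hm (lt_of_lt_of_le hk (min_le_left _ _)),
      hM m' hm (lt_of_lt_of_le hk (min_le_right _ _)), add_zero]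
  smul_mem' := by
    intro c F hF k m
    obtain ⟨N, hN⟩ := hF k m
    exact ⟨N, fun m' hm hk => by rw [Pi.smul_apply, hN m' hm hk, smul_zero]⟩

lemma polyMul_mem_iterLaurent (p : MvPolynomial (Fin r) ℂ) {H : (Fin r → ℤ) → W}
    (hH : H ∈ iterLaurent W r) : polyMul p H ∈ iterLaurent W r := by
  refine polyMul_mem _ (fun l F hF k m => ?_) p H hH
  obtain ⟨N, hN⟩ := hF k (Function.update m l (m l - 1))
  refine ⟨N, fun m' hm hk => ?_⟩
  rw [polyMul_X]
  refine hN _ (fun i hi => ?_) ?_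
  · by_cases h : i = l
    · subst h
      simp [hm i hi]
    · simp [h, hm i hi]
  · by_cases h : k = l
    · subst h
      simp only [Function.update_self]
      omega
    · simpa [h] using hk

/-- A nonzero iterated Laurent series has a lexicographically least exponent. -/
lemma exists_lex_min {H : (Fin r → ℤ) → W} (hH : H ∈ iterLaurent W r) (h0 : H ≠ 0) :
    ∃ m, H m ≠ 0 ∧ ∀ m', H m' ≠ 0 → ∀ k, (∀ i < k, m' i = m i) → m k ≤ m' k := by
  -- The entries are minimised one after the other: among exponents sharing the first n entries, the
  -- defining condition of `iterLaurent` bounds the next entry below.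
  suffices h : ∀ n ≤ r, ∃ m, H m ≠ 0 ∧ ∀ m', H m' ≠ 0 →
      ∀ k : Fin r, (k : ℕ) < n → (∀ i < k, m' i = m i) → m k ≤ m' k by
    obtain ⟨m, hm, hmin⟩ := h r le_rfl
    exact ⟨m, hm, fun m' hm' k => hmin m' hm' k k.2⟩
  intro n
  induction n with
  | zero =>
    intro _
    obtain ⟨m, hm⟩ := Function.ne_iff.1 h0
    exact ⟨m, hm, fun _ _ k hk => absurd hk (by omega)⟩
  | succ n ih =>
    intro hn
    obtain ⟨m, hm, hmin⟩ := ih (by omega)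
    let κ : Fin r := ⟨n, by omega⟩
    obtain ⟨N, hN⟩ := hH κ m
    obtain ⟨a, ⟨m₁, hm₁, hag, rfl⟩, hleast⟩ := Int.exists_least_of_bdd
      (P := fun a => ∃ m', H m' ≠ 0 ∧ (∀ i < κ, m' i = m i) ∧ m' κ = a)
      ⟨N, fun a ⟨m', h1, h2, h3⟩ => by
        by_contra hc
        exact h1 (hN m' h2 (by omega))⟩ ⟨m κ, m, hm, fun _ _ => rfl, rfl⟩
    refine ⟨m₁, hm₁, fun m' hm' k hk hk' => ?_⟩
    rcases Nat.lt_succ_iff_lt_or_eq.1 hk with h | h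
    · have hkκ : k < κ := h
      rw [hag k hkκ]
      exact hmin m' hm' k h fun i hi => (hk' i hi).trans (hag i (hi.trans hkκ))
    · obtain rfl : k = κ := Fin.ext h
      exact hleast _ ⟨m', hm', fun i hi => (hk' i hi).trans (hag i hi), rfl⟩

/-- Nonzero polynomials act injectively on iterated Laurent series. -/
lemma eq_zero_of_polyMul_eq_zero {p : MvPolynomial (Fin r) ℂ} (hp : p ≠ 0)
    {H : (Fin r → ℤ) → W} (hH : H ∈ iterLaurent W r) (h : polyMul p H = 0) : H = 0 := by
  by_contra h0
  obtain ⟨m, hm, hmin⟩ := exists_lex_min hH h0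
  obtain ⟨s, hs, hsmin⟩ := p.support.exists_min_image
    (fun s => toLex fun i => (s i : ℤ)) (MvPolynomial.support_nonempty.2 hp)
  -- At this exponent only the lowest monomial s of p contributes: for another monomial t, the
  -- exponent m + s - t is lexicographically below m.
  have hz := congrFun h (fun i => m i + (s i : ℤ))
  rw [polyMul, Pi.zero_apply, Finset.sum_eq_single_of_mem s hs] at hz
  · simp only [add_sub_cancel_right] at hz
    exact (smul_ne_zero (MvPolynomial.mem_support_iff.1 hs) hm) hz
  · intro t ht hts
    suffices H (fun i => m i + (s i : ℤ) - (t i : ℤ)) = 0 by rw [this, smul_zero]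
    by_contra hne
    have hlt : toLex (fun i => (s i : ℤ)) < toLex fun i => (t i : ℤ) := by
      refine lt_of_le_of_ne (hsmin t ht) fun he => hts ?_
      ext i
      exact_mod_cast (congrFun (toLex.injective he) i).symm
    obtain ⟨k, hk, hlt⟩ := hlt
    have hk' : ∀ i < k, (s i : ℤ) = t i := hk
    have hlt' : (s k : ℤ) < t k := hlt
    have := hmin _ hne k fun i hi => by
      have := hk' i hi
      omega
    omega

lemma eq_of_polyMul_eq {p : MvPolynomial (Fin r) ℂ} (hp : p ≠ 0) {G H : (Fin r → ℤ) → W}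
    (hG : G ∈ iterLaurent W r) (hH : H ∈ iterLaurent W r) (h : polyMul p G = polyMul p H) :
    G = H :=
  sub_eq_zero.1 (eq_zero_of_polyMul_eq_zero hp ((iterLaurent W r).sub_mem hG hH)
    (by rw [polyMul_sub_right, h, sub_self]))

lemma lowerTruncated_le_iterLaurent : lowerTruncated W r ≤ iterLaurent W r := by
  rintro H ⟨N, hN⟩ k m
  exact ⟨N, fun m' _ hk => hN m' ⟨k, hk⟩⟩

lemma substVar_mem_iterLaurent {F : (Fin 2 → ℤ) → W} (hF : F ∈ lowerTruncated W 2) :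
    substVar 0 1 F ∈ iterLaurent W 2 := by
  intro k m
  fin_cases k
  · exact ⟨0, fun m' _ hk => substVar_eq_zero_of_neg _ _ _ hk⟩
  · obtain ⟨N, hN⟩ := substVar_mem_levelTruncated (i := (0 : Fin 2)) (j := 1) (by decide) hF (m 0)
    exact ⟨N, fun m' hm hk => hN m' (hm 0 Fin.zero_lt_one) ⟨1, hk⟩⟩

/-- The formal series all of whose slices in the variables `x_i, x_j` lie in `W((x_j))((x_i))`. -/
def sliceLaurent (W : Type*) [AddCommGroup W] [Module ℂ W] (i j : Fin r) :
    Submodule ℂ ((Fin r → ℤ) → W) where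
  carrier := {H | ∀ m, slice i j m H ∈ iterLaurent W 2}
  zero_mem' := fun _ => (iterLaurent W 2).zero_mem
  add_mem' := fun hF hG m => (iterLaurent W 2).add_mem (hF m) (hG m)
  smul_mem' := fun c _ hF m => (iterLaurent W 2).smul_mem c (hF m)

lemma polyMul_mem_sliceLaurent {i j : Fin r} (hij : i ≠ j) (p : MvPolynomial (Fin r) ℂ)
    {H : (Fin r → ℤ) → W} (hH : H ∈ sliceLaurent W i j) :
    polyMul p H ∈ sliceLaurent W i j := by
  refine polyMul_mem _ (fun k F hF m => ?_) p H hH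
  by_cases hi : k = i
  · subst hi
    rw [slice_X_left hij]
    exact polyMul_mem_iterLaurent _ (hF m)
  by_cases hj : k = j
  · subst hj
    rw [slice_X_right]
    exact polyMul_mem_iterLaurent _ (hF m)
  rw [slice_X_of_ne hi hj]
  exact hF _

lemma eq_zero_of_polyMul_rename_eq_zero {i j : Fin r} (hij : i ≠ j) {p : MvPolynomial (Fin 2) ℂ}
    (hp : p ≠ 0) {H : (Fin r → ℤ) → W} (hH : H ∈ sliceLaurent W i j)
    (h : polyMul (rename ![i, j] p) H = 0) : H = 0 := by
  refine ext_slice (i := i) (j := j) fun m => eq_zero_of_polyMul_eq_zero hp (hH m) ?_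
  rw [← slice_rename hij, h]
  rfl

lemma substVar_mem_sliceLaurent {i j : Fin r} (hij : i ≠ j) {H : (Fin r → ℤ) → W}
    (hH : H ∈ sliceTruncated W i j) : substVar i j H ∈ sliceLaurent W i j := by
  intro m
  rw [slice_substVar hij]
  exact substVar_mem_iterLaurent (hH m)

/-! ### Iterated substitutions in three variables -/

lemma substVar_apply {i j : Fin r} (H : (Fin r → ℤ) → W) {m : Fin r → ℤ} {a : ℕ} (hm : m i = a) :
    substVar i j H m =
      ∑ᶠ l : ℤ, Ring.choose l a • H (setTwo i j m ![l, m j + a - l]) := by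
  rw [substVar, substCoeff, if_pos (by omega), hm]
  simp only [Int.toNat_natCast, slice]

lemma setTwo_01 (m : Fin 3 → ℤ) (a b : ℤ) : setTwo 0 1 m ![a, b] = ![a, b, m 2] := by
  funext k; fin_cases k <;> simp [setTwo]

lemma setTwo_12 (m : Fin 3 → ℤ) (a b : ℤ) : setTwo 1 2 m ![a, b] = ![m 0, a, b] := by
  funext k; fin_cases k <;> simp [setTwo]

lemma setTwo_02 (m : Fin 3 → ℤ) (a b : ℤ) : setTwo 0 2 m ![a, b] = ![a, m 1, b] := by
  funext k; fin_cases k <;> simp [setTwo]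

/-- The substitutions `x_1 = x_2 + x_0` and then `x_2 = x_3 + x_2`, computed on
`W((x_1, x_2, x_3))`. -/
lemma substVar_substVar_apply {L : (Fin 3 → ℤ) → W} {N : ℤ}
    (hN : ∀ m, (∃ i, m i < N) → L m = 0) (i j : ℕ) (k : ℤ) :
    substVar 1 2 (substVar 0 1 L) ![i, j, k] =
      ∑ n ∈ Finset.Icc N (i + j + k - 2 * N), ∑ l ∈ Finset.Icc N (i + j + k - 2 * N),
        (Ring.choose (l + (n - i)) j * Ring.choose n i) • L ![n, l, i + j + k - n - l] := by
  -- The three exponents are at least N and add up to i + j + k, so each is at most i + j + k - 2N.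
  set S := Finset.Icc N (i + j + k - 2 * N) with hS
  have hL : ∀ n l t : ℤ, n + l + t = i + j + k → L ![n, l, t] ≠ 0 → n ∈ S ∧ l ∈ S := by
    intro n l t hs h
    have h0 : N ≤ n := by
      by_contra hc; exact h (hN _ ⟨0, by simpa using hc⟩)
    have h1 : N ≤ l := by
      by_contra hc; exact h (hN _ ⟨1, by simpa using hc⟩)
    have h2 : N ≤ t := by
      by_contra hc; exact h (hN _ ⟨2, by simpa using hc⟩)
    simp only [hS, Finset.mem_Icc]
    omega
  rw [substVar_apply (a := j) _ (by simp)]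
  have inner : ∀ x : ℤ, substVar 0 1 L (setTwo 1 2 ![(i : ℤ), j, k]
      ![x, ![(i : ℤ), j, k] 2 + j - x]) =
      ∑ n ∈ S, Ring.choose n i • L ![n, x + i - n, k + j - x] := by
    intro x
    rw [setTwo_12, substVar_apply (a := i) _ (by simp)]
    rw [finsum_eq_sum_of_support_subset (s := S)]
    · refine Finset.sum_congr rfl fun n _ => ?_
      rw [setTwo_01]
      rfl
    · intro n hn
      have hn' : L ![n, x + i - n, k + j - x] ≠ 0 := by
        intro h
        apply hn
        simp only [setTwo_01]
        exact (congrArg _ h).trans (smul_zero _)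
      exact (hL _ _ _ (by ring) hn').1
  simp only [inner, Finset.smul_sum]
  rw [finsum_sum_comm]
  · refine Finset.sum_congr rfl fun n _ => ?_
    -- If n and l are the exponents of x_1 and x_2 in L, the first substitution leaves the exponent
    -- l + n - i on x_2. The reindexing makes l the summation variable.
    rw [← finsum_comp_equiv (Equiv.addRight (n - (i : ℤ)))]
    simp only [Equiv.coe_addRight]
    rw [finsum_eq_sum_of_support_subset (s := S)]
    · refine Finset.sum_congr rfl fun l _ => ?_
      rw [smul_smul]
      rw [show l + (n - (i : ℤ)) + i - n = l by ring,
        show k + j - (l + (n - (i : ℤ))) = i + j + k - n - l by ring]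
    · intro l hl
      refine (hL n l (i + j + k - n - l) (by ring) fun h => hl ?_).2
      beta_reduce
      rw [show l + (n - (i : ℤ)) + i - n = l by ring,
        show k + j - (l + (n - (i : ℤ))) = i + j + k - n - l by ring, h, smul_zero, smul_zero]
  · intro n _
    refine (S.finite_toSet.image fun l => l + (n - (i : ℤ))).subset fun x hx => ?_
    refine ⟨x + i - n, (hL n _ (k + j - x) (by ring) fun h => hx ?_).2, by ring⟩
    simp only [h, smul_zero]

/-- The substitutions `x_2 = x_3 + x_2` and then `x_1 = x_3 + x_1`, computed on
`W((x_1, x_2, x_3))`. -/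
lemma substVar_substVar_apply' {L : (Fin 3 → ℤ) → W} {N : ℤ}
    (hN : ∀ m, (∃ i, m i < N) → L m = 0) (i j : ℕ) (k : ℤ) :
    substVar 0 2 (substVar 1 2 L) ![i, j, k] =
      ∑ n ∈ Finset.Icc N (i + j + k - 2 * N), ∑ l ∈ Finset.Icc N (i + j + k - 2 * N),
        (Ring.choose l j * Ring.choose n i) • L ![n, l, i + j + k - n - l] := by
  set S := Finset.Icc N (i + j + k - 2 * N) with hS
  have hL : ∀ n l t : ℤ, n + l + t = i + j + k → L ![n, l, t] ≠ 0 → n ∈ S ∧ l ∈ S := by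
    intro n l t hs h
    have h0 : N ≤ n := by
      by_contra hc; exact h (hN _ ⟨0, by simpa using hc⟩)
    have h1 : N ≤ l := by
      by_contra hc; exact h (hN _ ⟨1, by simpa using hc⟩)
    have h2 : N ≤ t := by
      by_contra hc; exact h (hN _ ⟨2, by simpa using hc⟩)
    simp only [hS, Finset.mem_Icc]
    omega
  rw [substVar_apply (a := i) _ (by simp)]
  have inner : ∀ n : ℤ, substVar 1 2 L (setTwo 0 2 ![(i : ℤ), j, k]
      ![n, ![(i : ℤ), j, k] 2 + i - n]) =
      ∑ l ∈ S, Ring.choose l j • L ![n, l, i + j + k - n - l] := by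
    intro n
    rw [setTwo_02, substVar_apply (a := j) _ (by simp)]
    have e : ∀ l : ℤ, L (setTwo 1 2 ![n, ![(i : ℤ), j, k] 1, ![(i : ℤ), j, k] 2 + i - n]
        ![l, ![n, ![(i : ℤ), j, k] 1, ![(i : ℤ), j, k] 2 + i - n] 2 + j - l]) =
        L ![n, l, i + j + k - n - l] := by
      intro l
      rw [setTwo_12]
      congr 1
      funext t
      fin_cases t
      · simp
      · simp
      · simp; ring
    simp only [e]
    rw [finsum_eq_sum_of_support_subset (s := S)]
    intro l hl
    exact (hL n l (i + j + k - n - l) (by ring) fun h => hl (by simp only [h, smul_zero])).2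
  simp only [inner]
  rw [finsum_eq_sum_of_support_subset (s := S)]
  · simp only [Finset.smul_sum, smul_smul]
    refine Finset.sum_congr rfl fun n _ => Finset.sum_congr rfl fun l _ => ?_
    rw [mul_comm]
  · intro n hn
    by_contra hc
    apply hn
    simp only
    rw [Finset.sum_eq_zero, smul_zero]
    intro l _
    rw [show L ![n, l, i + j + k - n - l] = 0 from ?_, smul_zero]
    by_contra h
    exact hc (hL n l _ (by ring) h).1

/-- Vandermonde's identity for (n - i) + l, combined with (n choose i)(n - i choose a) = (i + a
choose i)(n choose i + a). It is the coefficient identity behind `expandVar_substVar_substVar`. -/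
lemma choose_vandermonde (n l : ℤ) (i j : ℕ) :
    Ring.choose (l + (n - i)) j * Ring.choose n i =
      ∑ a ∈ Finset.range (j + 1), Ring.choose ((i : ℤ) + (a : ℕ)) a *
        (Ring.choose l (j - a) * Ring.choose n (i + a)) := by
  rw [add_comm l, Ring.add_choose_eq j (Commute.all _ _),
    Finset.Nat.sum_antidiagonal_eq_sum_range_succ_mk, Finset.sum_mul]
  refine Finset.sum_congr rfl fun a _ => ?_
  have h := Ring.choose_smul_choose n (Nat.le_add_right i a)
  rw [Nat.add_sub_cancel_left, nsmul_eq_mul] at h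
  rw [← Nat.cast_add, Ring.choose_natCast, ← Nat.choose_symm_add, mul_left_comm, h]
  ring

/-- Substituting `x_1 = x_0 + x_2` (expanded in nonnegative powers of `x_2`) turns
`F(x + x_1, x + x_2, x)` into `F(x + x_2 + x_0, x + x_2, x)`. -/
lemma expandVar_substVar_substVar {L : (Fin 3 → ℤ) → W} (hL : L ∈ lowerTruncated W 3) :
    expandVar 0 1 (substVar 0 2 (substVar 1 2 L)) = substVar 1 2 (substVar 0 1 L) := by
  obtain ⟨N, hN⟩ := hL
  have hz0 : ∀ m : Fin 3 → ℤ, m 0 < 0 → substVar 0 2 (substVar 1 2 L) m = 0 := fun m hm =>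
    substVar_eq_zero_of_neg _ _ _ hm
  have hz1 : ∀ m : Fin 3 → ℤ, m 1 < 0 → substVar 0 2 (substVar 1 2 L) m = 0 := by
    intro m hm
    rw [substVar, substCoeff]
    split_ifs
    · refine finsum_eq_zero_of_forall_eq_zero fun n => ?_
      rw [slice, substVar_eq_zero_of_neg, smul_zero]
      rwa [setTwo_02]
    · rfl
  have hw : ∀ m : Fin 3 → ℤ, m 0 < 0 → substVar 1 2 (substVar 0 1 L) m = 0 := by
    intro m hm
    rw [substVar, substCoeff]
    split_ifs
    · refine finsum_eq_zero_of_forall_eq_zero fun n => ?_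
      rw [slice, substVar_eq_zero_of_neg, smul_zero]
      rwa [setTwo_12]
    · rfl
  funext m
  simp only [expandVar, expandFirst, slice, setTwo_01, Matrix.cons_val_zero, Matrix.cons_val_one]
  -- The closed formulas require natural exponents of the first two variables; with a negative one
  -- both sides vanish.
  by_cases hj : m 1 < 0
  · rw [substVar_eq_zero_of_neg _ _ _ hj]
    refine finsum_eq_zero_of_forall_eq_zero fun k => ?_
    rw [hz1 _ (by simp; omega), smul_zero]
  by_cases hi : m 0 < 0
  · rw [hw _ hi]
    refine finsum_eq_zero_of_forall_eq_zero fun k => ?_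
    by_cases hneg : m 0 + (k : ℤ) < 0
    · rw [hz0 _ (by simpa using hneg), smul_zero]
    · obtain ⟨a, ha⟩ : ∃ a : ℕ, m 0 + (k : ℤ) = a := ⟨(m 0 + k).toNat, by omega⟩
      rw [ha, Ring.choose_natCast, Nat.choose_eq_zero_of_lt (by omega), Nat.cast_zero, zero_smul]
  obtain ⟨i, hi'⟩ : ∃ i : ℕ, m 0 = i := ⟨(m 0).toNat, by omega⟩
  obtain ⟨j, hj'⟩ : ∃ j : ℕ, m 1 = j := ⟨(m 1).toNat, by omega⟩
  have hm : m = ![(i : ℤ), j, m 2] := by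
    funext t; fin_cases t <;> simp [hi', hj']
  rw [hm, substVar_substVar_apply hN]
  simp only [Matrix.cons_val_zero, Matrix.cons_val_one, Matrix.cons_val_two, Matrix.tail_cons,
    Matrix.head_cons]
  -- Terms with a > j would involve a negative power of the second variable, which the substitutions
  -- do not produce.
  rw [finsum_eq_sum_of_support_subset (s := Finset.range (j + 1))]
  swap
  · intro a ha
    by_contra hc
    apply ha
    simp only [Finset.coe_range, Set.mem_Iio, not_lt] at hc
    simp only
    rw [hz1 _ (by simp; omega), smul_zero]
  have key : ∀ a ∈ Finset.range (j + 1),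
      Ring.choose ((i : ℤ) + (a : ℕ)) a •
        substVar 0 2 (substVar 1 2 L) ![(i : ℤ) + (a : ℕ), (j : ℤ) - (a : ℕ), m 2] =
      ∑ n ∈ Finset.Icc N (i + j + m 2 - 2 * N), ∑ l ∈ Finset.Icc N (i + j + m 2 - 2 * N),
        (Ring.choose ((i : ℤ) + (a : ℕ)) a *
          (Ring.choose l (j - a) * Ring.choose n (i + a))) • L ![n, l, i + j + m 2 - n - l] := by
    intro a ha
    have ha' : a ≤ j := by simpa [Nat.lt_succ_iff] using ha
    have h := substVar_substVar_apply' hN (i + a) (j - a) (m 2)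
    have e : ((i + a : ℕ) : ℤ) + ((j - a : ℕ) : ℤ) = i + j := by omega
    have e1 : ((i + a : ℕ) : ℤ) = (i : ℤ) + (a : ℕ) := by omega
    have e2 : ((j - a : ℕ) : ℤ) = (j : ℤ) - (a : ℕ) := by omega
    rw [e, e1, e2] at h
    rw [h]
    simp only [Finset.smul_sum, smul_smul]
  rw [Finset.sum_congr rfl key, Finset.sum_comm]
  refine Finset.sum_congr rfl fun n _ => ?_
  rw [Finset.sum_comm]
  refine Finset.sum_congr rfl fun l _ => ?_
  rw [choose_vandermonde, Finset.sum_smul]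

/-! ### Coefficients in `W((x))((x_0))` -/

lemma Ser.mul_add_left {R M : Type*} [CommRing R] [AddCommGroup M] [Module R M]
    (p q : LaurentSeries R) (g : Ser R M) : Ser.mul (p + q) g = Ser.mul p g + Ser.mul q g :=
  add_smul p q g

lemma Ser.mul_mul {R M : Type*} [CommRing R] [AddCommGroup M] [Module R M]
    (p q : LaurentSeries R) (g : Ser R M) : Ser.mul (p * q) g = Ser.mul p (Ser.mul q g) :=
  mul_smul p q g

lemma Ser.zero_mul {R M : Type*} [CommRing R] [AddCommGroup M] [Module R M] (g : Ser R M) :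
    Ser.mul (0 : LaurentSeries R) g = 0 :=
  zero_smul (LaurentSeries R) g

lemma Ser.one_mul {R M : Type*} [CommRing R] [AddCommGroup M] [Module R M] (g : Ser R M) :
    Ser.mul (1 : LaurentSeries R) g = g :=
  one_smul (LaurentSeries R) g

lemma Ser.mul_inv_mul {K M : Type*} [Field K] [AddCommGroup M] [Module K M]
    {q : LaurentSeries K} (hq : q ≠ 0) (g : Ser K M) : Ser.mul q (Ser.mul q⁻¹ g) = g := by
  rw [← Ser.mul_mul, mul_inv_cancel₀ hq, Ser.one_mul]

/-- The formal series in `x_0, x` underlying an element of `W((x))((x_0))`. -/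
def doubleCoeff (g : DoubleSeries W) : (Fin 2 → ℤ) → W :=
  fun m => (g.coeff (m 0)).coeff (m 1)

/-- The polynomial `p(x_0 + x, x)` as an element of `ℂ((x))((x_0))`. -/
def shiftEval : MvPolynomial (Fin 2) ℂ →+* LaurentSeries (LaurentSeries ℂ) :=
  MvPolynomial.eval₂Hom
    ((HahnSeries.C : LaurentSeries ℂ →+* LaurentSeries (LaurentSeries ℂ)).comp
      (algebraMap ℂ (LaurentSeries ℂ)))
    (![HahnSeries.single 1 1 + HahnSeries.C (HahnSeries.single 1 1 : LaurentSeries ℂ),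
      HahnSeries.C (HahnSeries.single 1 1 : LaurentSeries ℂ)] :
      Fin 2 → LaurentSeries (LaurentSeries ℂ))

lemma iotaInv_eq (p : MvPolynomial (Fin 2) ℂ) : iotaInv p = (shiftEval p)⁻¹ := rfl

lemma doubleCoeff_add (g h : DoubleSeries W) :
    doubleCoeff (g + h) = doubleCoeff g + doubleCoeff h := rfl

lemma coeff_single_one_smul {R M : Type*} [CommRing R] [AddCommGroup M] [Module R M]
    (g : Ser R M) (a : ℤ) :
    Ser.coeff (Ser.mul (HahnSeries.single 1 1 : LaurentSeries R) g) a = g.coeff (a - 1) := by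
  have h := HahnModule.coeff_single_smul_vadd (R := R) (r := 1) (x := g) (a := a - 1) (b := (1 : ℤ))
  rw [one_smul, vadd_eq_add, add_sub_cancel] at h
  exact h

lemma coeff_C_smul {R M : Type*} [CommRing R] [AddCommGroup M] [Module R M] (c : R)
    (g : Ser R M) (a : ℤ) :
    Ser.coeff (Ser.mul (HahnSeries.C c : LaurentSeries R) g) a = c • g.coeff a :=
  HahnModule.coeff_single_zero_smul

lemma doubleCoeff_X_one_smul (g : DoubleSeries W) :
    doubleCoeff (Ser.mul (shiftEval (X 1)) g) = polyMul (X 1) (doubleCoeff g) := by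
  funext m
  rw [polyMul_X, doubleCoeff, doubleCoeff, shiftEval, MvPolynomial.coe_eval₂Hom,
    MvPolynomial.eval₂_X]
  refine (congrArg (fun g => Ser.coeff g (m 1)) (coeff_C_smul _ _ _)).trans ?_
  refine (coeff_single_one_smul (g.coeff (m 0)) (m 1)).trans ?_
  simp

lemma doubleCoeff_X_zero_smul (g : DoubleSeries W) :
    doubleCoeff (Ser.mul (shiftEval (X 0)) g) = polyMul (X 0 + X 1) (doubleCoeff g) := by
  rw [polyMul_add_left, ← doubleCoeff_X_one_smul]
  have e : shiftEval (X 0) = HahnSeries.single 1 1 + shiftEval (X 1) := by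
    simp [shiftEval]
  rw [e, Ser.mul_add_left, doubleCoeff_add]
  congr 1
  funext m
  rw [polyMul_X, doubleCoeff, doubleCoeff, coeff_single_one_smul]
  simp

lemma doubleCoeff_C_smul (c : ℂ) (g : DoubleSeries W) :
    doubleCoeff (Ser.mul (shiftEval (C c)) g) = polyMul (C c) (doubleCoeff g) := by
  funext m
  rw [polyMul_C, Pi.smul_apply, doubleCoeff, doubleCoeff, shiftEval, MvPolynomial.coe_eval₂Hom,
    MvPolynomial.eval₂_C]
  refine (congrArg (fun g => Ser.coeff g (m 1)) (coeff_C_smul _ _ _)).trans ?_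
  have e : algebraMap ℂ (LaurentSeries ℂ) c = HahnSeries.C c := by
    rw [HahnSeries.algebraMap_apply', PowerSeries.algebraMap_apply, Algebra.algebraMap_self_apply,
      HahnSeries.ofPowerSeries_C]
  rw [e]
  exact coeff_C_smul _ _ _

/-- Translates the action of the field ℂ((x))((x_0)), where p(x_0 + x, x) is inverted, into the
coefficientwise action `polyMul`. Constants and the two variables suffice. -/
lemma doubleCoeff_shiftEval_smul (p : MvPolynomial (Fin 2) ℂ) (g : DoubleSeries W) :
    doubleCoeff (Ser.mul (shiftEval p) g) = polyMul (polyShift p) (doubleCoeff g) := by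
  induction p using MvPolynomial.induction_on generalizing g with
  | C c =>
    rw [doubleCoeff_C_smul, ← shiftVar_zero_one, shiftVar_C]
  | add p q hp hq =>
    rw [map_add, Ser.mul_add_left, doubleCoeff_add, hp, hq, ← polyMul_add_left]
    simp [polyShift]
  | mul_X p k hp =>
    rw [map_mul, Ser.mul_mul, hp, ← shiftVar_zero_one, ← shiftVar_zero_one, map_mul, polyMul_mul]
    congr 1
    by_cases h : k = 0
    · subst h
      rw [doubleCoeff_X_zero_smul, shiftVar_X_self]
    · obtain rfl : k = 1 := by omega
      rw [doubleCoeff_X_one_smul, shiftVar_X_of_ne h]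

/-- Otherwise `polyShift p` would annihilate the constant series 1, against injectivity on truncated
series. -/
lemma shiftEval_ne_zero {p : MvPolynomial (Fin 2) ℂ} (hp : p ≠ 0) : shiftEval p ≠ 0 := by
  intro h
  let g : DoubleSeries ℂ := HahnModule.of _ (HahnSeries.single 0
    (HahnModule.of ℂ (HahnSeries.single 0 1)))
  have hg1 : ∀ m : Fin 2 → ℤ, m 0 ≠ 0 → doubleCoeff g m = 0 := by
    intro m hm
    change Ser.coeff ((HahnSeries.single (0 : ℤ) (HahnModule.of ℂ (HahnSeries.single (0 : ℤ)
      (1 : ℂ)) : Ser ℂ ℂ)).coeff (m 0)) (m 1) = 0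
    rw [HahnSeries.coeff_single_of_ne hm]
    rfl
  have hg0 : ∀ m : Fin 2 → ℤ, m 0 = 0 → doubleCoeff g m = (HahnSeries.single (0 : ℤ)
      (1 : ℂ)).coeff (m 1) := by
    intro m hm
    change Ser.coeff ((HahnSeries.single (0 : ℤ) (HahnModule.of ℂ (HahnSeries.single (0 : ℤ)
      (1 : ℂ)) : Ser ℂ ℂ)).coeff (m 0)) (m 1) = _
    rw [hm, HahnSeries.coeff_single_same]
    rfl
  have hlow : doubleCoeff g ∈ lowerTruncated ℂ 2 := by
    refine ⟨0, fun m ⟨i, hi⟩ => ?_⟩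
    by_cases hm : m 0 = 0
    · rw [hg0 m hm, HahnSeries.coeff_single_of_ne]
      fin_cases i
      · exact absurd hi (by simp [hm])
      · exact hi.ne
    · exact hg1 m hm
  have hz : polyMul (polyShift p) (doubleCoeff g) = 0 := by
    rw [← doubleCoeff_shiftEval_smul, h, Ser.zero_mul]
    rfl
  have := congrFun (eq_zero_of_polyMul_eq_zero (polyShift_ne_zero hp)
    (lowerTruncated_le_iterLaurent hlow) hz) 0
  rw [hg0 0 rfl] at this
  simp at this

lemma doubleCoeff_mem_iterLaurent (g : DoubleSeries W) : doubleCoeff g ∈ iterLaurent W 2 := by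
  have key : ∀ {R M : Type _} [CommRing R] [AddCommGroup M] [Module R M] (h : Ser R M),
      ∃ N : ℤ, ∀ n < N, h.coeff n = 0 := by
    intro R M _ _ _ h
    by_cases h0 : (HahnModule.of R).symm h = 0
    · exact ⟨0, fun n _ => by rw [Ser.coeff, h0]; rfl⟩
    · exact ⟨((HahnModule.of R).symm h).order, fun n hn => HahnSeries.coeff_eq_zero_of_lt_order hn⟩
  intro k m
  fin_cases k
  · obtain ⟨N, hN⟩ := key g
    refine ⟨N, fun m' _ hk => ?_⟩
    have hk' : m' 0 < N := hk
    rw [doubleCoeff, hN _ hk']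
    rfl
  · obtain ⟨N, hN⟩ := key (g.coeff (m 0))
    refine ⟨N, fun m' hm hk => ?_⟩
    rw [doubleCoeff, hm 0 Fin.zero_lt_one]
    exact hN _ hk

lemma doubleCoeff_substSeries (F : (Fin 2 → ℤ) → W) (hF : F ∈ lowerTruncated W 2) :
    doubleCoeff (substSeries F hF) = substVar 0 1 F := by
  funext m
  rw [substVar, slice_zero_one]
  rfl

/-! ### The products of a quasi compatible pair -/

/-- The coefficient of `x^n` in a field `a(x)`. -/
abbrev fieldCoeff (a : VertexOperator ℂ W) (n : ℤ) : W →ₗ[ℂ] W := HVertexOperator.coeff a n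

lemma fieldCoeff_truncated (a : VertexOperator ℂ W) (w : W) :
    ∃ N : ℤ, ∀ n < N, fieldCoeff a n w = 0 := by
  by_cases h0 : (HahnModule.of ℂ).symm (a w) = 0
  · exact ⟨0, fun n _ => by rw [HVertexOperator.coeff_apply_apply, h0]; rfl⟩
  · exact ⟨((HahnModule.of ℂ).symm (a w)).order,
      fun n hn => HahnSeries.coeff_eq_zero_of_lt_order hn⟩

lemma field_ext {a b : VertexOperator ℂ W} (h : ∀ n w, fieldCoeff a n w = fieldCoeff b n w) :
    a = b :=
  HVertexOperator.coeff_inj (funext fun n => LinearMap.ext fun w => h n w)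

@[simp]
lemma fieldCoeff_zero (n : ℤ) : fieldCoeff (0 : VertexOperator ℂ W) n = 0 := by
  ext w
  rfl

lemma fieldCoeff_idField (n : ℤ) (w : W) :
    fieldCoeff (idField W) n w = if n = 0 then w else 0 := by
  change (HahnSeries.single (0 : ℤ) w).coeff n = _
  rw [HahnSeries.coeff_single]
  split_ifs <;> rfl

lemma iterProd_pair (a b : VertexOperator ℂ W) (w : W) (m : Fin 2 → ℤ) :
    iterProd ![a, b] w m = fieldCoeff a (m 0) (fieldCoeff b (m 1) w) := by
  simp [iterProd, List.ofFn_succ]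

/-- The series `∑_n (a_n b)(x) w x_0^{-n-1}` in `x_0` (index `0`) and `x` (index `1`). -/
def prodSeries (a b : VertexOperator ℂ W) (w : W) : (Fin 2 → ℤ) → W :=
  fun m => fieldCoeff (nthProd a b (-m 0 - 1)) (m 1) w

lemma fieldCoeff_nthProd (a b : VertexOperator ℂ W) (n k : ℤ) (w : W) :
    fieldCoeff (nthProd a b n) k w = prodSeries a b w ![-n - 1, k] := by
  simp [prodSeries]

lemma doubleCoeff_YE {p : MvPolynomial (Fin 2) ℂ} {a b : VertexOperator ℂ W} (hp : Clears p a b)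
    (w : W) : polyMul (polyShift p) (doubleCoeff (YE p a b hp w)) =
      substVar 0 1 (polyMul p (iterProd ![a, b] w)) := by
  rw [← doubleCoeff_shiftEval_smul, YE, iotaInv_eq]
  exact (congrArg doubleCoeff (Ser.mul_inv_mul (shiftEval_ne_zero hp.1) _)).trans
    (doubleCoeff_substSeries _ _)

lemma prodSeries_eq_of_clears {a b : VertexOperator ℂ W} (h : ∃ p, Clears p a b) (w : W) :
    prodSeries a b w = doubleCoeff (YE h.choose a b h.choose_spec w) := by
  funext m
  rw [prodSeries, nthProd, dif_pos h]
  change ((YE h.choose a b h.choose_spec w).coeff (-(-m 0 - 1) - 1)).coeff (m 1) = _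
  rw [show -(-m 0 - 1) - 1 = m 0 by ring]
  rfl

lemma prodSeries_mem_iterLaurent (a b : VertexOperator ℂ W) (w : W) :
    prodSeries a b w ∈ iterLaurent W 2 := by
  by_cases h : ∃ p, Clears p a b
  · rw [prodSeries_eq_of_clears h]
    exact doubleCoeff_mem_iterLaurent _
  · have : prodSeries a b w = 0 := by
      funext m
      rw [prodSeries, nthProd, dif_neg h, fieldCoeff_zero]
      rfl
    rw [this]
    exact (iterLaurent W 2).zero_mem

lemma Clears.mul_left {p : MvPolynomial (Fin 2) ℂ} {a b : VertexOperator ℂ W} (hp : Clears p a b)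
    {q : MvPolynomial (Fin 2) ℂ} (hq : q ≠ 0) : Clears (q * p) a b :=
  ⟨mul_ne_zero hq hp.1, fun w => by
    rw [polyMul_mul]; exact polyMul_mem_lowerTruncated _ (hp.2 w)⟩

lemma substVar_polyMul_pair (p : MvPolynomial (Fin 2) ℂ) {F : (Fin 2 → ℤ) → W}
    (hF : F ∈ lowerTruncated W 2) :
    substVar 0 1 (polyMul p F) = polyMul (polyShift p) (substVar 0 1 F) := by
  rw [substVar_polyMul (by decide) p (lowerTruncated_le_sliceTruncated (by decide) hF),
    shiftVar_zero_one]

/-- The defining relation of the products `a_n b`, for an arbitrary clearing polynomial. -/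
lemma polyMul_prodSeries {p : MvPolynomial (Fin 2) ℂ} {a b : VertexOperator ℂ W}
    (hp : Clears p a b) (w : W) :
    polyMul (polyShift p) (prodSeries a b w) = substVar 0 1 (polyMul p (iterProd ![a, b] w)) := by
  have h : ∃ p, Clears p a b := ⟨p, hp⟩
  set q := h.choose
  have hq : Clears q a b := h.choose_spec
  have hE : polyMul (polyShift q) (prodSeries a b w) =
      substVar 0 1 (polyMul q (iterProd ![a, b] w)) := by
    rw [prodSeries_eq_of_clears h]
    exact doubleCoeff_YE hq w
  -- The relation is known for the polynomial q chosen in `nthProd`. Multiplying it by p, and the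
  -- desired one by q, gives the same identity, and q cancels.
  refine eq_of_polyMul_eq (polyShift_ne_zero hq.1)
    (polyMul_mem_iterLaurent _ (prodSeries_mem_iterLaurent a b w))
    (substVar_mem_iterLaurent (hp.2 w)) ?_
  rw [polyMul_comm, hE, ← substVar_polyMul_pair _ (hq.2 w), ← substVar_polyMul_pair _ (hp.2 w),
    polyMul_comm]

/-- The defining relation determines the products `a_n b`. -/
lemma eq_prodSeries {p : MvPolynomial (Fin 2) ℂ} {a b : VertexOperator ℂ W}
    (hp : Clears p a b) {w : W} {q : MvPolynomial (Fin 2) ℂ} (hq : q ≠ 0) {F : (Fin 2 → ℤ) → W}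
    (hF : F ∈ iterLaurent W 2) (h : polyMul (polyShift (q * p)) F =
      substVar 0 1 (polyMul (q * p) (iterProd ![a, b] w))) : F = prodSeries a b w :=
  eq_of_polyMul_eq (polyShift_ne_zero (hp.mul_left hq).1) hF (prodSeries_mem_iterLaurent a b w)
    (h.trans (polyMul_prodSeries (hp.mul_left hq) w).symm)

/-- The bound depends on q only. Applied to the inverse of p(x_0 + x, x), it makes a_n b vanish for
large n on all vectors of W simultaneously. -/
lemma coeff_smul_eq_zero_of_lt_order {R M : Type*} [CommRing R] [AddCommGroup M] [Module R M]
    (q : LaurentSeries R) (g : Ser R M) (hg : ∀ n < 0, g.coeff n = 0) {n : ℤ} (hn : n < q.order) :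
    Ser.coeff (Ser.mul q g) n = 0 := by
  rw [Ser.coeff, Ser.mul, HahnModule.coeff_smul]
  refine Finset.sum_eq_zero fun ij hij => ?_
  obtain ⟨h1, h2, h3⟩ := (Finset.mem_vaddAntidiagonal _ _).1 hij
  have h4 : q.order ≤ ij.1 := HahnSeries.order_le_of_coeff_ne_zero h1
  rw [vadd_eq_add] at h3
  rw [show ((HahnModule.of R).symm g).coeff ij.2 = 0 from hg _ (by omega), smul_zero]

/-- The products `a_n b` vanish for `n` large. -/
lemma nthProd_truncated (a b : VertexOperator ℂ W) :
    ∃ N : ℤ, ∀ n < N, nthProd a b (-n - 1) = 0 := by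
  by_cases h : ∃ p, Clears p a b
  · refine ⟨(iotaInv h.choose).order, fun n hn => field_ext fun k w => ?_⟩
    rw [fieldCoeff_nthProd, prodSeries_eq_of_clears h, doubleCoeff, fieldCoeff_zero]
    have : (YE h.choose a b h.choose_spec w).coeff n = 0 := by
      refine coeff_smul_eq_zero_of_lt_order _ _ (fun i hi => ?_) hn
      exact HahnModule.ext _ _ (funext fun k => if_neg (by omega))
    simp only [Matrix.cons_val_zero]
    rw [show - (-n - 1) - 1 = n by ring, this]
    rfl
  · exact ⟨0, fun n _ => by rw [nthProd, dif_neg h]⟩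

/-! ### The identity field -/

lemma clears_one_idField_left (b : VertexOperator ℂ W) : Clears 1 (idField W) b := by
  refine ⟨one_ne_zero, fun w => ?_⟩
  obtain ⟨N, hN⟩ := fieldCoeff_truncated b w
  rw [polyMul_one]
  refine ⟨min N 0, fun m ⟨i, hi⟩ => ?_⟩
  rw [iterProd_pair, fieldCoeff_idField]
  split_ifs with h
  · refine hN _ ?_
    fin_cases i
    · exact absurd hi (by simp [h])
    · exact lt_of_lt_of_le hi (min_le_left _ _)
  · rfl

lemma clears_one_idField_right (a : VertexOperator ℂ W) : Clears 1 a (idField W) := by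
  refine ⟨one_ne_zero, fun w => ?_⟩
  obtain ⟨N, hN⟩ := fieldCoeff_truncated a w
  rw [polyMul_one]
  refine ⟨min N 0, fun m ⟨i, hi⟩ => ?_⟩
  rw [iterProd_pair, fieldCoeff_idField]
  split_ifs with h
  · refine hN _ ?_
    fin_cases i
    · exact lt_of_lt_of_le hi (min_le_left _ _)
    · exact absurd hi (by simp [h])
  · exact map_zero _

lemma polyShift_one : polyShift 1 = 1 := by simp [polyShift]

lemma prodSeries_idField_left (b : VertexOperator ℂ W) (w : W) :
    prodSeries (idField W) b w = substVar 0 1 (iterProd ![idField W, b] w) := by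
  have := polyMul_prodSeries (clears_one_idField_left b) w
  rwa [polyShift_one, polyMul_one, polyMul_one] at this

lemma prodSeries_idField_right (a : VertexOperator ℂ W) (w : W) :
    prodSeries a (idField W) w = substVar 0 1 (iterProd ![a, idField W] w) := by
  have := polyMul_prodSeries (clears_one_idField_right a) w
  rwa [polyShift_one, polyMul_one, polyMul_one] at this

/-- `1_W(x)_n b(x) = δ_{n, -1} b(x)`. -/
lemma nthProd_idField_left (b : VertexOperator ℂ W) (n : ℤ) :
    nthProd (idField W) b n = if n = -1 then b else 0 := by
  refine field_ext fun k w => ?_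
  rw [fieldCoeff_nthProd, prodSeries_idField_left]
  by_cases hn : 0 ≤ -n - 1
  · obtain ⟨i, hi⟩ : ∃ i : ℕ, -n - 1 = i := ⟨(-n - 1).toNat, by omega⟩
    rw [hi, substVar_apply (a := i) _ (by simp), finsum_eq_single _ 0]
    · have e : setTwo 0 1 ![(i : ℤ), k] ![0, ![(i : ℤ), k] 1 + i - 0] = ![0, k + i] := by
        funext t; fin_cases t <;> simp [setTwo]
      rw [e, iterProd_pair, fieldCoeff_idField]
      simp only [Matrix.cons_val_zero, Matrix.cons_val_one, if_true]
      split_ifs with h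
      · obtain rfl : i = 0 := by omega
        simp
      · rw [Ring.choose_zero_pos ℤ (by omega), zero_smul, fieldCoeff_zero]
        rfl
    · intro l hl
      rw [iterProd_pair, fieldCoeff_idField, if_neg, smul_zero]
      simpa [setTwo] using hl
  · rw [if_neg (by omega), substVar_eq_zero_of_neg _ _ _ (by simpa using hn), fieldCoeff_zero]
    rfl

/-- `a(x)_{-1} 1_W(x) = a(x)`. -/
lemma nthProd_idField_right (a : VertexOperator ℂ W) : nthProd a (idField W) (-1) = a := by
  refine field_ext fun k w => ?_
  rw [fieldCoeff_nthProd, prodSeries_idField_right,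
    substVar_apply (a := 0) _ (by simp), finsum_eq_single _ k]
  · have e : setTwo 0 1 ![-(-1) - 1, k] ![k, ![-(-1) - 1, k] 1 + ((0 : ℕ) : ℤ) - k] = ![k, 0] := by
      funext t; fin_cases t <;> simp [setTwo]
    rw [e, iterProd_pair, fieldCoeff_idField]
    simp
  · intro l hl
    rw [iterProd_pair, fieldCoeff_idField, if_neg, map_zero, smul_zero]
    simp [setTwo]
    omega

/-! ### The product relation on slices of series in r variables -/

lemma map_mem_iterLaurent (A : W →ₗ[ℂ] W') {F : (Fin r → ℤ) → W} (hF : F ∈ iterLaurent W r) :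
    (fun m => A (F m)) ∈ iterLaurent W' r := by
  intro k m
  obtain ⟨N, hN⟩ := hF k m
  exact ⟨N, fun m' hm hk => by simp [hN m' hm hk]⟩

/-- `G` and `H` are obtained, slice by slice in the variables `x_i, x_j`, by applying a linear map
to `a(x_i) b(x_j) v` and to `∑_n (a_n b)(x_j) v x_i^{-n-1}` respectively, for fields `a`, `b` such
that `p` clears `(a, b)`. -/
def IsPairSlice (p : MvPolynomial (Fin 2) ℂ) (i j : Fin r) (G H : (Fin r → ℤ) → W) : Prop :=
  ∀ m, ∃ (a b : VertexOperator ℂ W) (A : W →ₗ[ℂ] W) (v : W), Clears p a b ∧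
    (∀ n, G (setTwo i j m n) = A (iterProd ![a, b] v n)) ∧
    ∀ n, H (setTwo i j m n) = A (prodSeries a b v n)

section IsPairSlice
variable {p : MvPolynomial (Fin 2) ℂ} {i j : Fin r} {G H : (Fin r → ℤ) → W}

lemma IsPairSlice.mem_sliceTruncated (h : IsPairSlice p i j G H) (hij : i ≠ j) :
    polyMul (rename ![i, j] p) G ∈ sliceTruncated W i j := by
  intro m
  obtain ⟨a, b, A, v, hp, hG, -⟩ := h m
  rw [slice_rename hij, show slice i j m G = fun n => A (iterProd ![a, b] v n) from funext hG,
    polyMul_map]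
  exact map_mem_lowerTruncated A (hp.2 v)

lemma IsPairSlice.mem_sliceLaurent (h : IsPairSlice p i j G H) : H ∈ sliceLaurent W i j := by
  intro m
  obtain ⟨a, b, A, v, -, -, hH⟩ := h m
  rw [show slice i j m H = fun n => A (prodSeries a b v n) from funext hH]
  exact map_mem_iterLaurent A (prodSeries_mem_iterLaurent a b v)

lemma IsPairSlice.polyMul_eq (h : IsPairSlice p i j G H) (hij : i ≠ j) :
    polyMul (shiftVar i j (rename ![i, j] p)) H = substVar i j (polyMul (rename ![i, j] p) G) := by
  refine ext_slice (i := i) (j := j) fun m => ?_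
  obtain ⟨a, b, A, v, hp, hG, hH⟩ := h m
  rw [shiftVar_rename hij, slice_rename hij, slice_substVar hij, slice_rename hij,
    show slice i j m G = fun n => A (iterProd ![a, b] v n) from funext hG,
    show slice i j m H = fun n => A (prodSeries a b v n) from funext hH,
    polyMul_map, polyMul_map, polyMul_prodSeries hp,
    substVar_map A (lowerTruncated_le_sliceTruncated (by decide) (hp.2 v))]

/-- The extra factor q may involve all the variables: clearing a longer product needs more than the
polynomial p of the pair. -/
lemma IsPairSlice.polyMul_mul_eq (h : IsPairSlice p i j G H) (hij : i ≠ j)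
    (q : MvPolynomial (Fin r) ℂ) :
    polyMul (shiftVar i j (q * rename ![i, j] p)) H =
      substVar i j (polyMul (q * rename ![i, j] p) G) := by
  rw [map_mul, polyMul_mul, h.polyMul_eq hij, polyMul_mul,
    substVar_polyMul hij q (h.mem_sliceTruncated hij)]

end IsPairSlice

/-! ### Truncation in one variable -/

/-- The part of a formal series consisting of the terms of degree at most `n` in `x_i`. -/
def truncVar (i : Fin r) (n : ℤ) (H : (Fin r → ℤ) → W) : (Fin r → ℤ) → W :=
  fun m => if m i ≤ n then H m else 0

lemma truncVar_of_le {i : Fin r} {n : ℤ} (H : (Fin r → ℤ) → W) {m : Fin r → ℤ} (h : m i ≤ n) :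
    truncVar i n H m = H m := if_pos h

lemma truncVar_add (i : Fin r) (n : ℤ) (G H : (Fin r → ℤ) → W) :
    truncVar i n (G + H) = truncVar i n G + truncVar i n H := by
  funext m
  simp only [truncVar, Pi.add_apply]
  split_ifs <;> simp

lemma truncVar_smul (i : Fin r) (n : ℤ) (c : ℂ) (H : (Fin r → ℤ) → W) :
    truncVar i n (c • H) = c • truncVar i n H := by
  funext m
  simp only [truncVar, Pi.smul_apply]
  split_ifs <;> simp

lemma truncVar_X_of_ne {i k : Fin r} (h : k ≠ i) (n : ℤ) (H : (Fin r → ℤ) → W) :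
    truncVar i n (polyMul (X k) H) = polyMul (X k) (truncVar i n H) := by
  funext m
  rw [truncVar, polyMul_X, polyMul_X, truncVar, Function.update_of_ne (Ne.symm h)]

lemma truncVar_X_self (i : Fin r) (n : ℤ) (H : (Fin r → ℤ) → W) :
    truncVar i n (polyMul (X i) H) = polyMul (X i) (truncVar i (n - 1) H) := by
  funext m
  rw [truncVar, polyMul_X, polyMul_X, truncVar, Function.update_self]
  simp only [sub_le_sub_iff_right]

lemma truncVar_truncVar {i : Fin r} {n n' : ℤ} (h : n ≤ n') (H : (Fin r → ℤ) → W) :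
    truncVar i n (truncVar i n' H) = truncVar i n H := by
  funext m
  simp only [truncVar]
  split_ifs with h1 h2
  · rfl
  · omega
  · rfl

/-- Multiplication by a polynomial never lowers the degree in x_i, so terms of degree above n cannot
affect those of degree at most n. -/
lemma truncVar_polyMul_truncVar (i : Fin r) (p : MvPolynomial (Fin r) ℂ) (n : ℤ) :
    ∀ H : (Fin r → ℤ) → W, truncVar i n (polyMul p (truncVar i n H)) =
      truncVar i n (polyMul p H) := by
  induction p using MvPolynomial.induction_on with
  | C c => intro H; rw [polyMul_C, polyMul_C, truncVar_smul, truncVar_smul, truncVar_truncVar le_rfl]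
  | add p q hp hq =>
    intro H; rw [polyMul_add_left, truncVar_add, hp, hq, polyMul_add_left, truncVar_add]
  | mul_X p k hp =>
    intro H
    rw [polyMul_mul, polyMul_mul, ← hp, ← hp (polyMul (X k) H)]
    congr 2
    by_cases h : k = i
    · subst h
      rw [truncVar_X_self, truncVar_X_self, truncVar_truncVar (by omega)]
    · rw [truncVar_X_of_ne h, truncVar_X_of_ne h, truncVar_truncVar le_rfl]

lemma truncVar_polyMul {i : Fin r} {p : MvPolynomial (Fin r) ℂ}
    (hp : p ∈ MvPolynomial.supported ℂ {k | k ≠ i}) (n : ℤ) :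
    ∀ H : (Fin r → ℤ) → W, truncVar i n (polyMul p H) = polyMul p (truncVar i n H) := by
  rw [MvPolynomial.supported_eq_adjoin_X] at hp
  induction hp using Algebra.adjoin_induction with
  | mem x hx =>
    obtain ⟨k, hk, rfl⟩ := hx
    exact truncVar_X_of_ne hk n
  | algebraMap c =>
    intro H
    rw [MvPolynomial.algebraMap_eq, polyMul_C, polyMul_C, truncVar_smul]
  | add x y _ _ hx hy => intro H; rw [polyMul_add_left, truncVar_add, hx, hy, polyMul_add_left]
  | mul x y _ _ hx hy => intro H; rw [polyMul_mul, hx, hy, polyMul_mul]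

lemma rename_mem_supported_ne {s : ℕ} {i : Fin r} {f : Fin s → Fin r} (hf : ∀ k, f k ≠ i)
    (p : MvPolynomial (Fin s) ℂ) : rename f p ∈ MvPolynomial.supported ℂ {k | k ≠ i} := by
  rw [MvPolynomial.mem_supported]
  intro k hk
  obtain ⟨l, -, rfl⟩ := Finset.mem_image.1 (MvPolynomial.vars_rename f p hk)
  exact hf l

lemma truncVar_mem_levelTruncated {i : Fin r} (n : ℤ) {H : (Fin r → ℤ) → W}
    (hH : H ∈ levelTruncated W i) : truncVar i n H ∈ levelTruncated W i := by
  intro l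
  obtain ⟨N, hN⟩ := hH l
  refine ⟨N, fun m hm hk => ?_⟩
  rw [truncVar, hN m hm hk, ite_self]

lemma mem_levelTruncated_of_X_pow {i : Fin r} {k : ℕ} {H : (Fin r → ℤ) → W}
    (h : polyMul (X i ^ k) H ∈ levelTruncated W i) : H ∈ levelTruncated W i := by
  intro n
  obtain ⟨N, hN⟩ := h (n + k)
  refine ⟨min N n, fun m hm ⟨l, hl⟩ => ?_⟩
  have := hN (Function.update m i (m i + k)) (by simp [hm]) ⟨l, ?_⟩
  · rw [polyMul_X_pow] at this
    simpa using this
  · by_cases h : l = i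
    · subst h
      have := min_le_right N n
      omega
    · rw [Function.update_of_ne h]
      exact lt_of_lt_of_le hl (min_le_left _ _)

/-- If `x_i^k (p + x_i q) H` is truncated at each level of `x_i`, where `p` does not involve `x_i`,
then so are the products with powers of `p` of the truncations of `H`. -/
lemma pow_polyMul_truncVar_mem {i : Fin r} {p : MvPolynomial (Fin r) ℂ}
    (hp : p ∈ MvPolynomial.supported ℂ {k | k ≠ i}) (q : MvPolynomial (Fin r) ℂ) (k : ℕ)
    {H : (Fin r → ℤ) → W} {N : ℤ} (hN : ∀ m, m i < N → H m = 0)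
    (h : polyMul (X i ^ k * (p + X i * q)) H ∈ levelTruncated W i) (t : ℕ) :
    polyMul (p ^ t) (truncVar i (N - 1 + t) H) ∈ levelTruncated W i := by
  rw [polyMul_mul] at h
  replace h := mem_levelTruncated_of_X_pow h
  induction t with
  | zero =>
    have : truncVar i (N - 1 + (0 : ℕ)) H = 0 := by
      funext m
      rw [truncVar]
      split_ifs with hm
      · exact hN m (by push_cast at hm; omega)
      · rfl
    rw [this, polyMul_zero_right]
    exact (levelTruncated W i).zero_mem
  | succ t ih =>
    set n : ℤ := N - 1 + (t + 1 : ℕ) with hn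
    have hn1 : n - 1 = N - 1 + (t : ℕ) := by rw [hn]; push_cast; ring
    -- Here p H = (p + x_i q) H - x_i q H. Up to degree n, the last term depends only on H up to
    -- degree n - 1, and p^t brings that part under the induction hypothesis.
    have h1 : polyMul (p ^ (t + 1)) (truncVar i n H) =
        polyMul (p ^ t) (truncVar i n (polyMul (p + X i * q) H)) -
          polyMul (X i) (truncVar i (n - 1) (polyMul q (polyMul (p ^ t)
            (truncVar i (n - 1) H)))) := by
      have hpt : p ^ t ∈ MvPolynomial.supported ℂ {k | k ≠ i} := pow_mem hp t
      rw [polyMul_comm q, truncVar_polyMul hpt, truncVar_polyMul_truncVar, polyMul_comm (X i),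
        ← polyMul_sub_right, polyMul_add_left, truncVar_add, polyMul_mul (X i), truncVar_X_self,
        add_sub_cancel_right, truncVar_polyMul hp, pow_succ, polyMul_mul]
    rw [h1]
    refine (levelTruncated W i).sub_mem (polyMul_mem_levelTruncated _
      (truncVar_mem_levelTruncated _ h)) (polyMul_mem_levelTruncated _
      (truncVar_mem_levelTruncated _ (polyMul_mem_levelTruncated _ ?_)))
    rw [hn1]
    exact ih

lemma polyMul_rename_succAbove (i : Fin (r + 1)) (n : ℤ) (q : MvPolynomial (Fin r) ℂ) :
    ∀ (H : (Fin (r + 1) → ℤ) → W) (m : Fin r → ℤ),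
      polyMul (rename i.succAbove q) H (i.insertNth (α := fun _ => ℤ) n m) =
        polyMul q (fun m' => H (i.insertNth (α := fun _ => ℤ) n m')) m := by
  induction q using MvPolynomial.induction_on with
  | C c => intro H m; rw [MvPolynomial.rename_C, polyMul_C, polyMul_C]; rfl
  | add p q hp hq =>
    intro H m
    rw [map_add, polyMul_add_left, polyMul_add_left, Pi.add_apply, Pi.add_apply, hp, hq]
  | mul_X p k hp =>
    intro H m
    rw [map_mul, polyMul_mul, polyMul_mul, hp, MvPolynomial.rename_X]
    congr 1
    funext m'
    rw [polyMul_X, polyMul_X, Fin.insertNth_apply_succAbove, Fin.insertNth_update]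

/-! ### Products of quasi compatible sequences -/

/-- The multiplicative set generated by the nonzero polynomials in at most two of the variables. -/
def binarySubmonoid (r : ℕ) : Submonoid (MvPolynomial (Fin r) ℂ) :=
  Submonoid.closure {q | q ≠ 0 ∧ ∃ (i j : Fin r) (p : MvPolynomial (Fin 2) ℂ), q = rename ![i, j] p}

lemma rename_mem_binarySubmonoid {i j : Fin r} {p : MvPolynomial (Fin 2) ℂ}
    (h : rename ![i, j] p ≠ 0) : rename ![i, j] p ∈ binarySubmonoid r :=
  Submonoid.subset_closure ⟨h, i, j, p, rfl⟩

lemma comp_pair {α β : Type*} (f : α → β) (a b : α) : f ∘ ![a, b] = ![f a, f b] := by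
  funext k
  fin_cases k <;> rfl

lemma ne_zero_of_mem_binarySubmonoid {q : MvPolynomial (Fin r) ℂ} (hq : q ∈ binarySubmonoid r) :
    q ≠ 0 := by
  induction hq using Submonoid.closure_induction with
  | mem x hx => exact hx.1
  | one => exact one_ne_zero
  | mul x y _ _ hx hy => exact mul_ne_zero hx hy

lemma map_mem_binarySubmonoid {s : ℕ} {f : Fin r → Fin s} (hf : Function.Injective f)
    {q : MvPolynomial (Fin r) ℂ} (hq : q ∈ binarySubmonoid r) :
    rename f q ∈ binarySubmonoid s := by
  induction hq using Submonoid.closure_induction with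
  | mem x hx =>
    obtain ⟨h0, i, j, p, rfl⟩ := hx
    have h1 : rename f (rename ![i, j] p) ≠ 0 := fun h =>
      h0 (MvPolynomial.rename_injective f hf (h.trans (map_zero _).symm))
    rw [MvPolynomial.rename_rename, comp_pair] at h1 ⊢
    exact rename_mem_binarySubmonoid h1
  | one => rw [map_one]; exact one_mem _
  | mul x y _ _ hx hy => rw [map_mul]; exact mul_mem hx hy

/-- Reversed indices are corrected by exchanging the variables of p. A polynomial in one variable is
regarded as one in two by adjoining an idle variable, which exists because r ≥ 2. -/
lemma exists_lt_rename {i j : Fin r} (hr : 2 ≤ r) {p : MvPolynomial (Fin 2) ℂ}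
    (h : rename ![i, j] p ≠ 0) : ∃ (k l : Fin r) (q : MvPolynomial (Fin 2) ℂ), k < l ∧ q ≠ 0 ∧
      rename ![i, j] p = rename ![k, l] q := by
  suffices H : ∃ (k l : Fin r) (a b : Fin 2), k < l ∧
      rename ![i, j] p = rename ![k, l] (rename ![a, b] p) by
    obtain ⟨k, l, a, b, hkl, he⟩ := H
    exact ⟨k, l, _, hkl, fun h0 => h (by rw [he, h0, map_zero]), he⟩
  have key : ∀ (k l : Fin r) (a b : Fin 2), ![k, l] a = i → ![k, l] b = j →
      rename ![i, j] p = rename ![k, l] (rename ![a, b] p) := by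
    intro k l a b ha hb
    rw [MvPolynomial.rename_rename, comp_pair, ha, hb]
  rcases lt_trichotomy i j with hij | hij | hij
  · exact ⟨i, j, 0, 1, hij, key _ _ _ _ rfl rfl⟩
  · subst hij
    have : Nontrivial (Fin r) := Fin.nontrivial_iff_two_le.2 hr
    obtain ⟨k, hk⟩ := exists_ne i
    rcases lt_or_gt_of_ne hk with hk | hk
    · exact ⟨k, i, 1, 1, hk, key _ _ _ _ rfl rfl⟩
    · exact ⟨i, k, 0, 0, hk, key _ _ _ _ rfl rfl⟩
  · exact ⟨j, i, 1, 0, hij, key _ _ _ _ rfl rfl⟩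

lemma exists_dvd_prod (hr : 2 ≤ r) {q : MvPolynomial (Fin r) ℂ} (hq : q ∈ binarySubmonoid r) :
    ∃ p : MvPolynomial (Fin 2) ℂ, p ≠ 0 ∧
      q ∣ ∏ i : Fin r, ∏ j ∈ Finset.Ioi i, rename ![i, j] p := by
  induction hq using Submonoid.closure_induction with
  | mem x hx =>
    obtain ⟨h0, i, j, p, rfl⟩ := hx
    obtain ⟨k, l, q, hkl, hq, he⟩ := exists_lt_rename hr h0
    refine ⟨q, hq, ?_⟩
    rw [he]
    exact (Finset.dvd_prod_of_mem (fun j => rename ![k, j] q) (Finset.mem_Ioi.2 hkl)).trans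
      (Finset.dvd_prod_of_mem (fun i => ∏ j ∈ Finset.Ioi i, rename ![i, j] q) (Finset.mem_univ k))
  | one => exact ⟨1, one_ne_zero, one_dvd _⟩
  | mul x y _ _ hx hy =>
    obtain ⟨p, hp, hpx⟩ := hx
    obtain ⟨q, hq, hqy⟩ := hy
    refine ⟨p * q, mul_ne_zero hp hq, ?_⟩
    simp only [map_mul, Finset.prod_mul_distrib]
    exact mul_dvd_mul hpx hqy

/-- Arbitrary products of polynomials in at most two variables survive substitutions and insertions
more easily than the fixed shape ∏ p(x_i, x_j). The product of the polynomials used recovers that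
shape. -/
lemma quasiCompatibleSeq_iff {ψ : Fin r → VertexOperator ℂ W} :
    QuasiCompatibleSeq ψ ↔ ∃ q ∈ binarySubmonoid r, ∀ w,
      polyMul q (iterProd ψ w) ∈ lowerTruncated W r := by
  constructor
  · rintro ⟨p, hp, h⟩
    refine ⟨_, Submonoid.prod_mem _ fun i _ => Submonoid.prod_mem _ fun j hj => ?_, h⟩
    exact rename_mem_binarySubmonoid (rename_pair_ne_zero (Finset.mem_Ioi.1 hj).ne hp)
  · rintro ⟨q, hq, h⟩
    by_cases hr : 2 ≤ r
    · obtain ⟨p, hp, d, hd⟩ := exists_dvd_prod hr hq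
      refine ⟨p, hp, fun w => ?_⟩
      rw [hd, mul_comm, polyMul_mul]
      exact polyMul_mem_lowerTruncated _ (h w)
    -- For r ≤ 1 there are no pairs, and a single field is truncated anyway.
    · refine ⟨1, one_ne_zero, fun w => polyMul_mem_lowerTruncated _ ?_⟩
      obtain rfl | rfl : r = 0 ∨ r = 1 := by omega
      · exact ⟨0, fun m ⟨i, _⟩ => i.elim0⟩
      · obtain ⟨N, hN⟩ := fieldCoeff_truncated (ψ 0) w
        refine ⟨N, fun m ⟨i, hi⟩ => ?_⟩
        obtain rfl : i = 0 := Subsingleton.elim _ _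
        simpa [iterProd] using hN _ hi

/-! ### Inserting fields into a sequence -/

lemma insertNth_succ_eq_cons {α : Type*} (i : Fin (r + 1)) (x : α) (f : Fin (r + 1) → α) :
    i.succ.insertNth (α := fun _ => α) x f =
      Fin.cons (f 0) (i.insertNth (α := fun _ => α) x (Fin.tail f)) := by
  refine (Fin.eq_insertNth_iff.2 ⟨?_, ?_⟩).symm
  · simp
  · funext k
    refine Fin.cases ?_ (fun k => ?_) k
    · simp [Fin.removeNth]
    · simp [Fin.removeNth, Fin.tail]

/-- Inserting one or two factors into a product at a fixed place. -/
lemma exists_prod_insertNth {M : Type*} [Monoid M] : ∀ {r : ℕ} (f : Fin r → M) (i : Fin (r + 1)),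
    ∃ A B : M, (List.ofFn f).prod = A * B ∧
      (∀ x, (List.ofFn (i.insertNth (α := fun _ => M) x f)).prod = A * (x * B)) ∧
      ∀ x y, (List.ofFn (i.castSucc.insertNth (α := fun _ => M) x
        (i.insertNth (α := fun _ => M) y f))).prod = A * (x * (y * B)) := by
  intro r
  induction r with
  | zero =>
    intro f i
    obtain rfl : i = 0 := Fin.ext (by omega)
    refine ⟨1, (List.ofFn f).prod, (one_mul _).symm, fun x => ?_, fun x y => ?_⟩
    · simp [Fin.insertNth_zero', List.ofFn_succ]
    · simp [Fin.insertNth_zero', List.ofFn_succ]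
  | succ r ih =>
    intro f i
    refine Fin.cases ?_ (fun i => ?_) i
    · refine ⟨1, (List.ofFn f).prod, (one_mul _).symm, fun x => ?_, fun x y => ?_⟩
      · simp [Fin.insertNth_zero', List.ofFn_succ]
      · simp [Fin.insertNth_zero', List.ofFn_succ]
    · obtain ⟨A, B, h0, h1, h2⟩ := ih (Fin.tail f) i
      have hcons : ∀ {s : ℕ} (a : M) (g : Fin s → M),
          (List.ofFn (Fin.cons (α := fun _ => M) a g)).prod = a * (List.ofFn g).prod := by
        intro s a g
        simp [List.ofFn_succ]
      refine ⟨f 0 * A, B, ?_, fun x => ?_, fun x y => ?_⟩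
      · conv_lhs => rw [← Fin.cons_self_tail f]
        rw [hcons, h0, mul_assoc]
      · rw [insertNth_succ_eq_cons, hcons, h1, mul_assoc]
      · rw [← Fin.succ_castSucc, insertNth_succ_eq_cons i, insertNth_succ_eq_cons, hcons,
          Fin.tail_cons, Fin.cons_zero, h2, mul_assoc]

lemma coeff_insertNth (i : Fin (r + 1)) (c : VertexOperator ℂ W) (f : Fin r → VertexOperator ℂ W)
    (m : Fin (r + 1) → ℤ) :
    (fun k => (HVertexOperator.coeff (i.insertNth (α := fun _ => VertexOperator ℂ W) c f k) (m k) :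
      Module.End ℂ W)) =
      i.insertNth (α := fun _ => Module.End ℂ W) (HVertexOperator.coeff c (m i))
        (fun k => HVertexOperator.coeff (f k) (m (i.succAbove k))) := by
  refine Fin.eq_insertNth_iff.2 ⟨?_, ?_⟩
  · simp
  · funext k
    simp [Fin.removeNth]

/-- The formal series of a sequence into which one or two fields are inserted. -/
lemma exists_iterProd_insertNth (f : Fin r → VertexOperator ℂ W) (i : Fin (r + 1)) (l : Fin r → ℤ)
    (w : W) : ∃ (A : W →ₗ[ℂ] W) (v : W), iterProd f w l = A v ∧
      (∀ (c : VertexOperator ℂ W) (m : Fin (r + 1) → ℤ), (∀ k, m (i.succAbove k) = l k) →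
        iterProd (i.insertNth (α := fun _ => VertexOperator ℂ W) c f) w m =
          A (fieldCoeff c (m i) v)) ∧
      ∀ (a b : VertexOperator ℂ W) (m : Fin (r + 2) → ℤ),
        (∀ k, m (i.castSucc.succAbove (i.succAbove k)) = l k) →
        iterProd (i.castSucc.insertNth (α := fun _ => VertexOperator ℂ W) a
          (i.insertNth (α := fun _ => VertexOperator ℂ W) b f)) w m =
          A (iterProd ![a, b] v ![m i.castSucc, m i.succ]) := by
  obtain ⟨A, B, h0, h1, h2⟩ := exists_prod_insertNth
    (fun k => (HVertexOperator.coeff (f k) (l k) : Module.End ℂ W)) i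
  refine ⟨A, B w, ?_, fun c m hm => ?_, fun a b m hm => ?_⟩
  · rw [iterProd, h0]
    rfl
  · rw [iterProd, coeff_insertNth]
    simp only [hm]
    rw [h1]
    rfl
  · rw [iterProd, coeff_insertNth]
    have := coeff_insertNth i b f (fun k => m (i.castSucc.succAbove k))
    rw [this]
    simp only [hm, Fin.succAbove_castSucc_self]
    rw [h2, iterProd_pair]
    rfl

/-! ### Leading coefficients in `x_0` of `p(x_0 + x, x)` -/

/-- Modulo d the two homomorphisms agree on the variables, hence everywhere. -/
lemma dvd_algHom_sub {σ B : Type*} [CommRing B] [Algebra ℂ B] (α β : MvPolynomial σ ℂ →ₐ[ℂ] B)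
    {d : B} (h : ∀ k, d ∣ α (X k) - β (X k)) (f : MvPolynomial σ ℂ) : d ∣ α f - β f := by
  induction f using MvPolynomial.induction_on with
  | C c =>
    rw [← MvPolynomial.algebraMap_eq, α.commutes, β.commutes, sub_self]
    exact dvd_zero d
  | add p q hp hq =>
    rw [map_add, map_add, add_sub_add_comm]
    exact dvd_add hp hq
  | mul_X p k hp =>
    have e : α (p * X k) - β (p * X k) =
        (α p - β p) * α (X k) + β p * (α (X k) - β (X k)) := by
      rw [map_mul, map_mul]
      ring
    rw [e]
    exact dvd_add (hp.mul_right _) ((h k).mul_left _)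

/-- The polynomials `q` such that the lowest coefficient in `x_i` of the result of substituting
`x_i ↦ x_i + x_{i+1}` in `q` lies in `binarySubmonoid`. -/
def leadingBinary (i : Fin (r + 1)) : Submonoid (MvPolynomial (Fin (r + 2)) ℂ) where
  carrier := {q | ∃ (k : ℕ) (q₀ : MvPolynomial (Fin (r + 1)) ℂ) (b : MvPolynomial (Fin (r + 2)) ℂ),
    q₀ ∈ binarySubmonoid (r + 1) ∧ shiftVar i.castSucc i.succ q =
      X i.castSucc ^ k * (rename i.castSucc.succAbove q₀ + X i.castSucc * b)}
  one_mem' := ⟨0, 1, 0, one_mem _, by simp⟩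
  mul_mem' := by
    rintro q q' ⟨k, q₀, b, hq₀, h⟩ ⟨k', q₀', b', hq₀', h'⟩
    refine ⟨k + k', q₀ * q₀', b * rename i.castSucc.succAbove q₀' +
      rename i.castSucc.succAbove q₀ * b' + X i.castSucc * b * b', mul_mem hq₀ hq₀', ?_⟩
    rw [map_mul, h, h', map_mul]
    ring

/-- Setting x_i = 0 after x_i ↦ x_i + x_{i+1} identifies the two variables, and `predAbove` is this
identification of indices. -/
lemma shiftVar_congr_predAbove (i : Fin (r + 1)) (q : MvPolynomial (Fin (r + 2)) ℂ) :
    X i.castSucc ∣ shiftVar i.castSucc i.succ q -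
      rename i.castSucc.succAbove (rename i.predAbove q) := by
  rw [MvPolynomial.rename_rename]
  refine dvd_algHom_sub _ (rename (i.castSucc.succAbove ∘ i.predAbove)) (fun k => ?_) q
  rw [MvPolynomial.rename_X, Function.comp_apply]
  by_cases hk : k = i.castSucc
  · subst hk
    rw [shiftVar_X_self, Fin.predAbove_castSucc_self, Fin.succAbove_castSucc_self,
      add_sub_cancel_right]
  · rw [shiftVar_X_of_ne hk, Fin.succAbove_predAbove hk, sub_self]
    exact dvd_zero _

lemma mem_leadingBinary_of_ne_zero {i : Fin (r + 1)} {s t : Fin (r + 2)}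
    {p : MvPolynomial (Fin 2) ℂ} (h : rename ![i.predAbove s, i.predAbove t] p ≠ 0) :
    rename ![s, t] p ∈ leadingBinary i := by
  obtain ⟨b, hb⟩ := shiftVar_congr_predAbove i (rename ![s, t] p)
  refine ⟨0, rename ![i.predAbove s, i.predAbove t] p, b, rename_mem_binarySubmonoid h, ?_⟩
  have e : rename i.predAbove (rename ![s, t] p) = rename ![i.predAbove s, i.predAbove t] p := by
    rw [MvPolynomial.rename_rename, comp_pair]
  rw [pow_zero, one_mul, ← e, ← hb]
  ring

/-- Modulo X 0 - X 1 the polynomial p equals p(X 1, X 1), which is zero. -/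
lemma diagonal_dvd {p : MvPolynomial (Fin 2) ℂ} {s : ℕ} {u : Fin s}
    (h : rename ![u, u] p = 0) : X 0 - X 1 ∣ p := by
  have h1 : rename ![(1 : Fin 2), 1] p = 0 := by
    have := congrArg (rename fun _ => (1 : Fin 2)) h
    rwa [MvPolynomial.rename_rename, comp_pair, map_zero] at this
  have := dvd_algHom_sub (AlgHom.id ℂ _) (rename ![(1 : Fin 2), 1]) (d := X 0 - X 1)
    (fun k => by
      fin_cases k
      · simp
      · simp) p
  rwa [h1, sub_zero] at this

/-- A generator that remains nonzero when x_i and x_{i+1} are identified provides its own lowest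
coefficient. Otherwise it is some p(x_s, x_t) with {s, t} = {i, i+1} and p zero on the diagonal. The
full power of x_s - x_t dividing it becomes a power of ±x_i, and the cofactor is of the first kind.
-/
lemma binarySubmonoid_le_leadingBinary (i : Fin (r + 1)) :
    binarySubmonoid (r + 2) ≤ leadingBinary i := by
  refine Submonoid.closure_le.2 ?_
  rintro q ⟨h0, s, t, p, rfl⟩
  by_cases hz : rename ![i.predAbove s, i.predAbove t] p = 0
  swap
  · exact mem_leadingBinary_of_ne_zero hz
  have hp : p ≠ 0 := fun h => h0 (by rw [h, map_zero])
  have hst : s ≠ t := by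
    rintro rfl
    apply h0
    have := congrArg (rename fun _ => s) hz
    rwa [MvPolynomial.rename_rename, comp_pair, map_zero] at this
  have hpred : i.predAbove s = i.predAbove t := by
    by_contra hne
    exact rename_pair_ne_zero hne hp hz
  have hdiff : (X s - X t : MvPolynomial (Fin (r + 2)) ℂ) ∈ leadingBinary i := by
    have hC : ∀ c : ℂ, c ≠ 0 → (C c : MvPolynomial (Fin (r + 1)) ℂ) ∈ binarySubmonoid (r + 1) := by
      intro c hc
      have := rename_mem_binarySubmonoid (i := (0 : Fin (r + 1))) (j := 0) (p := C c)
        (by rw [MvPolynomial.rename_C]; simpa using hc)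
      rwa [MvPolynomial.rename_C] at this
    by_cases hs : s = i.castSucc
    · have ht : t = i.succ := by
        have := Fin.succAbove_predAbove (p := i) (i := t) (fun h => hst (hs.trans h.symm))
        rw [← this, ← hpred, hs, Fin.predAbove_castSucc_self, Fin.succAbove_castSucc_self]
      refine ⟨1, C 1, 0, hC 1 one_ne_zero, ?_⟩
      rw [hs, ht, map_sub, shiftVar_X_self, shiftVar_X_of_ne (Fin.castSucc_lt_succ).ne']
      simp
    · have hs' := Fin.succAbove_predAbove (p := i) (i := s) hs
      have ht : t = i.castSucc := by
        by_contra ht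
        have ht' := Fin.succAbove_predAbove (p := i) (i := t) ht
        exact hst (by rw [← hs', hpred, ht'])
      have hs'' : s = i.succ := by
        rw [← hs', hpred, ht, Fin.predAbove_castSucc_self, Fin.succAbove_castSucc_self]
      refine ⟨1, C (-1), 0, hC (-1) (by simp), ?_⟩
      rw [hs'', ht, map_sub, shiftVar_X_self, shiftVar_X_of_ne (Fin.castSucc_lt_succ).ne']
      simp
  have hunit : ¬ IsUnit (X 0 - X 1 : MvPolynomial (Fin 2) ℂ) := by
    intro hu
    have := hu.map (MvPolynomial.aeval (fun _ => (0 : ℂ)))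
    simp at this
  obtain ⟨p₁, he, hndvd⟩ :=
    (FiniteMultiplicity.of_not_isUnit hunit hp).exists_eq_pow_mul_and_not_dvd
  have e : rename ![s, t] (X 0 - X 1) = (X s - X t : MvPolynomial (Fin (r + 2)) ℂ) := by simp
  rw [he, map_mul, map_pow, e]
  refine mul_mem (pow_mem hdiff _) (mem_leadingBinary_of_ne_zero fun h => hndvd ?_)
  · rw [hpred] at h
    exact diagonal_dvd h

/-! ### Closure properties of quasi compatibility -/

/-- The sequence `f` with the field `c` inserted at the place `i`. -/
abbrev insertField (i : Fin (r + 1)) (c : VertexOperator ℂ W) (f : Fin r → VertexOperator ℂ W) :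
    Fin (r + 1) → VertexOperator ℂ W :=
  i.insertNth (α := fun _ => VertexOperator ℂ W) c f

/-- Replacing two adjacent members `a, b` of a quasi compatible sequence by `a_n b` gives a quasi
compatible sequence. -/
lemma QuasiCompatibleSeq.nthProd {i : Fin (r + 1)} {a b : VertexOperator ℂ W}
    {f : Fin r → VertexOperator ℂ W}
    (h : QuasiCompatibleSeq (insertField i.castSucc a (insertField i b f)))
    (hab : ∃ p, Clears p a b) (n : ℤ) :
    QuasiCompatibleSeq (insertField i (nthProd a b n) f) := by
  obtain ⟨p, hp⟩ := hab
  obtain ⟨q, hq, hqw⟩ := quasiCompatibleSeq_iff.1 h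
  have hij : i.castSucc ≠ i.succ := Fin.castSucc_lt_succ.ne
  have hmem : q * rename ![i.castSucc, i.succ] p ∈ binarySubmonoid (r + 2) :=
    mul_mem hq (rename_mem_binarySubmonoid (rename_pair_ne_zero hij hp.1))
  obtain ⟨k, q₀, b₀, hq₀, hlead⟩ := binarySubmonoid_le_leadingBinary i hmem
  obtain ⟨N, hN⟩ := nthProd_truncated a b
  -- The powers of x_0 in the series of products start at N, and a_n b sits at -n - 1. With this t,
  -- the truncation degree N - 1 + t reaches it.
  set t := (-n - 1 - N + 1).toNat with ht
  refine quasiCompatibleSeq_iff.2 ⟨q₀ ^ t, pow_mem hq₀ t, fun w => ?_⟩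
  set G := iterProd (insertField i.castSucc a (insertField i b f)) w with hG
  -- The variable of index `i.castSucc` plays the role of x_0; the others belong to the shortened
  -- sequence.
  let H : (Fin (r + 2) → ℤ) → W := fun m =>
    iterProd (insertField i (NonlocalVA.nthProd a b (-m i.castSucc - 1)) f) w
      (fun k => m (i.castSucc.succAbove k))
  have hslice : IsPairSlice p i.castSucc i.succ G H := by
    intro m
    obtain ⟨A, v, -, h1, h2⟩ := exists_iterProd_insertNth f i
      (fun k => m (i.castSucc.succAbove (i.succAbove k))) w
    have hoff : ∀ n k, setTwo i.castSucc i.succ m n (i.castSucc.succAbove (i.succAbove k)) =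
        m (i.castSucc.succAbove (i.succAbove k)) := by
      intro n k
      refine setTwo_of_ne _ _ (Fin.succAbove_ne _ _) ?_
      rw [← Fin.succAbove_castSucc_self]
      exact fun h => Fin.succAbove_ne i k (Fin.succAbove_right_injective h)
    refine ⟨a, b, A, v, hp, fun n => ?_, fun n => ?_⟩
    · rw [hG, h2 a b _ (hoff n), setTwo_left hij, setTwo_right]
      congr 2
    · change iterProd _ w _ = _
      rw [h1 _ _ (hoff n), setTwo_left hij, Fin.succAbove_castSucc_self, setTwo_right]
      rfl
  have hlevel : polyMul (shiftVar i.castSucc i.succ (q * rename ![i.castSucc, i.succ] p)) H ∈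
      levelTruncated W i.castSucc := by
    rw [hslice.polyMul_mul_eq hij]
    refine substVar_mem_levelTruncated hij ?_
    rw [mul_comm, polyMul_mul]
    exact polyMul_mem_lowerTruncated _ (hqw w)
  rw [hlead] at hlevel
  have hbdd : ∀ m : Fin (r + 2) → ℤ, m i.castSucc < N → H m = 0 := by
    intro m hm
    obtain ⟨A, v, -, h1, -⟩ := exists_iterProd_insertNth f i
      (fun k => m (i.castSucc.succAbove (i.succAbove k))) w
    change iterProd _ w _ = _
    rw [h1 _ _ (fun k => rfl), hN _ hm, fieldCoeff_zero, LinearMap.zero_apply, map_zero]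
  have hmain := pow_polyMul_truncVar_mem
    (rename_mem_supported_ne (fun k => Fin.succAbove_ne i.castSucc k) q₀) b₀ k hbdd hlevel t
  obtain ⟨M, hM⟩ := hmain (-n - 1)
  refine ⟨M, fun m ⟨l, hl⟩ => ?_⟩
  have hz := hM (i.castSucc.insertNth (α := fun _ => ℤ) (-n - 1) m) (by simp)
    ⟨i.castSucc.succAbove l, by simpa using hl⟩
  rw [← map_pow, polyMul_rename_succAbove] at hz
  rw [← hz]
  congr 1
  funext m'
  rw [truncVar_of_le]
  · change _ = iterProd _ w _
    simp only [Fin.insertNth_apply_same, Fin.insertNth_apply_succAbove]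
    rw [show -(-n - 1) - 1 = n by ring]
  · rw [Fin.insertNth_apply_same]
    omega

/-- The identity field contributes only the exponent 0 in its own variable, so the old clearing
polynomial still works in the renamed variables. -/
lemma QuasiCompatibleSeq.insert_idField {f : Fin r → VertexOperator ℂ W} (h : QuasiCompatibleSeq f)
    (i : Fin (r + 1)) : QuasiCompatibleSeq (insertField i (idField W) f) := by
  obtain ⟨q, hq, hqw⟩ := quasiCompatibleSeq_iff.1 h
  refine quasiCompatibleSeq_iff.2 ⟨rename i.succAbove q,
    map_mem_binarySubmonoid Fin.succAbove_right_injective hq, fun w => ?_⟩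
  obtain ⟨N, hN⟩ := hqw w
  have key : ∀ (n : ℤ) (m : Fin r → ℤ), iterProd (insertField i (idField W) f) w
      (i.insertNth (α := fun _ => ℤ) n m) = if n = 0 then iterProd f w m else 0 := by
    intro n m
    obtain ⟨A, v, h0, h1, -⟩ := exists_iterProd_insertNth f i m w
    rw [h1 _ _ (by simp), Fin.insertNth_apply_same, fieldCoeff_idField, h0]
    split_ifs
    · rfl
    · exact map_zero A
  refine ⟨min N 0, fun m ⟨k, hk⟩ => ?_⟩
  have hk0 := min_le_right N 0
  rw [← Fin.insertNth_self_removeNth i m, polyMul_rename_succAbove]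
  simp only [key]
  by_cases hm : m i = 0
  · simp only [hm, if_true]
    refine hN _ ?_
    obtain ⟨l, rfl⟩ := Fin.exists_succAbove_eq (x := k) (y := i)
      (fun h => by rw [h, hm] at hk; omega)
    exact ⟨l, lt_of_lt_of_le hk (min_le_left _ _)⟩
  · simp only [hm, if_false]
    exact congrFun (polyMul_zero_right q) _

lemma iterProd_insertField_add (i : Fin (r + 1)) (a b : VertexOperator ℂ W)
    (f : Fin r → VertexOperator ℂ W) (w : W) : iterProd (insertField i (a + b) f) w =
      iterProd (insertField i a f) w + iterProd (insertField i b f) w := by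
  funext m
  obtain ⟨A, v, -, h1, -⟩ := exists_iterProd_insertNth f i (fun k => m (i.succAbove k)) w
  rw [Pi.add_apply, h1 _ _ fun _ => rfl, h1 _ _ fun _ => rfl, h1 _ _ fun _ => rfl, ← map_add]
  rfl

lemma iterProd_insertField_smul (i : Fin (r + 1)) (c : ℂ) (a : VertexOperator ℂ W)
    (f : Fin r → VertexOperator ℂ W) (w : W) :
    iterProd (insertField i (c • a) f) w = c • iterProd (insertField i a f) w := by
  funext m
  obtain ⟨A, v, -, h1, -⟩ := exists_iterProd_insertNth f i (fun k => m (i.succAbove k)) w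
  rw [Pi.smul_apply, h1 _ _ fun _ => rfl, h1 _ _ fun _ => rfl, ← map_smul]
  rfl

lemma QuasiCompatibleSeq.insert_add {i : Fin (r + 1)} {a b : VertexOperator ℂ W}
    {f : Fin r → VertexOperator ℂ W} (ha : QuasiCompatibleSeq (insertField i a f))
    (hb : QuasiCompatibleSeq (insertField i b f)) :
    QuasiCompatibleSeq (insertField i (a + b) f) := by
  obtain ⟨p, hp, hpw⟩ := quasiCompatibleSeq_iff.1 ha
  obtain ⟨q, hq, hqw⟩ := quasiCompatibleSeq_iff.1 hb
  refine quasiCompatibleSeq_iff.2 ⟨p * q, mul_mem hp hq, fun w => ?_⟩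
  rw [iterProd_insertField_add, polyMul_add_right]
  refine (lowerTruncated W _).add_mem ?_ ?_
  · rw [mul_comm, polyMul_mul]
    exact polyMul_mem_lowerTruncated _ (hpw w)
  · rw [polyMul_mul]
    exact polyMul_mem_lowerTruncated _ (hqw w)

lemma QuasiCompatibleSeq.insert_smul {i : Fin (r + 1)} {a : VertexOperator ℂ W}
    {f : Fin r → VertexOperator ℂ W} (ha : QuasiCompatibleSeq (insertField i a f)) (c : ℂ) :
    QuasiCompatibleSeq (insertField i (c • a) f) := by
  obtain ⟨p, hp, hpw⟩ := quasiCompatibleSeq_iff.1 ha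
  refine quasiCompatibleSeq_iff.2 ⟨p, hp, fun w => ?_⟩
  rw [iterProd_insertField_smul, ← polyMul_C, polyMul_comm]
  exact polyMul_mem_lowerTruncated _ (hpw w)

lemma QuasiCompatible.mono {S T : Set (VertexOperator ℂ W)} (hT : QuasiCompatible T) (h : S ⊆ T) :
    QuasiCompatible S := fun r ψ hψ => hT r ψ fun i => h (hψ i)

lemma QuasiCompatible.exists_clears {T : Set (VertexOperator ℂ W)} (hT : QuasiCompatible T)
    {a b : VertexOperator ℂ W} (ha : a ∈ T) (hb : b ∈ T) : ∃ p, Clears p a b := by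
  obtain ⟨q, hq, h⟩ := quasiCompatibleSeq_iff.1 (hT 2 ![a, b] (by
    intro i
    fin_cases i
    · exact ha
    · exact hb))
  exact ⟨q, ne_zero_of_mem_binarySubmonoid hq, h⟩

/-! ### Maximal quasi compatible sets -/

open Classical in
/-- The number of members of a sequence outside a set. -/
def countOutside (M : Set (VertexOperator ℂ W)) (f : Fin r → VertexOperator ℂ W) : ℕ :=
  ∑ i, if f i ∈ M then 0 else 1

open Classical in
lemma countOutside_insertField (M : Set (VertexOperator ℂ W)) (i : Fin (r + 1))
    (c : VertexOperator ℂ W) (f : Fin r → VertexOperator ℂ W) :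
    countOutside M (insertField i c f) = (if c ∈ M then 0 else 1) + countOutside M f := by
  rw [countOutside, Fin.sum_univ_succAbove _ i]
  simp [countOutside]

/-- A criterion for membership in a maximal quasi compatible set. -/
lemma mem_of_maximal {M : Set (VertexOperator ℂ W)} (hM : Maximal QuasiCompatible M)
    (c : VertexOperator ℂ W)
    (h : c ∉ M → ∀ (r : ℕ) (i : Fin (r + 1)) (f : Fin r → VertexOperator ℂ W),
      (∀ (s : ℕ) (g : Fin s → VertexOperator ℂ W), (∀ k, g k ∈ insert c M) →
        countOutside M g ≤ countOutside M f → QuasiCompatibleSeq g) →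
      (∀ k, f k ∈ insert c M) → QuasiCompatibleSeq (insertField i c f)) : c ∈ M := by
  by_contra hc
  have hins : QuasiCompatible (insert c M) := by
    -- Induction on the number of entries outside M, each of which equals c. Removing one occurrence
    -- of c leaves f with fewer such entries, and h returns from f to the full sequence.
    suffices H : ∀ (N r : ℕ) (f : Fin r → VertexOperator ℂ W), (∀ k, f k ∈ insert c M) →
        countOutside M f ≤ N → QuasiCompatibleSeq f from
      fun r f hf => H _ r f hf le_rfl
    intro N
    induction N with
    | zero =>
      intro r f hf h0
      refine hM.prop r f fun i => ?_
      by_contra hi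
      have := (Finset.sum_eq_zero_iff.1 (Nat.le_zero.1 h0)) i (Finset.mem_univ i)
      simp [hi] at this
    | succ N ih =>
      intro r f hf hN
      by_cases hall : ∀ i, f i ∈ M
      · exact hM.prop r f hall
      obtain ⟨i, hi⟩ := not_forall.1 hall
      have hfi : f i = c := (hf i).resolve_right hi
      cases r with
      | zero => exact i.elim0
      | succ r =>
        have hf' : f = insertField i c (i.removeNth f) := by
          rw [← hfi]
          exact (Fin.insertNth_self_removeNth i f).symm
        rw [hf'] at hN ⊢
        rw [countOutside_insertField, if_neg hc] at hN
        exact h hc r i _ (fun s g hg hle => ih s g hg (by omega)) fun k => hf _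
  exact hc (hM.le_of_ge hins (Set.subset_insert c M) (Set.mem_insert c M))

lemma forall_insertField_mem {T : Set (VertexOperator ℂ W)} {i : Fin (r + 1)}
    {c : VertexOperator ℂ W} {f : Fin r → VertexOperator ℂ W} (hc : c ∈ T) (hf : ∀ k, f k ∈ T)
    (k : Fin (r + 1)) : insertField i c f k ∈ T := by
  refine Fin.succAboveCases i ?_ (fun k => ?_) k
  · simpa using hc
  · simpa using hf k

section Maximal
variable {M : Set (VertexOperator ℂ W)} (hM : Maximal QuasiCompatible M)
include hM

lemma idField_mem_of_maximal : idField W ∈ M :=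
  mem_of_maximal hM _ fun _ r i f h hf => (h r f hf le_rfl).insert_idField i

lemma add_mem_of_maximal {a b : VertexOperator ℂ W} (ha : a ∈ M) (hb : b ∈ M) : a + b ∈ M :=
  mem_of_maximal hM _ fun _ r i f h hf => QuasiCompatibleSeq.insert_add
    (h _ _ (forall_insertField_mem (Set.mem_insert_of_mem _ ha) hf)
      (by rw [countOutside_insertField, if_pos ha, zero_add]))
    (h _ _ (forall_insertField_mem (Set.mem_insert_of_mem _ hb) hf)
      (by rw [countOutside_insertField, if_pos hb, zero_add]))

lemma smul_mem_of_maximal (c : ℂ) {a : VertexOperator ℂ W} (ha : a ∈ M) : c • a ∈ M :=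
  mem_of_maximal hM _ fun _ r i f h hf => QuasiCompatibleSeq.insert_smul
    (h _ _ (forall_insertField_mem (Set.mem_insert_of_mem _ ha) hf)
      (by rw [countOutside_insertField, if_pos ha, zero_add])) c

/-- Replacing a_n b by the pair a, b lengthens the sequence but adds no entries outside M. This is
why the induction in `mem_of_maximal` counts those entries and not the length. -/
lemma nthProd_mem_of_maximal {a b : VertexOperator ℂ W} (ha : a ∈ M) (hb : b ∈ M) (n : ℤ) :
    nthProd a b n ∈ M :=
  mem_of_maximal hM _ fun _ r i f h hf => QuasiCompatibleSeq.nthProd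
    (h _ _ (forall_insertField_mem (Set.mem_insert_of_mem _ ha)
      (forall_insertField_mem (Set.mem_insert_of_mem _ hb) hf))
      (by rw [countOutside_insertField, countOutside_insertField, if_pos ha, if_pos hb, zero_add,
        zero_add]))
    (hM.prop.exists_clears ha hb) n

end Maximal

/-- Quasi compatibility is of finite character, since it only concerns finite sequences, so Zorn's
lemma applies. -/
lemma exists_maximal_quasiCompatible {S : Set (VertexOperator ℂ W)} (hS : QuasiCompatible S) :
    ∃ M, S ⊆ M ∧ Maximal QuasiCompatible M := by
  refine Order.IsOfFiniteCharacter.exists_maximal (F := {S | QuasiCompatible S}) (fun T => ?_) hS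
  refine ⟨fun hT T' hT' _ => QuasiCompatible.mono hT hT', fun h r ψ hψ => ?_⟩
  exact h (Set.range ψ) (Set.range_subset_iff.2 hψ) (Set.finite_range ψ) r ψ
    fun i => Set.mem_range_self i

/-- A quasi compatible set is contained in a closed quasi compatible subspace containing `1_W`. -/
lemma exists_closed_quasiCompatible {S : Set (VertexOperator ℂ W)} (hS : QuasiCompatible S) :
    ∃ T : Submodule ℂ (VertexOperator ℂ W), QuasiCompatible (T : Set (VertexOperator ℂ W)) ∧
      IsClosedSubspace T ∧ S ⊆ T ∧ idField W ∈ T := by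
  obtain ⟨M, hSM, hM⟩ := exists_maximal_quasiCompatible hS
  refine ⟨{ carrier := M
            add_mem' := fun ha hb => add_mem_of_maximal hM ha hb
            zero_mem' := by
              rw [← zero_smul ℂ (idField W)]
              exact smul_mem_of_maximal hM 0 (idField_mem_of_maximal hM)
            smul_mem' := fun c _ ha => smul_mem_of_maximal hM c ha },
    hM.prop, fun a ha b hb n => nthProd_mem_of_maximal hM ha hb n, hSM, idField_mem_of_maximal hM⟩

/-! ### The generated subspace -/

lemma subset_generatedSubspace (S : Set (VertexOperator ℂ W)) :
    S ⊆ (generatedSubspace S : Set (VertexOperator ℂ W)) :=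
  fun _ ha => Submodule.mem_sInf.2 fun _ hT => hT.2.2.1 ha

lemma idField_mem_generatedSubspace (S : Set (VertexOperator ℂ W)) :
    idField W ∈ generatedSubspace S :=
  Submodule.mem_sInf.2 fun _ hT => hT.2.2.2

lemma isClosedSubspace_generatedSubspace (S : Set (VertexOperator ℂ W)) :
    IsClosedSubspace (generatedSubspace S) := fun a ha b hb n =>
  Submodule.mem_sInf.2 fun T hT => hT.2.1 a (Submodule.mem_sInf.1 ha T hT) b
    (Submodule.mem_sInf.1 hb T hT) n

/-- An intersection is quasi compatible as soon as one of its members is; the substance is that the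
family being intersected is not empty. -/
lemma quasiCompatible_generatedSubspace {S : Set (VertexOperator ℂ W)} (hS : QuasiCompatible S) :
    QuasiCompatible (generatedSubspace S : Set (VertexOperator ℂ W)) := by
  obtain ⟨T, hT⟩ := exists_closed_quasiCompatible hS
  exact hT.1.mono fun a ha => Submodule.mem_sInf.1 ha T hT

/-! ### Products with varying factors -/

@[simp]
lemma iterProd_zero_left (b : VertexOperator ℂ W) (w : W) : iterProd ![0, b] w = 0 := by
  funext m
  rw [iterProd_pair, fieldCoeff_zero]
  rfl

@[simp]
lemma iterProd_zero_right (a : VertexOperator ℂ W) (w : W) : iterProd ![a, 0] w = 0 := by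
  funext m
  rw [iterProd_pair, fieldCoeff_zero]
  exact map_zero _

lemma clears_zero_left {p : MvPolynomial (Fin 2) ℂ} (hp : p ≠ 0) (b : VertexOperator ℂ W) :
    Clears p 0 b :=
  ⟨hp, fun w => by
    rw [iterProd_zero_left, polyMul_zero_right]
    exact (lowerTruncated W 2).zero_mem⟩

lemma clears_zero_right {p : MvPolynomial (Fin 2) ℂ} (hp : p ≠ 0) (a : VertexOperator ℂ W) :
    Clears p a 0 :=
  ⟨hp, fun w => by
    rw [iterProd_zero_right, polyMul_zero_right]
    exact (lowerTruncated W 2).zero_mem⟩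

lemma prodSeries_eq_zero {a b : VertexOperator ℂ W} {w : W} (h : Clears 1 a b)
    (h0 : iterProd ![a, b] w = 0) : prodSeries a b w = 0 := by
  have := polyMul_prodSeries h w
  rw [polyShift_one, h0, polyMul_zero_right, polyMul_one] at this
  rw [this]
  funext m
  simp [substVar, substCoeff, slice]

lemma prodSeries_zero_left (b : VertexOperator ℂ W) (w : W) : prodSeries 0 b w = 0 :=
  prodSeries_eq_zero (clears_zero_left one_ne_zero b) (iterProd_zero_left b w)

lemma prodSeries_zero_right (a : VertexOperator ℂ W) (w : W) : prodSeries a 0 w = 0 :=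
  prodSeries_eq_zero (clears_zero_right one_ne_zero a) (iterProd_zero_right a w)

lemma slice_truncVar {o i j : Fin r} (hi : o ≠ i) (hj : o ≠ j) (n : ℤ) (m : Fin r → ℤ)
    (H : (Fin r → ℤ) → W) :
    slice i j m (truncVar o n H) = if m o ≤ n then slice i j m H else 0 := by
  funext l
  rw [slice, truncVar, setTwo_of_ne _ _ hi hj]
  split_ifs <;> rfl

lemma truncVar_substVar {o i j : Fin r} (hi : o ≠ i) (hj : o ≠ j) (n : ℤ)
    (H : (Fin r → ℤ) → W) :
    truncVar o n (substVar i j H) = substVar i j (truncVar o n H) := by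
  funext m
  rw [truncVar, substVar, substVar, slice_truncVar hi hj]
  split_ifs
  · rfl
  · simp [substCoeff]

lemma truncVar_mem_sliceTruncated {o i j : Fin r} (hi : o ≠ i) (hj : o ≠ j) (n : ℤ)
    {H : (Fin r → ℤ) → W} (hH : H ∈ sliceTruncated W i j) :
    truncVar o n H ∈ sliceTruncated W i j := by
  intro m
  rw [slice_truncVar hi hj]
  split_ifs
  · exact hH m
  · exact (lowerTruncated W 2).zero_mem

lemma truncVar_mem_sliceLaurent {o i j : Fin r} (hi : o ≠ i) (hj : o ≠ j) (n : ℤ)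
    {H : (Fin r → ℤ) → W} (hH : H ∈ sliceLaurent W i j) :
    truncVar o n H ∈ sliceLaurent W i j := by
  intro m
  rw [slice_truncVar hi hj]
  split_ifs
  · exact hH m
  · exact (iterLaurent W 2).zero_mem

/-- The defining relation of the products `a_n b` when the fields `a` and `b` depend on the exponent
of a further variable `x_o`. -/
lemma polyMul_prodSeries_family {o i j : Fin r} (hi : o ≠ i) (hj : o ≠ j) (hij : i ≠ j)
    {a b : ℤ → VertexOperator ℂ W} {N : ℤ} (hN : ∀ l < N, a l = 0 ∨ b l = 0)
    (hab : ∀ l, ∃ p, Clears p (a l) (b l)) (w : W) {G H : (Fin r → ℤ) → W}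
    (hG : ∀ m, G m = iterProd ![a (m o), b (m o)] w ![m i, m j])
    (hH : ∀ m, H m = prodSeries (a (m o)) (b (m o)) w ![m i, m j])
    {q : MvPolynomial (Fin r) ℂ} (hq : polyMul q G ∈ levelTruncated W o) :
    polyMul (shiftVar i j q) H = substVar i j (polyMul q G) := by
  have hL : polyMul q G ∈ sliceTruncated W i j :=
    levelTruncated_le_sliceTruncated hi hj hij hq
  suffices h : ∀ n, truncVar o n (polyMul (shiftVar i j q) H) =
      truncVar o n (substVar i j (polyMul q G)) by
    funext m
    have hm := congrFun (h (m o)) m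
    rwa [truncVar_of_le _ le_rfl, truncVar_of_le _ le_rfl] at hm
  intro n
  choose p hp using hab
  -- The clearing polynomials depend on the exponent of x_o, and one polynomial need not serve all
  -- of them. In degrees at most n in x_o only the levels from N to n matter, and the product of
  -- their polynomials clears all these pairs.
  set P := ∏ l ∈ Finset.Icc N n, p l with hP
  have hP0 : P ≠ 0 := Finset.prod_ne_zero_iff.2 fun l _ => (hp l).1
  have hvec : ∀ n' : Fin 2 → ℤ, ![n' 0, n' 1] = n' := by
    intro n'
    funext k
    fin_cases k <;> rfl
  have hslice : IsPairSlice P i j (truncVar o n G) (truncVar o n H) := by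
    intro m
    have hG' : ∀ n', truncVar o n G (setTwo i j m n') =
        if m o ≤ n then iterProd ![a (m o), b (m o)] w n' else 0 := by
      intro n'
      rw [truncVar, hG, setTwo_of_ne _ _ hi hj, setTwo_left hij, setTwo_right, hvec]
    have hH' : ∀ n', truncVar o n H (setTwo i j m n') =
        if m o ≤ n then prodSeries (a (m o)) (b (m o)) w n' else 0 := by
      intro n'
      rw [truncVar, hH, setTwo_of_ne _ _ hi hj, setTwo_left hij, setTwo_right, hvec]
    by_cases hm : m o ≤ n
    · by_cases hm' : N ≤ m o
      · refine ⟨a (m o), b (m o), LinearMap.id, w, ?_, fun n' => ?_, fun n' => ?_⟩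
        · rw [hP, ← Finset.prod_erase_mul _ _ (Finset.mem_Icc.2 ⟨hm', hm⟩)]
          exact (hp (m o)).mul_left (Finset.prod_ne_zero_iff.2 fun l _ => (hp l).1)
        · rw [hG', if_pos hm]; rfl
        · rw [hH', if_pos hm]; rfl
      · refine ⟨0, 0, 0, 0, clears_zero_right hP0 0, fun n' => ?_, fun n' => ?_⟩
        · rw [hG', if_pos hm, iterProd_pair]
          rcases hN (m o) (by omega) with h | h
          · simp [h]
          · simp [h]
        · rw [hH', if_pos hm]
          rcases hN (m o) (by omega) with h | h
          · simp [h, prodSeries_zero_left]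
          · simp [h, prodSeries_zero_right]
    · refine ⟨0, 0, 0, 0, clears_zero_right hP0 0, fun n' => ?_, fun n' => ?_⟩
      · rw [hG', if_neg hm]; rfl
      · rw [hH', if_neg hm]; rfl
  have hne : ∀ k, ![i, j] k ≠ o := by
    intro k
    fin_cases k
    · exact hi.symm
    · exact hj.symm
  have hsub : truncVar o n (polyMul (shiftVar i j q) H) - truncVar o n (substVar i j (polyMul q G))
      ∈ sliceLaurent W i j := by
    refine (sliceLaurent W i j).sub_mem ?_ (truncVar_mem_sliceLaurent hi hj n
      (substVar_mem_sliceLaurent hij hL))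
    rw [← truncVar_polyMul_truncVar]
    exact truncVar_mem_sliceLaurent hi hj n (polyMul_mem_sliceLaurent hij _
      hslice.mem_sliceLaurent)
  -- The auxiliary factor P involves only x_i and x_j, hence commutes with truncation in x_o, and it
  -- cancels on slices in W((x_j))((x_i)).
  refine sub_eq_zero.1 (eq_zero_of_polyMul_rename_eq_zero hij (polyShift_ne_zero hP0) hsub ?_)
  rw [polyMul_sub_right, sub_eq_zero]
  have hsupp := rename_mem_supported_ne hne P
  have hsupp' := rename_mem_supported_ne hne (polyShift P)
  rw [← truncVar_polyMul_truncVar, ← truncVar_polyMul hsupp', ← shiftVar_rename hij,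
    ← polyMul_mul, mul_comm, ← map_mul, hslice.polyMul_mul_eq hij, mul_comm, polyMul_mul,
    truncVar_substVar hi hj, truncVar_polyMul hsupp, truncVar_polyMul_truncVar,
    substVar_polyMul hij _ (truncVar_mem_sliceTruncated hi hj n hL), truncVar_substVar hi hj]

/-! ### Associativity of the products of fields -/

/-- The series `∑ (a_k b)_n c (x) w x_0^{-k-1} x_2^{-n-1}` in `x_0, x_2, x`. -/
def leftAssocSeries (a b c : VertexOperator ℂ W) (w : W) : (Fin 3 → ℤ) → W :=
  fun m => fieldCoeff (nthProd (nthProd a b (-m 0 - 1)) c (-m 1 - 1)) (m 2) w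

/-- The series `∑ a_k (b_n c) (x) w x_1^{-k-1} x_2^{-n-1}` in `x_1, x_2, x`. -/
def rightAssocSeries (a b c : VertexOperator ℂ W) (w : W) : (Fin 3 → ℤ) → W :=
  fun m => fieldCoeff (nthProd a (nthProd b c (-m 1 - 1)) (-m 0 - 1)) (m 2) w

lemma rightAssocSeries_mem_sliceBounded (a b c : VertexOperator ℂ W) (w : W) :
    rightAssocSeries a b c w ∈ sliceBounded W 0 1 := by
  obtain ⟨N, hN⟩ := nthProd_truncated b c
  intro m
  refine ⟨N, fun n hn => ?_⟩
  rw [slice, rightAssocSeries, setTwo_right, hN _ hn, fieldCoeff_nthProd, prodSeries_zero_right]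
  rfl

lemma mem_iterLaurent_three {H : (Fin 3 → ℤ) → W} (h0 : ∃ N, ∀ m, m 0 < N → H m = 0)
    (h1 : ∀ x, ∃ N, ∀ m, m 0 = x → m 1 < N → H m = 0)
    (h2 : ∀ x y, ∃ N, ∀ m, m 0 = x → m 1 = y → m 2 < N → H m = 0) : H ∈ iterLaurent W 3 := by
  intro k m
  fin_cases k
  · obtain ⟨N, hN⟩ := h0
    exact ⟨N, fun m' _ hk => hN m' hk⟩
  · obtain ⟨N, hN⟩ := h1 (m 0)
    exact ⟨N, fun m' hm hk => hN m' (hm 0 (by decide)) hk⟩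
  · obtain ⟨N, hN⟩ := h2 (m 0) (m 1)
    exact ⟨N, fun m' hm hk => hN m' (hm 0 (by decide)) (hm 1 (by decide)) hk⟩

lemma leftAssocSeries_mem_iterLaurent (a b c : VertexOperator ℂ W) (w : W) :
    leftAssocSeries a b c w ∈ iterLaurent W 3 := by
  refine mem_iterLaurent_three ?_ (fun x => ?_) fun x y => ?_
  · obtain ⟨N, hN⟩ := nthProd_truncated a b
    refine ⟨N, fun m hm => ?_⟩
    rw [leftAssocSeries, hN _ hm, fieldCoeff_nthProd, prodSeries_zero_left]
    rfl
  · obtain ⟨N, hN⟩ := nthProd_truncated (nthProd a b (-x - 1)) c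
    refine ⟨N, fun m hx hm => ?_⟩
    rw [leftAssocSeries, hx, hN _ hm, fieldCoeff_zero]
    rfl
  · obtain ⟨N, hN⟩ := fieldCoeff_truncated (nthProd (nthProd a b (-x - 1)) c (-y - 1)) w
    refine ⟨N, fun m hx hy hm => ?_⟩
    rw [leftAssocSeries, hx, hy]
    exact hN _ hm

/-- Weak associativity of the products of fields in a closed quasi compatible subspace. -/
lemma exists_polyMul_assoc {T : Submodule ℂ (VertexOperator ℂ W)}
    (hT : QuasiCompatible (T : Set (VertexOperator ℂ W))) (hcl : IsClosedSubspace T)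
    {a b c : VertexOperator ℂ W} (ha : a ∈ T) (hb : b ∈ T) (hc : c ∈ T) :
    ∃ Q : MvPolynomial (Fin 3) ℂ, Q ≠ 0 ∧ ∀ w,
      polyMul Q (leftAssocSeries a b c w) =
        polyMul Q (expandVar 0 1 (rightAssocSeries a b c w)) := by
  have h01 : (0 : Fin 3) ≠ 1 := by decide
  have h02 : (0 : Fin 3) ≠ 2 := by decide
  have h12 : (1 : Fin 3) ≠ 2 := by decide
  obtain ⟨p, hp⟩ := hT.exists_clears ha hb
  obtain ⟨p', hp'⟩ := hT.exists_clears hb hc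
  obtain ⟨q, hq, hqw⟩ := quasiCompatibleSeq_iff.1 (hT 3 ![a, b, c] (by
    intro i
    fin_cases i
    · exact ha
    · exact hb
    · exact hc))
  -- The factor q clears the triple, p permits combining a and b first, and p' permits combining b
  -- and c first.
  set Q := q * rename ![1, 2] p' * rename ![0, 1] p with hQ
  have hQ' : Q = q * rename ![0, 1] p * rename ![1, 2] p' := by rw [hQ]; ring
  have hQ0 : Q ≠ 0 := mul_ne_zero (mul_ne_zero (ne_zero_of_mem_binarySubmonoid hq)
    (rename_pair_ne_zero h12 hp'.1)) (rename_pair_ne_zero h01 hp.1)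
  -- The multiplier is Q(x_0 + x_2 + x, x_2 + x, x).
  refine ⟨shiftVar 1 2 (shiftVar 0 1 Q), shiftVar_ne_zero h12 (shiftVar_ne_zero h01 hQ0),
    fun w => ?_⟩
  set G := iterProd ![a, b, c] w with hG
  have hGm : ∀ m, G m = fieldCoeff a (m 0) (fieldCoeff b (m 1) (fieldCoeff c (m 2) w)) := by
    intro m
    simp [hG, iterProd, List.ofFn_succ]
  have hL : polyMul Q G ∈ lowerTruncated W 3 := by
    rw [hQ, mul_assoc, mul_comm, polyMul_mul]
    exact polyMul_mem_lowerTruncated _ (hqw w)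
  have hleft : polyMul (shiftVar 1 2 (shiftVar 0 1 Q)) (leftAssocSeries a b c w) =
      substVar 1 2 (substVar 0 1 (polyMul Q G)) := by
    have hs : IsPairSlice p 0 1 G
        (fun m => fieldCoeff (nthProd a b (-m 0 - 1)) (m 1) (fieldCoeff c (m 2) w)) := by
      intro m
      refine ⟨a, b, LinearMap.id, fieldCoeff c (m 2) w, hp, fun n => ?_, fun n => ?_⟩
      · rw [hGm, setTwo_left h01, setTwo_right, setTwo_of_ne _ _ h02.symm h12.symm,
          LinearMap.id_apply, iterProd_pair]
      · beta_reduce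
        rw [setTwo_left h01, setTwo_right, setTwo_of_ne _ _ h02.symm h12.symm]
        rfl
    have h1 := hs.polyMul_mul_eq h01 (q * rename ![1, 2] p')
    rw [← hQ] at h1
    obtain ⟨N, hN⟩ := nthProd_truncated a b
    rw [← h1]
    -- The left factor a_k b of the outer product varies with the exponent of x_0, so the relation
    -- for families of fields is needed.
    refine polyMul_prodSeries_family h01 h02 h12 (a := fun l => nthProd a b (-l - 1))
      (b := fun _ => c) (fun l hl => Or.inl (hN l hl))
      (fun l => hT.exists_clears (hcl a ha b hb _) hc) w (fun m => ?_) (fun m => rfl) ?_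
    · rw [iterProd_pair]
      rfl
    · rw [h1]
      exact substVar_mem_levelTruncated h01 hL
  have hright : polyMul (shiftVar 0 2 (shiftVar 1 2 Q)) (rightAssocSeries a b c w) =
      substVar 0 2 (substVar 1 2 (polyMul Q G)) := by
    have hs : IsPairSlice p' 1 2 G
        (fun m => fieldCoeff a (m 0) (fieldCoeff (nthProd b c (-m 1 - 1)) (m 2) w)) := by
      intro m
      refine ⟨b, c, fieldCoeff a (m 0), w, hp', fun n => ?_, fun n => ?_⟩
      · rw [hGm, setTwo_left h12, setTwo_right, setTwo_of_ne _ _ h01 h02, iterProd_pair]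
      · beta_reduce
        rw [setTwo_left h12, setTwo_right, setTwo_of_ne _ _ h01 h02]
        rfl
    have h1 := hs.polyMul_mul_eq h12 (q * rename ![0, 1] p)
    rw [← hQ'] at h1
    obtain ⟨N, hN⟩ := nthProd_truncated b c
    rw [← h1]
    refine polyMul_prodSeries_family h01.symm h12 h02 (a := fun _ => a)
      (b := fun l => nthProd b c (-l - 1)) (fun l hl => Or.inr (hN l hl))
      (fun l => hT.exists_clears ha (hcl b hb c hc _)) w (fun m => ?_) (fun m => rfl) ?_
    · rw [iterProd_pair]
      rfl
    · rw [h1]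
      exact substVar_mem_levelTruncated h12 hL
  -- Both orders of combining the fields lead to the same polynomial once x_1 is replaced by x_0 +
  -- x_2.
  have hcomp : shiftVar 1 2 (shiftVar 0 1 Q) = shiftVar 0 1 (shiftVar 0 2 (shiftVar 1 2 Q)) := by
    have : ((shiftVar (1 : Fin 3) 2).comp (shiftVar 0 1)) =
        (shiftVar 0 1).comp ((shiftVar 0 2).comp (shiftVar 1 2)) := by
      refine MvPolynomial.algHom_ext fun k => ?_
      fin_cases k
      · simp [shiftVar_X_self, shiftVar_X_of_ne, add_assoc]
      · simp [shiftVar_X_self, shiftVar_X_of_ne]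
      · simp [shiftVar_X_of_ne]
    exact DFunLike.congr_fun this Q
  rw [hleft, hcomp, ← expandVar_polyMul h01 _ (rightAssocSeries_mem_sliceBounded a b c w), hright,
    expandVar_substVar_substVar hL]

end Series

section QuasiModule

variable {V W : Type*} [AddCommGroup V] [Module ℂ V] [NonlocalVertexAlgebra V]
  [AddCommGroup W] [Module ℂ W]

/-! ### Quasi modules and products of fields -/

lemma expandFirst_polyMul (p : MvPolynomial (Fin 2) ℂ) {F : (Fin 2 → ℤ) → W}
    (hF : F ∈ boundedSecond W) :
    expandFirst (polyMul p F) = polyMul (polyShift p) (expandFirst F) := by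
  have e : ∀ H : (Fin 2 → ℤ) → W, expandVar 0 1 H = expandFirst H := by
    intro H
    funext m
    rw [expandVar, slice_zero_one]
    congr 1
    funext k
    fin_cases k <;> rfl
  rw [← e, expandVar_polyMul (by decide) p (fun m => by rwa [slice_zero_one]), e,
    shiftVar_zero_one]

lemma iterProd_mem_boundedSecond (a b : VertexOperator ℂ W) (w : W) :
    iterProd ![a, b] w ∈ boundedSecond W := by
  obtain ⟨N, hN⟩ := fieldCoeff_truncated b w
  refine ⟨N, fun m hm => ?_⟩
  rw [iterProd_pair, hN _ hm]
  exact map_zero _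

/-- After multiplication by a power of `x_1`, the two expansions of `x_1 ↦ x_0 + x_2` agree on an
element of `W((x_1, x_2))`. -/
lemma exists_expandFirst_eq_substVar {F : (Fin 2 → ℤ) → W} (hF : F ∈ lowerTruncated W 2) :
    ∃ k : ℕ, expandFirst (polyMul (X 0 ^ k) F) = substVar 0 1 (polyMul (X 0 ^ k) F) := by
  obtain ⟨N, hN⟩ := hF
  refine ⟨(-N).toNat, expandFirst_eq_substVar fun m hm => ?_⟩
  rw [polyMul_X_pow]
  refine hN _ ⟨0, ?_⟩
  rw [Function.update_self]
  omega

/-- For a clearing polynomial `p` and any `f`, a suitable nonzero multiple of `f p` makes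
`a(x_0 + x_2) b(x_2) w` agree with `∑ (a_n b)(x_2) w x_0^{-n-1}`. -/
lemma exists_expandFirst_iterProd {p : MvPolynomial (Fin 2) ℂ} {a b : VertexOperator ℂ W}
    (hp : Clears p a b) {f : MvPolynomial (Fin 2) ℂ} (hf : f ≠ 0) (w : W) :
    ∃ k : ℕ, polyMul (polyShift (X 0 ^ k * f * p)) (expandFirst (iterProd ![a, b] w)) =
      substVar 0 1 (polyMul (X 0 ^ k * f * p) (iterProd ![a, b] w)) := by
  obtain ⟨k, hk⟩ := exists_expandFirst_eq_substVar ((hp.mul_left hf).2 w)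
  refine ⟨k, ?_⟩
  rw [← expandFirst_polyMul _ (iterProd_mem_boundedSecond a b w), mul_assoc, polyMul_mul, hk]

lemma nestedProd_mem_iterLaurent {V' : Type*} [AddCommGroup V'] [Module ℂ V']
    (Y' : V' →ₗ[ℂ] VertexOperator ℂ V') (Z : V' →ₗ[ℂ] VertexOperator ℂ W) (u v : V') (w : W) :
    nestedProd Y' Z u v w ∈ iterLaurent W 2 := by
  intro k m
  fin_cases k
  · obtain ⟨N, hN⟩ := fieldCoeff_truncated (Y' u) v
    refine ⟨N, fun m' _ hk => ?_⟩
    have hk' : m' 0 < N := hk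
    rw [nestedProd, show HVertexOperator.coeff (Y' u) (m' 0) v = 0 from hN _ hk', map_zero]
    exact congrFun (congrArg DFunLike.coe (fieldCoeff_zero _)) w
  · obtain ⟨N, hN⟩ := fieldCoeff_truncated (Z (HVertexOperator.coeff (Y' u) (m 0) v)) w
    refine ⟨N, fun m' hm hk => ?_⟩
    rw [nestedProd, hm 0 Fin.zero_lt_one]
    exact hN _ hk

lemma iterProd_add_left (a b c : VertexOperator ℂ W) (w : W) :
    iterProd ![a + b, c] w = iterProd ![a, c] w + iterProd ![b, c] w := by
  funext m
  rw [Pi.add_apply, iterProd_pair, iterProd_pair, iterProd_pair]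
  rfl

lemma iterProd_smul_left (z : ℂ) (a b : VertexOperator ℂ W) (w : W) :
    iterProd ![z • a, b] w = fun m => (z • LinearMap.id : W →ₗ[ℂ] W) (iterProd ![a, b] w m) := by
  funext m
  rw [iterProd_pair, iterProd_pair]
  rfl

/-- `nthProd` depends formally on a choice of polynomial for each pair. Additivity follows from the
defining relation with a common clearing polynomial. -/
lemma nthProd_add_left {a b c : VertexOperator ℂ W} (ha : ∃ p, Clears p a c)
    (hb : ∃ p, Clears p b c) (n : ℤ) :
    nthProd (a + b) c n = nthProd a c n + nthProd b c n := by
  obtain ⟨p, hp⟩ := ha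
  obtain ⟨q, hq⟩ := hb
  have hpa := hp.mul_left hq.1
  have hpb := mul_comm p q ▸ hq.mul_left hp.1
  have hadd : Clears (q * p) (a + b) c := by
    refine ⟨hpa.1, fun w => ?_⟩
    rw [iterProd_add_left, polyMul_add_right]
    exact Submodule.add_mem _ (hpa.2 w) (hpb.2 w)
  refine field_ext fun k w => ?_
  have h := eq_prodSeries hadd one_ne_zero (w := w)
    (Submodule.add_mem _ (prodSeries_mem_iterLaurent a c w) (prodSeries_mem_iterLaurent b c w)) (by
      rw [one_mul, polyMul_add_right, polyMul_prodSeries hpa, polyMul_prodSeries hpb,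
        iterProd_add_left, polyMul_add_right,
        substVar_add (lowerTruncated_le_sliceTruncated (by decide) (hpa.2 w))
          (lowerTruncated_le_sliceTruncated (by decide) (hpb.2 w))])
  rw [fieldCoeff_nthProd, ← h, Pi.add_apply, ← fieldCoeff_nthProd, ← fieldCoeff_nthProd]
  rfl

lemma nthProd_smul_left (z : ℂ) {a b : VertexOperator ℂ W} (h : ∃ p, Clears p a b) (n : ℤ) :
    nthProd (z • a) b n = z • nthProd a b n := by
  obtain ⟨p, hp⟩ := h
  have hz : Clears p (z • a) b := by
    refine ⟨hp.1, fun w => ?_⟩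
    rw [iterProd_smul_left, polyMul_map]
    exact Submodule.smul_mem _ z (hp.2 w)
  refine field_ext fun k w => ?_
  have h := eq_prodSeries hz one_ne_zero (w := w)
    (Submodule.smul_mem _ z (prodSeries_mem_iterLaurent a b w)) (by
      rw [one_mul, iterProd_smul_left, polyMul_map, substVar_map _
        (lowerTruncated_le_sliceTruncated (by decide) (hp.2 w)), ← polyMul_prodSeries hp]
      exact polyMul_map (z • LinearMap.id : W →ₗ[ℂ] W) _ _)
  rw [fieldCoeff_nthProd, ← h, Pi.smul_apply, ← fieldCoeff_nthProd]
  rfl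

lemma ncoeff_add_left (a b : VertexOperator ℂ W) (n : ℤ) (w : W) :
    VertexOperator.ncoeff (a + b) n w =
      VertexOperator.ncoeff a n w + VertexOperator.ncoeff b n w := by
  simp only [VertexOperator.ncoeff_apply]
  rfl

lemma ncoeff_smul_left (z : ℂ) (a : VertexOperator ℂ W) (n : ℤ) (w : W) :
    VertexOperator.ncoeff (z • a) n w = z • VertexOperator.ncoeff a n w := by
  simp only [VertexOperator.ncoeff_apply]
  rfl

/-- In a quasi module, `Z(u_n v, x) = Z(u, x)_n Z(v, x)`. -/
lemma IsQuasiModule.map_ncoeff {Z : V →ₗ[ℂ] VertexOperator ℂ W} (hZ : IsQuasiModule Z) {u v : V}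
    (h : ∃ p, Clears p (Z u) (Z v)) (n : ℤ) :
    Z (VertexOperator.ncoeff (Y u) n v) = nthProd (Z u) (Z v) n := by
  obtain ⟨p, hp⟩ := h
  refine field_ext fun k w => ?_
  obtain ⟨f, hf, hassoc⟩ := hZ.quasi_assoc u v w
  -- Quasi associativity is multiplied by p to clear the pair, and by a power of x_1 so that both
  -- expansions of x_1 coincide. The defining relation then identifies the nested series with the
  -- series of products.
  obtain ⟨l, hl⟩ := exists_expandFirst_iterProd hp hf w
  have hmul : ∀ F : (Fin 2 → ℤ) → W, polyMul (polyShift (X 0 ^ l * f * p)) F =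
      polyMul (polyShift (X 0 ^ l * p)) (polyMul (polyShift f) F) := by
    intro F
    rw [← polyMul_mul]
    congr 1
    simp only [polyShift, map_mul]
    ring
  rw [fieldCoeff_nthProd, ← eq_prodSeries hp (mul_ne_zero (pow_ne_zero l (MvPolynomial.X_ne_zero 0)) hf)
    (nestedProd_mem_iterLaurent Y Z u v w) (by rw [← hl, hmul, hmul, hassoc])]
  rfl

/-- A linear map compatible with all products is a quasi module structure. -/
lemma isQuasiModule_of_map_ncoeff {Z : V →ₗ[ℂ] VertexOperator ℂ W} (hvac : Z vac = idField W)
    (hcl : ∀ u v, ∃ p, Clears p (Z u) (Z v))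
    (h : ∀ u v n, Z (VertexOperator.ncoeff (Y u) n v) = nthProd (Z u) (Z v) n) :
    IsQuasiModule Z := by
  refine ⟨hvac, fun u v w => ?_⟩
  obtain ⟨p, hp⟩ := hcl u v
  -- The polynomial for quasi associativity is x_1^k p; only the power k depends on w.
  obtain ⟨k, hk⟩ := exists_expandFirst_iterProd hp one_ne_zero w
  have hp' := hp.mul_left (q := X 0 ^ k * 1)
    (mul_ne_zero (pow_ne_zero k (MvPolynomial.X_ne_zero 0)) one_ne_zero)
  refine ⟨_, hp'.1, ?_⟩
  rw [hk, ← polyMul_prodSeries hp']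
  congr 1
  funext m
  rw [nestedProd, prodSeries, ← h, VertexOperator.ncoeff_apply, show -(-m 0 - 1) - 1 = m 0 by ring]

/-! ### Transport of weak associativity along f -/

/-- The linear map `v ↦ f(v)(x) w`, coefficientwise. -/
def coeffMap (f : V →ₗ[ℂ] VertexOperator ℂ W) (k : ℤ) (w : W) : V →ₗ[ℂ] W where
  toFun v := fieldCoeff (f v) k w
  map_add' u v := by rw [map_add]; rfl
  map_smul' c v := by rw [map_smul]; rfl

/-- The series in three variables obtained by applying `f` to a series with coefficients in `V` and
evaluating at `w`. -/
def applySeries (f : V →ₗ[ℂ] VertexOperator ℂ W) (w : W) (F : (Fin 2 → ℤ) → V) :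
    (Fin 3 → ℤ) → W :=
  fun m => coeffMap f (m 2) w (F ![m 0, m 1])

lemma slice_applySeries (f : V →ₗ[ℂ] VertexOperator ℂ W) (w : W) (F : (Fin 2 → ℤ) → V)
    (m : Fin 3 → ℤ) :
    slice 0 1 m (applySeries f w F) = fun n => coeffMap f (m 2) w (F n) := by
  funext n
  rw [slice, applySeries, setTwo_left (by decide), setTwo_right,
    setTwo_of_ne _ _ (by decide) (by decide)]
  congr 2
  funext k
  fin_cases k <;> rfl

lemma applySeries_polyMul (f : V →ₗ[ℂ] VertexOperator ℂ W) (w : W) (p : MvPolynomial (Fin 2) ℂ)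
    (F : (Fin 2 → ℤ) → V) :
    applySeries f w (polyMul p F) = polyMul (rename ![0, 1] p) (applySeries f w F) := by
  refine ext_slice (i := 0) (j := 1) fun m => ?_
  rw [slice_rename (by decide), slice_applySeries, slice_applySeries, polyMul_map]

lemma applySeries_expandFirst (f : V →ₗ[ℂ] VertexOperator ℂ W) (w : W) {F : (Fin 2 → ℤ) → V}
    (hF : F ∈ boundedSecond V) :
    applySeries f w (expandFirst F) = expandVar 0 1 (applySeries f w F) := by
  funext m
  rw [expandVar, slice_applySeries, expandFirst_map _ hF]
  rfl

/-- The elements of `V` on which `f` is compatible with all products are closed under products. -/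
lemma map_ncoeff_ncoeff {T : Submodule ℂ (VertexOperator ℂ W)}
    (hT : QuasiCompatible (T : Set (VertexOperator ℂ W))) (hcl : IsClosedSubspace T)
    {f : V →ₗ[ℂ] VertexOperator ℂ W} (hf : ∀ v, f v ∈ T) {a b : V}
    (ha : ∀ v n, f (VertexOperator.ncoeff (Y a) n v) = nthProd (f a) (f v) n)
    (hb : ∀ v n, f (VertexOperator.ncoeff (Y b) n v) = nthProd (f b) (f v) n) (k : ℤ) (c : V)
    (n : ℤ) : f (VertexOperator.ncoeff (Y (VertexOperator.ncoeff (Y a) k b)) n c) =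
      nthProd (f (VertexOperator.ncoeff (Y a) k b)) (f c) n := by
  have hcoeff : ∀ (u v : V) (l : ℤ), HVertexOperator.coeff (Y u) l v =
      VertexOperator.ncoeff (Y u) (-l - 1) v := by
    intro u v l
    rw [VertexOperator.ncoeff_apply, show -(-l - 1) - 1 = l by ring]
  obtain ⟨Q, hQ, hassoc⟩ := exists_polyMul_assoc hT hcl (hf a) (hf b) (hf c)
  obtain ⟨l, hl⟩ := NonlocalVertexAlgebra.weak_assoc a b c
  set R : MvPolynomial (Fin 3) ℂ := rename ![0, 1] ((X 0 + X 1) ^ l) with hR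
  have hR0 : R ≠ 0 := rename_pair_ne_zero (by decide) (pow_ne_zero l fun h => by
    have := congrArg (MvPolynomial.eval fun _ => (1 : ℂ)) h
    norm_num at this)
  refine field_ext fun j w => ?_
  -- By the hypotheses on a and b, f(a_k (b_n c)) = f(a)_k (f(b)_n f(c)).
  have hright : applySeries f w (iterProd ![Y a, Y b] c) =
      rightAssocSeries (f a) (f b) (f c) w := by
    funext m
    change fieldCoeff (f _) (m 2) w = _
    rw [iterProd_pair, rightAssocSeries]
    simp only [fieldCoeff, hcoeff, Matrix.cons_val_zero, Matrix.cons_val_one]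
    rw [ha, hb]
  set H := applySeries f w (nestedProd Y Y a b c) with hH
  have hRH : polyMul R H = polyMul R (expandVar 0 1 (rightAssocSeries (f a) (f b) (f c) w)) := by
    rw [hR, hH, ← applySeries_polyMul, ← hl, applySeries_polyMul,
      applySeries_expandFirst f w (iterProd_mem_boundedSecond _ _ _), hright]
  have hHmem : H ∈ iterLaurent W 3 := by
    refine mem_iterLaurent_three ?_ (fun x => ?_) fun x y => ?_
    · obtain ⟨N, hN⟩ := nestedProd_mem_iterLaurent Y Y a b c 0 0
      refine ⟨N, fun m hm => ?_⟩
      rw [hH, applySeries, hN ![m 0, m 1] (fun i hi => absurd hi (Fin.not_lt_zero i)) hm, map_zero]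
    · obtain ⟨N, hN⟩ := nestedProd_mem_iterLaurent Y Y a b c 1 ![x, 0]
      refine ⟨N, fun m hx hm => ?_⟩
      rw [hH, applySeries, hN ![m 0, m 1] (fun i hi => ?_) hm, map_zero]
      obtain rfl : i = 0 := by omega
      exact hx
    · obtain ⟨N, hN⟩ := fieldCoeff_truncated (f (nestedProd Y Y a b c ![x, y])) w
      refine ⟨N, fun m hx hy hm => ?_⟩
      rw [hH, applySeries, hx, hy]
      exact hN _ hm
  -- After multiplication by R and by Q respectively, both sides agree with the expansion of the
  -- same series of products f(a)_k (f(b)_n f(c)). The factor Q R cancels on iterated Laurent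
  -- series.
  have hEq : H = leftAssocSeries (f a) (f b) (f c) w := by
    refine eq_of_polyMul_eq (mul_ne_zero hQ hR0) hHmem (leftAssocSeries_mem_iterLaurent _ _ _ _) ?_
    rw [polyMul_mul, hRH, polyMul_comm, ← hassoc w, mul_comm, polyMul_mul]
  have := congrFun hEq ![-k - 1, -n - 1, j]
  simp only [hH, applySeries, leftAssocSeries, nestedProd, Matrix.cons_val_zero,
    Matrix.cons_val_one, Matrix.cons_val_two, Matrix.tail_cons, Matrix.head_cons] at this
  rw [show -(-k - 1) - 1 = k by ring, show -(-n - 1) - 1 = n by ring, ← ha] at this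
  exact this

/-! ### Induction over a generating set -/

lemma forall_of_vertexSubalgebraSpan_eq_top {S : Set V} (hS : vertexSubalgebraSpan S = ⊤)
    (T : Submodule ℂ V) (h1 : S ⊆ T) (h2 : vac ∈ T)
    (h3 : ∀ a ∈ T, ∀ b ∈ T, ∀ n : ℤ, VertexOperator.ncoeff (Y a) n b ∈ T) (v : V) : v ∈ T :=
  (sInf_le (a := T) (s := {T : Submodule ℂ V | S ⊆ T ∧ vac ∈ T ∧
    ∀ a ∈ T, ∀ b ∈ T, ∀ n : ℤ, VertexOperator.ncoeff (Y a) n b ∈ T}) ⟨h1, h2, h3⟩)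
    (show v ∈ vertexSubalgebraSpan S from hS ▸ Submodule.mem_top)

/-- A quasi module structure whose restriction to a generating subset `S` has quasi compatible image
takes its values in the closed subspace generated by that image. -/
lemma IsQuasiModule.mem_generatedSubspace {Z : V →ₗ[ℂ] VertexOperator ℂ W} (hZ : IsQuasiModule Z)
    {S : Set V} (hS : vertexSubalgebraSpan S = ⊤) {R : Set (VertexOperator ℂ W)}
    (hR : QuasiCompatible R) (hSR : ∀ u ∈ S, Z u ∈ R) (v : V) : Z v ∈ generatedSubspace R := by
  refine forall_of_vertexSubalgebraSpan_eq_top hS ((generatedSubspace R).comap Z)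
    (fun u hu => subset_generatedSubspace R (hSR u hu)) ?_ (fun a ha b hb n => ?_) v
  · rw [Submodule.mem_comap, hZ.map_vac]
    exact idField_mem_generatedSubspace R
  · rw [Submodule.mem_comap] at ha hb ⊢
    -- Membership of Z a and Z b in the quasi compatible space ⟨R⟩ supplies their clearing
    -- polynomial, without which Z need not be known to respect the product.
    rw [hZ.map_ncoeff ((quasiCompatible_generatedSubspace hR).exists_clears ha hb)]
    exact isClosedSubspace_generatedSubspace R _ ha _ hb n

/-- A linear map into the closed subspace generated by `R` that is compatible with the products by
the elements of a generating set is compatible with all products. -/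
lemma map_ncoeff_of_generating {S : Set V} (hS : vertexSubalgebraSpan S = ⊤)
    {R : Set (VertexOperator ℂ W)} (hR : QuasiCompatible R) {f : V →ₗ[ℂ] VertexOperator ℂ W}
    (hf : ∀ v, f v ∈ generatedSubspace R) (hvac : f vac = idField W)
    (h : ∀ u ∈ S, ∀ v n, f (VertexOperator.ncoeff (Y u) n v) = nthProd (f u) (f v) n) (u v : V)
    (n : ℤ) : f (VertexOperator.ncoeff (Y u) n v) = nthProd (f u) (f v) n := by
  have hqc := quasiCompatible_generatedSubspace hR
  let T : Submodule ℂ V :=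
    { carrier := {a | ∀ v n, f (VertexOperator.ncoeff (Y a) n v) = nthProd (f a) (f v) n}
      add_mem' := fun {a b} ha hb v n => by
        rw [map_add, ncoeff_add_left, map_add, ha, hb, map_add,
          nthProd_add_left (hqc.exists_clears (hf a) (hf v)) (hqc.exists_clears (hf b) (hf v))]
      -- Both sides at 0 are computed as scalar multiples by 0.
      zero_mem' := fun v n => by
        have h0 := nthProd_smul_left 0 (hqc.exists_clears (hf 0) (hf v)) n
        have h1 := ncoeff_smul_left 0 (Y (0 : V)) n v
        rw [zero_smul, zero_smul] at h0 h1
        rw [map_zero Y, map_zero f, h0, h1, map_zero]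
      smul_mem' := fun z a ha v n => by
        rw [map_smul, ncoeff_smul_left, map_smul, ha, map_smul,
          nthProd_smul_left z (hqc.exists_clears (hf a) (hf v))] }
  refine forall_of_vertexSubalgebraSpan_eq_top hS T h ?_ (fun a ha b hb k => ?_) u v n
  · intro v n
    rw [NonlocalVertexAlgebra.Y_vac, hvac, nthProd_idField_left, VertexOperator.ncoeff_apply]
    have := fieldCoeff_idField (W := V) (-n - 1) v
    rw [fieldCoeff] at this
    rw [this]
    split_ifs with h1 h2 h2
    · rfl
    · omega
    · omega
    · exact map_zero f
  · exact map_ncoeff_ncoeff hqc (isClosedSubspace_generatedSubspace R) hf ha hb k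

end QuasiModule

end NonlocalVA

end

/-! ### The extension theorem -/

open NonlocalVA in
/-- A linear map on a generating subspace with quasi compatible image extends to a quasi module
structure if and only if there is a linear map `f` into `⟨Y_W^0(U)⟩` as below; the extension is
unique if it exists. -/
theorem theorem6p5 {V W : Type*} [AddCommGroup V] [Module ℂ V] [NonlocalVertexAlgebra V]
    [AddCommGroup W] [Module ℂ W] (U : Submodule ℂ V)
    (hU : vertexSubalgebraSpan (U : Set V) = ⊤)
    (Y₀ : U →ₗ[ℂ] VertexOperator ℂ W) (hY₀ : QuasiCompatible (Set.range Y₀)) :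
    ((∃ YW : V →ₗ[ℂ] VertexOperator ℂ W, IsQuasiModule YW ∧ ∀ u : U, YW u = Y₀ u) ↔
      ∃ f : V →ₗ[ℂ] generatedSubspace (Set.range Y₀),
        (f NonlocalVertexAlgebra.vac : VertexOperator ℂ W) = idField W ∧
        ∀ (u : U) (v : V) (n : ℤ),
          (f (VertexOperator.ncoeff (NonlocalVertexAlgebra.Y (u : V)) n v) : VertexOperator ℂ W) =
            nthProd (Y₀ u) (f v) n) ∧
    ∀ YW YW' : V →ₗ[ℂ] VertexOperator ℂ W,
      IsQuasiModule YW → (∀ u : U, YW u = Y₀ u) →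
      IsQuasiModule YW' → (∀ u : U, YW' u = Y₀ u) → YW = YW' := by
  have hqc := quasiCompatible_generatedSubspace hY₀
  have hmem : ∀ Z : V →ₗ[ℂ] VertexOperator ℂ W, IsQuasiModule Z → (∀ u : U, Z u = Y₀ u) →
      ∀ v, Z v ∈ generatedSubspace (Set.range Y₀) := fun Z hZ hext v =>
    hZ.mem_generatedSubspace hU hY₀ (fun u hu => ⟨⟨u, hu⟩, (hext ⟨u, hu⟩).symm⟩) v
  refine ⟨⟨?_, ?_⟩, ?_⟩
  · rintro ⟨Z, hZ, hext⟩
    have hm := hmem Z hZ hext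
    refine ⟨Z.codRestrict _ hm, hZ.map_vac, fun u v n => ?_⟩
    rw [LinearMap.codRestrict_apply, LinearMap.codRestrict_apply, ← hext]
    exact hZ.map_ncoeff (hqc.exists_clears (hm _) (hm _)) n
  · rintro ⟨f, hvac, hf⟩
    let Z : V →ₗ[ℂ] VertexOperator ℂ W := (generatedSubspace (Set.range Y₀)).subtype ∘ₗ f
    have hm : ∀ v, Z v ∈ generatedSubspace (Set.range Y₀) := fun v => (f v).2
    have hZ : ∀ u : U, Z u = Y₀ u := by
      intro u
      -- By the creation property u_{-1} 1 = u, while Y_W^0(u)_{-1} 1_W = Y_W^0(u).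
      have h := hf u NonlocalVertexAlgebra.vac (-1)
      rw [hvac, nthProd_idField_right, VertexOperator.ncoeff_apply,
        show -(-1 : ℤ) - 1 = 0 by norm_num, NonlocalVertexAlgebra.creation] at h
      exact h
    have hprod := map_ncoeff_of_generating hU hY₀ hm hvac (fun u hu v n => by
      rw [hZ ⟨u, hu⟩]
      exact hf ⟨u, hu⟩ v n)
    exact ⟨Z, isQuasiModule_of_map_ncoeff hvac (fun u v => hqc.exists_clears (hm u) (hm v)) hprod,
      hZ⟩
  · intro Z Z' hZ hext hZ' hext'
    have hm := hmem Z hZ hext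
    have hm' := hmem Z' hZ' hext'
    -- The equalizer of the two extensions contains U and the vacuum, and it is closed under
    -- products because both extensions respect them.
    refine LinearMap.ext fun v => forall_of_vertexSubalgebraSpan_eq_top hU (LinearMap.eqLocus Z Z')
      (fun u hu => (hext ⟨u, hu⟩).trans (hext' ⟨u, hu⟩).symm)
      (hZ.map_vac.trans hZ'.map_vac.symm) (fun a ha b hb n => ?_) v
    rw [LinearMap.mem_eqLocus] at ha hb ⊢
    rw [hZ.map_ncoeff (hqc.exists_clears (hm a) (hm b)),
      hZ'.map_ncoeff (hqc.exists_clears (hm' a) (hm' b)), ha, hb]
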